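/- Let $H=H_0+\delta H$ be a Hamiltonian on $n$ qubits, where $H_0=-\sum_{j=1}^m\alpha_jQ_j$ is a stabilizer Hamiltonian ($\alpha_j\in\mathbb R$; $Q_1,\dots,Q_m$ distinct, mutually commuting Pauli operators) and $\delta H=\sum_{i=1}^k\gamma_iP_i$ ($\gamma_i\in\mathbb R$; $P_1,\dots,P_k$ distinct, otherwise arbitrary Pauli operators); signs of Pauli operators are absorbed in the coefficients. Let $|K|$ be the dimension (number of independent generators, up to phases) of the group $K=\langle P_1,\dots,P_k\rangle$, and put $q=\min(|K|,n)$. There is one randomized classical algorithm (a program for a random access machine with unit-cost integer addition, truncated subtraction and comparison, fair coin flips, and exact real arithmetic: field operations, square roots, comparisons, and the computation of all real roots of a polynomial of degree at most $d$ at cost $(d+1)^3$) which, given the lists of the $\alpha_j,Q_j,\gamma_i,P_i$, always halts within time $O(n^3+m\,n^2+2^{3|K|})$, with an absolute implied constant, and samples an eigenstate of $H$ uniformly at random; so the time is $O(n^3+2^{3|K|})$ whenever $H_0$ has $m=O(n)$ terms. More precisely, for every such $H$ there are a Clifford circuit $C$ (of Hadamard, phase and CNOT gates) with $$CHC^\dagger=\sum_{x\in\{0,1\}^{n-q}}|x\rangle\langle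 x|\otimes\tilde H_x ,$$ where the $\tilde H_x$ are operators on $q$ qubits, and for each $x$ an orthonormal eigenbasis $(|\phi_{x,i}\rangle)_{i\in\{0,1\}^q}$ of $\tilde H_x$, with real eigenvalues $E_{x,i}$, such that the states $|\psi_{x,i}\rangle=C^\dagger(|x\rangle\otimes|\phi_{x,i}\rangle)$ form an orthonormal eigenbasis of $H$ with $H|\psi_{x,i}\rangle=E_{x,i}|\psi_{x,i}\rangle$, and on every sequence of coin flips the algorithm outputs the gates of $C$, a bitstring $x$ and the $2^q$ amplitudes of some $|\phi_{x,i}\rangle$, each of the $2^n$ pairs $(x,i)$ having probability exactly $2^{-n}$. -/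

import Mathlib

open scoped Matrix

namespace DopedStab

/-! ### Pauli operators and perturbed stabilizer Hamiltonians -/

/-- The four one-qubit Pauli letters. -/
inductive Letter where
  | I
  | X
  | Y
  | Z
  deriving DecidableEq

/-- The one-qubit Pauli matrices, indexed by `false = 0` and `true = 1`. -/
noncomputable def Letter.entry : Letter → Bool → Bool → ℂ
  | .I, a, b => if a = b then 1 else 0
  | .X, a, b => if a = b then 0 else 1
  | .Y, a, b => if a = b then 0 else if a then Complex.I else -Complex.I
  | .Z, a, b => if a = b then (if a then -1 else 1) else 0

/-- The symplectic representation (X-part, Z-part) of a letter. -/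
def Letter.symp : Letter → ZMod 2 × ZMod 2
  | .I => (0, 0)
  | .X => (1, 0)
  | .Y => (1, 1)
  | .Z => (0, 1)

/-- The number by which a letter is written in the memory of the machine. -/
def Letter.code : Letter → ℕ
  | .I => 0
  | .X => 1
  | .Y => 2
  | .Z => 3

/-- Labels of the computational basis states of `n` qubits. -/
abbrev Bits (n : ℕ) : Type := Fin n → Bool

/-- Hermitian Pauli operators on `n` qubits (phase `+1`). -/
abbrev PauliString (n : ℕ) : Type := Fin n → Letter

/-- The matrix of a Pauli string: the tensor product of its letters. -/
noncomputable def PauliString.mat {n : ℕ} (P : PauliString n) : Matrix (Bits n) (Bits n) ℂ :=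
  Matrix.of fun v w => ∏ i, (P i).entry (v i) (w i)

/-- The dimension of the group generated by a family of Pauli operators: the number of its
algebraically independent generators, phases being disregarded. Multiplication of Pauli
operators up to phase is addition of their symplectic representations. -/
noncomputable def pauliDim {n k : ℕ} (P : Fin k → PauliString n) : ℕ :=
  Module.finrank (ZMod 2)
    (Submodule.span (ZMod 2)
      (Set.range fun j : Fin k => (fun i : Fin n => (P j i).symp : Fin n → ZMod 2 × ZMod 2)))

/-- The data of `H = H₀ + δH`, with a stabilizer Hamiltonian `H₀ = -∑ α_j Q_j`, a combination of
`m` different commuting Pauli operators, and a perturbation `δH = ∑ γ_i P_i`, a combination of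
`k` different arbitrary Pauli operators. Signs of Pauli operators are part of the coefficients. -/
structure Hamiltonian (n m k : ℕ) where
  Q : Fin m → PauliString n
  α : Fin m → ℝ
  Q_injective : Function.Injective Q
  Q_commute : ∀ i j, Commute (Q i).mat (Q j).mat
  P : Fin k → PauliString n
  γ : Fin k → ℝ
  P_injective : Function.Injective P

/-- The Hamiltonian as a matrix. -/
noncomputable def Hamiltonian.mat {n m k : ℕ} (D : Hamiltonian n m k) :
    Matrix (Bits n) (Bits n) ℂ :=
  -(∑ j, (D.α j : ℂ) • (D.Q j).mat) + ∑ i, (D.γ i : ℂ) • (D.P i).mat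

/-- The dimension `|K|` of the group `K` generated by the perturbing Pauli operators. -/
noncomputable def Hamiltonian.dimK {n m k : ℕ} (D : Hamiltonian n m k) : ℕ := pauliDim D.P

/-! ### Clifford circuits -/

/-- The generating gates of the Clifford group: Hadamard, phase and controlled-not. -/
inductive Gate (n : ℕ) where
  | had (a : Fin n)
  | phase (a : Fin n)
  | cnot (a b : Fin n) (hab : a ≠ b)

/-- The unitary matrix of a gate. -/
noncomputable def Gate.mat {n : ℕ} : Gate n → Matrix (Bits n) (Bits n) ℂ
  | .had a => Matrix.of fun v w =>
      if ∀ i, i ≠ a → v i = w i then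
        (if v a && w a then -1 else 1) * ((Real.sqrt 2 : ℝ) : ℂ)⁻¹
      else 0
  | .phase a => Matrix.diagonal fun v => if v a then Complex.I else 1
  | .cnot a b _ => Matrix.of fun v w =>
      if v = Function.update w b (xor (w a) (w b)) then 1 else 0

/-- The numbers by which a gate is written in the memory of the machine:
kind of gate, first qubit, second qubit. -/
def Gate.code {n : ℕ} : Gate n → ℕ × ℕ × ℕ
  | .had a => (0, a, a)
  | .phase a => (1, a, a)
  | .cnot a b _ => (2, a, b)

/-- The Clifford unitary of a circuit; the head of the list is applied first. -/
noncomputable def circuitMat {n : ℕ} : List (Gate n) → Matrix (Bits n) (Bits n) ℂ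
  | [] => 1
  | g :: L => circuitMat L * g.mat

/-! ### Splitting `n` qubits into the first `n - q` and the last `q` -/

/-- The bits of the first `n - q` qubits. -/
def headBits {n : ℕ} (q : ℕ) (v : Bits n) : Bits (n - q) :=
  fun i => v ⟨i, by omega⟩

/-- The bits of the last `q` qubits. -/
def tailBits {n q : ℕ} (h : q ≤ n) (v : Bits n) : Bits q :=
  fun j => v ⟨n - q + j, by omega⟩

/-- The vector `|x⟩ ⊗ |φ⟩`. -/
noncomputable def tensorKet {n q : ℕ} (h : q ≤ n) (x : Bits (n - q)) (φ : Bits q → ℂ) :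
    Bits n → ℂ :=
  fun v => if headBits q v = x then φ (tailBits h v) else 0

/-- The block-diagonal matrix `∑ x, |x⟩⟨x| ⊗ B x`. -/
noncomputable def blockMat {n q : ℕ} (h : q ≤ n)
    (B : Bits (n - q) → Matrix (Bits q) (Bits q) ℂ) : Matrix (Bits n) (Bits n) ℂ :=
  Matrix.of fun v w =>
    if headBits q v = headBits q w then B (headBits q v) (tailBits h v) (tailBits h w) else 0

/-! ### The machine: a random access machine with exact real arithmetic and fair coins -/

/-- Memory: finitely many (as many as a program names) two-dimensional arrays of natural numbers
and of real numbers, and the tape of coin flips not yet used. -/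
structure Memory where
  nat : ℕ → ℕ → ℕ → ℕ
  real : ℕ → ℕ → ℕ → ℝ
  tape : ℕ → Bool

/-- Integer expressions: constants, array access, addition, truncated subtraction. -/
inductive NExp where
  | const (c : ℕ)
  | get (a : ℕ) (i j : NExp)
  | add (e f : NExp)
  | sub (e f : NExp)

/-- Value of an integer expression. -/
def NExp.eval (s : Memory) : NExp → ℕ
  | .const c => c
  | .get a i j => s.nat a (i.eval s) (j.eval s)
  | .add e f => e.eval s + f.eval s
  | .sub e f => e.eval s - f.eval s

/-- Real expressions: constants, array access, field operations, square roots. -/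
inductive RExp where
  | const (c : ℕ)
  | get (a : ℕ) (i j : NExp)
  | add (e f : RExp)
  | sub (e f : RExp)
  | mul (e f : RExp)
  | div (e f : RExp)
  | sqrt (e : RExp)

/-- Value of a real expression. -/
noncomputable def RExp.eval (s : Memory) : RExp → ℝ
  | .const c => c
  | .get a i j => s.real a (i.eval s) (j.eval s)
  | .add e f => e.eval s + f.eval s
  | .sub e f => e.eval s - f.eval s
  | .mul e f => e.eval s * f.eval s
  | .div e f => e.eval s / f.eval s
  | .sqrt e => Real.sqrt (e.eval s)

/-- Tests: comparison of two integers or of two real numbers. -/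
inductive Test where
  | le (e f : NExp)
  | rle (e f : RExp)

/-- Meaning of a test. -/
def Test.Holds (s : Memory) : Test → Prop
  | .le e f => e.eval s ≤ f.eval s
  | .rle e f => e.eval s ≤ f.eval s

/-- The real roots, with multiplicity and in increasing order, of the polynomial
`c 0 + c 1 X + ⋯ + c d X ^ d`. -/
noncomputable def realRoots (d : ℕ) (c : ℕ → ℝ) : List ℝ :=
  (∑ i ∈ Finset.range (d + 1), Polynomial.C (c i) * Polynomial.X ^ i).roots.sort (· ≤ ·)

/-- Write a natural number to entry `(i, j)` of array `a`. -/
def Memory.setNat (s : Memory) (a i j c : ℕ) : Memory :=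
  { s with nat := fun a' i' j' => if a' = a ∧ i' = i ∧ j' = j then c else s.nat a' i' j' }

/-- Write a real number to entry `(i, j)` of array `a`. -/
def Memory.setReal (s : Memory) (a i j : ℕ) (c : ℝ) : Memory :=
  { s with real := fun a' i' j' => if a' = a ∧ i' = i ∧ j' = j then c else s.real a' i' j' }

/-- Read the first `d + 1` entries of row `0` of `src` as coefficients of a polynomial and write
its real roots to the first `d` entries of row `0` of `dst` (padded with zeros). -/
noncomputable def Memory.setRoots (s : Memory) (src dst d : ℕ) : Memory :=
  { s with real := fun a' i' j' =>
      if a' = dst ∧ i' = 0 ∧ j' < d then (realRoots d (s.real src 0)).getD j' 0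
      else s.real a' i' j' }

/-- Write the next coin to entry `(i, j)` of array `a`. -/
def Memory.setCoin (s : Memory) (a i j : ℕ) : Memory :=
  { s.setNat a i j (s.tape 0).toNat with tape := fun l => s.tape (l + 1) }

/-- Programs. -/
inductive Program where
  | nop
  | setNat (a : ℕ) (i j : NExp) (e : NExp)
  | setReal (a : ℕ) (i j : NExp) (e : RExp)
  | coin (a : ℕ) (i j : NExp)
  | roots (src dst : ℕ) (d : NExp)
  | seq (p r : Program)
  | ite (b : Test) (p r : Program)
  | loop (b : Test) (p : Program)

/-- `Exec p s s' t`: the program `p`, started with memory `s`, halts with memory `s'` after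
time `t`. Every assignment, coin flip and test costs `1` (an expression of a fixed program has
a bounded number of operations); computing the real roots of a polynomial of degree at most `d`
costs `(d + 1) ^ 3`. -/
inductive Exec : Program → Memory → Memory → ℕ → Prop where
  | nop (s : Memory) : Exec .nop s s 1
  | setNat (s : Memory) (a : ℕ) (i j e : NExp) :
      Exec (.setNat a i j e) s (s.setNat a (i.eval s) (j.eval s) (e.eval s)) 1
  | setReal (s : Memory) (a : ℕ) (i j : NExp) (e : RExp) :
      Exec (.setReal a i j e) s (s.setReal a (i.eval s) (j.eval s) (e.eval s)) 1
  | coin (s : Memory) (a : ℕ) (i j : NExp) :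
      Exec (.coin a i j) s (s.setCoin a (i.eval s) (j.eval s)) 1
  | roots (s : Memory) (src dst : ℕ) (d : NExp) :
      Exec (.roots src dst d) s (s.setRoots src dst (d.eval s)) ((d.eval s + 1) ^ 3)
  | seq {p r : Program} {s s' s'' : Memory} {t t' : ℕ} :
      Exec p s s' t → Exec r s' s'' t' → Exec (.seq p r) s s'' (t + t')
  | iteTrue {b : Test} {p r : Program} {s s' : Memory} {t : ℕ} :
      b.Holds s → Exec p s s' t → Exec (.ite b p r) s s' (t + 1)
  | iteFalse {b : Test} {p r : Program} {s s' : Memory} {t : ℕ} :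
      ¬ b.Holds s → Exec r s s' t → Exec (.ite b p r) s s' (t + 1)
  | loopDone {b : Test} {p : Program} {s : Memory} :
      ¬ b.Holds s → Exec (.loop b p) s s 1
  | loopStep {b : Test} {p : Program} {s s' s'' : Memory} {t t' : ℕ} :
      b.Holds s → Exec p s s' t → Exec (.loop b p) s' s'' t' →
      Exec (.loop b p) s s'' (t + t' + 1)

/-- The law of an infinite sequence of independent fair coins. -/
noncomputable def coinMeasure : MeasureTheory.Measure (ℕ → Bool) :=
  MeasureTheory.Measure.infinitePi fun _ : ℕ => (PMF.uniformOfFintype Bool).toMeasure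

/-! ### Input and output format -/

/-- The initial memory: the numbers `n`, `m`, `k` in array `0`, the letters of the Pauli operators
of `H₀` in array `1` and of `δH` in array `2`, one operator per row, the coefficients in row `0` of
the real arrays `1` and `2`, zeros everywhere else. -/
noncomputable def Hamiltonian.input {n m k : ℕ} (D : Hamiltonian n m k) (ω : ℕ → Bool) :
    Memory where
  nat a i j :=
    if a = 0 ∧ i = 0 then
      (if j = 0 then n else if j = 1 then m else if j = 2 then k else 0)
    else if a = 1 then
      (if h : i < m ∧ j < n then (D.Q ⟨i, h.1⟩ ⟨j, h.2⟩).code else 0)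
    else if a = 2 then
      (if h : i < k ∧ j < n then (D.P ⟨i, h.1⟩ ⟨j, h.2⟩).code else 0)
    else 0
  real a i j :=
    if a = 1 ∧ i = 0 then (if h : j < m then D.α ⟨j, h⟩ else 0)
    else if a = 2 ∧ i = 0 then (if h : j < k then D.γ ⟨j, h⟩ else 0)
    else 0
  tape := ω

/-- The final memory describes the state `C† (|x⟩ ⊗ |φ⟩)`: it holds the number of gates of the
circuit `C` and the number `q` in row `0` of array `3`, the gates of `C` in array `4`, one per
row, the bits of `x` in row `0` of array `5`, and the real and imaginary parts of the `2 ^ q`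
amplitudes of `φ` in row `0` of the real arrays `3` and `4`. The amplitude of `y` has
position `∑ l, y l * 2 ^ l`. -/
def Outputs {n q : ℕ} (s : Memory) (C : List (Gate n)) (x : Bits (n - q))
    (φ : Bits q → ℂ) : Prop :=
  s.nat 3 0 0 = C.length ∧ s.nat 3 0 1 = q ∧
  (∀ t : Fin C.length, (s.nat 4 t 0, s.nat 4 t 1, s.nat 4 t 2) = (C.get t).code) ∧
  (∀ i : Fin (n - q), s.nat 5 0 i = (x i).toNat) ∧
  (∀ y : Bits q,
    s.real 3 0 (∑ l, (y l).toNat * 2 ^ (l : ℕ)) = (φ y).re ∧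
    s.real 4 0 (∑ l, (y l).toNat * 2 ^ (l : ℕ)) = (φ y).im)

end DopedStab

open DopedStab

namespace DopedStab

/-! ### Program logic -/

/-! The circuit comes from Gaussian elimination over the field with two elements. The `Q j` commute,
so they can be made diagonal one after the other. The operators already treated have Z-parts in
echelon form with pivots on the last `r` qubits. Commutation with them forbids any X-part of the
next operator on those qubits (`Tab.x_eq_false_of_commute`). What is left of it on the other qubits
is rotated to letters `Z` and reduced to one pivot, by gates that do not touch the earlier operators
(`runs_diag`). A second elimination, with controlled-nots only, moves the X-parts of the `P i` to at
most `q` last qubits; controlled-nots map products of `Z` to products of `Z`, so the first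
achievement survives (`runs_shrink`). Every term of the conjugated Hamiltonian is then diagonal on
the first `n - q` qubits, which is the block form (`GoodCircuit.eq_blockMat`). The rank `|K|` is
found by the first elimination as well, applied to commuting copies of the `P i` on `2 n` qubits
(`PauliString.double`, `Elim.finrank_eq`).

A block is a Hermitian matrix of size `d = 2 ^ q`, of which one eigenvector has to be found exactly
in time `O(d ^ 3)`. The Lanczos process with full orthogonalization, restarted from the next
standard basis vector whenever the current Krylov space is exhausted, yields an orthonormal basis in
which the matrix is tridiagonal (`Lanczos.tridiag`). The zeros of the subdiagonal cut it into
blocks. Inside one block the eigenvector equation is a three-term recurrence, solved by the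
polynomials `jacobi`, and the eigenvalues are the roots of the last polynomial. These roots are real
because the operator is symmetric, and simple because a multiple root would give a generalized
eigenvector (`Tridiag.card_roots`). A block of length `L` therefore has exactly `L` different
eigenvalues, and an index `i` lying in the block that starts at `S` can be assigned the root number
`i - S`. Over all `i` this is an orthonormal eigenbasis (`Tridiag.orthonormal`), each member of
which costs one root computation and `O(d ^ 2)` further operations.

The first `n - q` coins choose the block `x` and the next `q` coins the index `i`. All other parts
of the program ignore the tape (`Exec.withTape`), so the final memory, apart from the unread coins,
is a function of `(x, i)`. The eigenbasis asserted to exist is the one read off these final memories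
(`exists_final_states`). Different pairs give different outputs and the machine is deterministic, so
each pair is output exactly on a cylinder set of `n` coins.

The eliminations and the collection of coefficients take `O((m + k) (n ^ 2 + 1))` steps, the work on
one block `O(8 ^ q)`. Since the `P i` are distinct, `k ≤ 2 ^ |K|`, and `2 ^ |K| * n ^ 2` is at most
`n ^ 3 + 2 ^ (3 |K|)` (`Hamiltonian.terms_le`).

Programs are verified by triples `Runs` that carry a time bound, together with the frame relation
`Same`. -/

instance : Add NExp := ⟨.add⟩
instance : Sub NExp := ⟨.sub⟩
instance (c : ℕ) : OfNat NExp c := ⟨.const c⟩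
instance : Add RExp := ⟨.add⟩
instance : Sub RExp := ⟨.sub⟩
instance : Mul RExp := ⟨.mul⟩
instance : Div RExp := ⟨.div⟩
instance (c : ℕ) : OfNat RExp c := ⟨.const c⟩

@[simp] theorem NExp.eval_add (s : Memory) (e f : NExp) : (e + f).eval s = e.eval s + f.eval s := rfl
@[simp] theorem NExp.eval_sub (s : Memory) (e f : NExp) : (e - f).eval s = e.eval s - f.eval s := rfl
@[simp] theorem NExp.eval_ofNat (s : Memory) (c : ℕ) :
    NExp.eval s (no_index (OfNat.ofNat c : NExp)) = OfNat.ofNat c := rfl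
@[simp] theorem NExp.eval_get (s : Memory) (a : ℕ) (i j : NExp) :
    (NExp.get a i j).eval s = s.nat a (i.eval s) (j.eval s) := rfl
@[simp] theorem RExp.eval_add (s : Memory) (e f : RExp) : (e + f).eval s = e.eval s + f.eval s := rfl
@[simp] theorem RExp.eval_sub (s : Memory) (e f : RExp) : (e - f).eval s = e.eval s - f.eval s := rfl
@[simp] theorem RExp.eval_mul (s : Memory) (e f : RExp) : (e * f).eval s = e.eval s * f.eval s := rfl
@[simp] theorem RExp.eval_div (s : Memory) (e f : RExp) : (e / f).eval s = e.eval s / f.eval s := rfl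
@[simp] theorem RExp.eval_sqrt (s : Memory) (e : RExp) :
    (RExp.sqrt e).eval s = Real.sqrt (e.eval s) := rfl
@[simp] theorem RExp.eval_ofNat (s : Memory) (c : ℕ) :
    RExp.eval s (no_index (OfNat.ofNat c : RExp)) = ((OfNat.ofNat c : ℕ) : ℝ) := rfl
@[simp] theorem RExp.eval_get (s : Memory) (a : ℕ) (i j : NExp) :
    (RExp.get a i j).eval s = s.real a (i.eval s) (j.eval s) := rfl
@[simp] theorem Test.holds_le (s : Memory) (e f : NExp) :
    (Test.le e f).Holds s ↔ e.eval s ≤ f.eval s := Iff.rfl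
@[simp] theorem Test.holds_rle (s : Memory) (e f : RExp) :
    (Test.rle e f).Holds s ↔ e.eval s ≤ f.eval s := Iff.rfl

/-- The scalar integer variable `a`. -/
abbrev nv (a : ℕ) : NExp := .get a 0 0
/-- The scalar real variable `a`. -/
abbrev rv (a : ℕ) : RExp := .get a 0 0

infixr:60 " ;; " => Program.seq

/-- The program `p`, started in `s`, halts within time `T` in a state satisfying `Post`. -/
def Runs (p : Program) (s : Memory) (T : ℕ) (Post : Memory → Prop) : Prop :=
  ∃ s' t, Exec p s s' t ∧ t ≤ T ∧ Post s'

variable {p r : Program} {s : Memory} {T T₁ T₂ : ℕ} {Post Post' : Memory → Prop}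

theorem Runs.mono (h : Runs p s T₁ Post) (hT : T₁ ≤ T₂) (hP : ∀ s', Post s' → Post' s') :
    Runs p s T₂ Post' := by
  obtain ⟨s', t, h1, h2, h3⟩ := h
  exact ⟨s', t, h1, h2.trans hT, hP _ h3⟩

theorem Runs.nop (h : Post s) : Runs .nop s 1 Post := ⟨s, 1, .nop s, le_rfl, h⟩

theorem Runs.setNat {a : ℕ} {i j e : NExp}
    (h : Post (s.setNat a (i.eval s) (j.eval s) (e.eval s))) :
    Runs (.setNat a i j e) s 1 Post := ⟨_, 1, .setNat .., le_rfl, h⟩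

theorem Runs.setReal {a : ℕ} {i j : NExp} {e : RExp}
    (h : Post (s.setReal a (i.eval s) (j.eval s) (e.eval s))) :
    Runs (.setReal a i j e) s 1 Post := ⟨_, 1, .setReal .., le_rfl, h⟩

theorem Runs.coin {a : ℕ} {i j : NExp}
    (h : Post (s.setCoin a (i.eval s) (j.eval s))) :
    Runs (.coin a i j) s 1 Post := ⟨_, 1, .coin .., le_rfl, h⟩

theorem Runs.roots {a b : ℕ} {d : NExp} (h : Post (s.setRoots a b (d.eval s))) :
    Runs (.roots a b d) s ((d.eval s + 1) ^ 3) Post := ⟨_, _, .roots .., le_rfl, h⟩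

theorem Runs.seq (h : Runs p s T₁ fun s' => Runs r s' T₂ Post) :
    Runs (p ;; r) s (T₁ + T₂) Post := by
  obtain ⟨s', t, h1, h2, s'', t', h3, h4, h5⟩ := h
  exact ⟨s'', t + t', .seq h1 h3, Nat.add_le_add h2 h4, h5⟩

/-- Sequencing with the intermediate assertion made explicit. -/
theorem Runs.seq' {Mid : Memory → Prop} (h : Runs p s T₁ Mid)
    (h' : ∀ s', Mid s' → Runs r s' T₂ Post) : Runs (p ;; r) s (T₁ + T₂) Post :=
  .seq (h.mono le_rfl h')

theorem Runs.ite {b : Test} (h₁ : b.Holds s → Runs p s T Post)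
    (h₂ : ¬ b.Holds s → Runs r s T Post) : Runs (.ite b p r) s (T + 1) Post := by
  by_cases hb : b.Holds s
  · obtain ⟨s', t, h1, h2, h3⟩ := h₁ hb
    exact ⟨s', t + 1, .iteTrue hb h1, Nat.add_le_add_right h2 1, h3⟩
  · obtain ⟨s', t, h1, h2, h3⟩ := h₂ hb
    exact ⟨s', t + 1, .iteFalse hb h1, Nat.add_le_add_right h2 1, h3⟩

/-- The invariant is indexed by a counter that must drop by one at every passage, so entering the
body with counter zero is contradictory. Hence `M` bounds the number of passages; the loop may also
stop earlier. -/
theorem Runs.while {b : Test} {s : Memory} {Post : Memory → Prop} (I : ℕ → Memory → Prop) (M : ℕ)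
    (h0 : I M s)
    (hbody : ∀ i s', I i s' → b.Holds s' → ∃ i', i = i' + 1 ∧ Runs p s' T (I i'))
    (hQ : ∀ i s', I i s' → ¬ b.Holds s' → Post s') :
    Runs (.loop b p) s (M * (T + 1) + 1) Post := by
  induction M generalizing s with
  | zero =>
    by_cases hb : b.Holds s
    · obtain ⟨i', h, -⟩ := hbody 0 s h0 hb
      omega
    · exact ⟨s, 1, .loopDone hb, by omega, hQ _ _ h0 hb⟩
  | succ M ih =>
    by_cases hb : b.Holds s
    · obtain ⟨i', h, s', t, h1, h2, h3⟩ := hbody _ s h0 hb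
      obtain rfl : M = i' := by omega
      obtain ⟨s'', t', h4, h5, h6⟩ := ih h3
      exact ⟨s'', t + t' + 1, .loopStep hb h1 h4, by rw [Nat.add_mul]; omega, h6⟩
    · exact ⟨s, 1, .loopDone hb, by omega, hQ _ _ h0 hb⟩

/-- `for v = 0, …, N - 1 do p`. -/
def Program.forUp (v : ℕ) (N : NExp) (p : Program) : Program :=
  .setNat v 0 0 0 ;; .loop (.le (nv v + 1) N) (p ;; .setNat v 0 0 (nv v + 1))

/-- The bound `N` is evaluated anew at each test, which is why `hN` asks that it keep its value
under the invariant. Each passage costs the body, the increment and the test, hence `T + 2`. -/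
theorem Runs.forUp {v : ℕ} {N : NExp} {s : Memory} {Post : Memory → Prop} {M : ℕ}
    (I : ℕ → Memory → Prop)
    (h0 : I 0 (s.setNat v 0 0 0))
    (hN : ∀ i s', i ≤ M → I i s' → N.eval s' = M)
    (hbody : ∀ i s', i < M → I i s' → s'.nat v 0 0 = i →
      Runs p s' T fun s'' => s''.nat v 0 0 = i ∧ I (i + 1) (s''.setNat v 0 0 (i + 1)))
    (hQ : ∀ s', I M s' → s'.nat v 0 0 = M → Post s') :
    Runs (.forUp v N p) s (M * (T + 2) + 2) Post := by
  have := Runs.seq (p := .setNat v 0 0 0) (s := s) (T₁ := 1) (Post := Post)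
    (r := .loop (.le (nv v + 1) N) (p ;; .setNat v 0 0 (nv v + 1)))
    (T₂ := M * (T + 1 + 1) + 1) (Runs.setNat (Runs.while
      (fun k s' => k ≤ M ∧ I (M - k) s' ∧ s'.nat v 0 0 = M - k) M
      ⟨le_rfl, by simpa using h0, by simp [Memory.setNat]⟩ ?_ ?_))
  · refine this.mono (by simp only [Nat.mul_add]; omega) fun _ h => h
  · rintro k s' ⟨hk, hI, hv⟩ hb
    have hN' := hN _ _ (Nat.sub_le _ _) hI
    simp [hv, hN'] at hb
    obtain ⟨k', rfl⟩ : ∃ k', k = k' + 1 := ⟨k - 1, by omega⟩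
    refine ⟨k', rfl, Runs.seq' (hbody _ _ (by omega) hI hv) ?_⟩
    rintro s'' ⟨h1, h2⟩
    refine Runs.setNat ⟨by omega, ?_, ?_⟩
    · simp only [NExp.eval_add, NExp.eval_get, NExp.eval_ofNat, h1]
      rwa [show M - k' = M - (k' + 1) + 1 by omega]
    · simp [Memory.setNat, h1]; omega
  · rintro k s' ⟨hk, hI, hv⟩ hb
    have hN' := hN _ _ (Nat.sub_le _ _) hI
    simp [hv, hN'] at hb
    obtain rfl : k = 0 := by omega
    exact hQ _ (by simpa using hI) (by simpa using hv)

/-! ### Frame conditions -/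

/-- Two memories agree except on the listed integer and real arrays. -/
structure Same (N R : List ℕ) (s s' : Memory) : Prop where
  nat : ∀ a, a ∉ N → s'.nat a = s.nat a
  real : ∀ a, a ∉ R → s'.real a = s.real a
  tape : s'.tape = s.tape

variable {N N' R R' : List ℕ} {s' s'' : Memory}

theorem Same.refl (N R : List ℕ) (s : Memory) : Same N R s s := ⟨fun _ _ => rfl, fun _ _ => rfl, rfl⟩

theorem Same.trans (h : Same N R s s') (h' : Same N R s' s'') : Same N R s s'' :=
  ⟨fun a ha => (h'.nat a ha).trans (h.nat a ha), fun a ha => (h'.real a ha).trans (h.real a ha),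
    h'.tape.trans h.tape⟩

/-- The inclusions are Boolean computations, so that `decide` settles them for concrete lists of
arrays. -/
theorem Same.mono (h : Same N R s s') (hN : N.all (· ∈ N') = true) (hR : R.all (· ∈ R') = true) :
    Same N' R' s s' := by
  simp only [List.all_eq_true, decide_eq_true_eq] at hN hR
  exact ⟨fun a ha => h.nat a fun h => ha (hN _ h), fun a ha => h.real a fun h => ha (hR _ h), h.tape⟩

theorem Same.setNat (h : Same N R s s') {a : ℕ} (ha : a ∈ N) (i j c : ℕ) :
    Same N R s (s'.setNat a i j c) := by
  refine ⟨fun b hb => ?_, h.real, h.tape⟩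
  rw [← h.nat b hb]
  funext i' j'
  have : b ≠ a := fun e => hb (e ▸ ha)
  simp [Memory.setNat, this]

theorem Same.setReal (h : Same N R s s') {a : ℕ} (ha : a ∈ R) (i j : ℕ) (c : ℝ) :
    Same N R s (s'.setReal a i j c) := by
  refine ⟨h.nat, fun b hb => ?_, h.tape⟩
  rw [← h.real b hb]
  funext i' j'
  have : b ≠ a := fun e => hb (e ▸ ha)
  simp [Memory.setReal, this]

@[simp] theorem Memory.setNat_real (s : Memory) (a i j c : ℕ) : (s.setNat a i j c).real = s.real := rfl
@[simp] theorem Memory.setReal_nat (s : Memory) (a i j : ℕ) (c : ℝ) :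
    (s.setReal a i j c).nat = s.nat := rfl
@[simp] theorem Memory.setNat_tape (s : Memory) (a i j c : ℕ) : (s.setNat a i j c).tape = s.tape := rfl
@[simp] theorem Memory.setReal_tape (s : Memory) (a i j : ℕ) (c : ℝ) :
    (s.setReal a i j c).tape = s.tape := rfl
theorem Memory.setNat_nat (s : Memory) (a i j c a' i' j' : ℕ) :
    (s.setNat a i j c).nat a' i' j' = if a' = a ∧ i' = i ∧ j' = j then c else s.nat a' i' j' := rfl
theorem Memory.setReal_real (s : Memory) (a i j : ℕ) (c : ℝ) (a' i' j' : ℕ) :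
    (s.setReal a i j c).real a' i' j' =
      if a' = a ∧ i' = i ∧ j' = j then c else s.real a' i' j' := rfl
@[simp] theorem Memory.setNat_nat_ne (s : Memory) (a i j c a' : ℕ) (h : a' ≠ a) :
    (s.setNat a i j c).nat a' = s.nat a' := by
  funext i' j'; simp [Memory.setNat, h]
@[simp] theorem Memory.setNat_nat_same (s : Memory) (a i j c : ℕ) :
    (s.setNat a i j c).nat a i j = c := by simp [Memory.setNat]
@[simp] theorem Memory.setReal_real_ne (s : Memory) (a i j : ℕ) (c : ℝ) (a' : ℕ) (h : a' ≠ a) :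
    (s.setReal a i j c).real a' = s.real a' := by
  funext i' j'; simp [Memory.setReal, h]
@[simp] theorem Memory.setReal_real_same (s : Memory) (a i j : ℕ) (c : ℝ) :
    (s.setReal a i j c).real a i j = c := by simp [Memory.setReal]

/-! ### Loops that fill a row or accumulate a sum -/

/-- `arr[row][v] := e` for all `v < N`. -/
def Program.mapR (v : ℕ) (N : NExp) (arr : ℕ) (row : NExp) (e : RExp) : Program :=
  .forUp v N (.setReal arr row (nv v) e)

/-- In `he` one may assume that every entry not yet written still has its old value. Updates in
place, as in Gram–Schmidt, and table rows computed from earlier rows of the same array need this. -/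
theorem Runs.mapR {v : ℕ} {N : NExp} {arr : ℕ} {row : NExp} {e : RExp} {s : Memory}
    (M ρ : ℕ) (f : ℕ → ℝ)
    (hN : ∀ s', Same [v] [arr] s s' → N.eval s' = M)
    (hρ : ∀ s', Same [v] [arr] s s' → row.eval s' = ρ)
    (he : ∀ i s', i < M → Same [v] [arr] s s' → s'.nat v 0 0 = i →
      (∀ a b, ¬ (a = ρ ∧ b < i) → s'.real arr a b = s.real arr a b) → e.eval s' = f i) :
    Runs (.mapR v N arr row e) s (3 * M + 2) fun s' => Same [v] [arr] s s' ∧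
      ∀ a b, s'.real arr a b = if a = ρ ∧ b < M then f b else s.real arr a b := by
  refine (Runs.forUp (T := 1) (M := M) (fun i s' => Same [v] [arr] s s' ∧
      ∀ a b, s'.real arr a b = if a = ρ ∧ b < i then f b else s.real arr a b)
      ⟨(Same.refl _ _ _).setNat (by simp) _ _ _, by simp⟩ (fun i s' _ h => hN s' h.1) ?_
      fun s' h _ => h).mono (by omega) fun _ h => h
  rintro i s' hi ⟨h1, h2⟩ hv
  refine Runs.setReal ⟨hv, ((h1.setReal (by simp) _ _ _).setNat (by simp) _ _ _), fun a b => ?_⟩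
  have := he i s' hi h1 hv (fun a b hab => by rw [h2, if_neg hab])
  simp only [Memory.setNat_real, Memory.setReal_real, hρ s' h1, this, NExp.eval_get,
    NExp.eval_ofNat, hv, h2]
  by_cases h : a = ρ <;> by_cases h' : b = i
  · simp [h, h']
  · have : b < i + 1 ↔ b < i := by omega
    simp [h, h', this]
  · simp [h]
  · simp [h]

/-- `arr[row][v] := e` for all `v < N`. -/
def Program.mapN (v : ℕ) (N : NExp) (arr : ℕ) (row : NExp) (e : NExp) : Program :=
  .forUp v N (.setNat arr row (nv v) e)

theorem Runs.mapN {v : ℕ} {N : NExp} {arr : ℕ} {row : NExp} {e : NExp} {s : Memory}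
    (M ρ : ℕ) (f : ℕ → ℕ) (hav : arr ≠ v)
    (hN : ∀ s', Same [v, arr] [] s s' → N.eval s' = M)
    (hρ : ∀ s', Same [v, arr] [] s s' → row.eval s' = ρ)
    (he : ∀ i s', i < M → Same [v, arr] [] s s' → s'.nat v 0 0 = i →
      (∀ a b, ¬ (a = ρ ∧ b < i) → s'.nat arr a b = s.nat arr a b) → e.eval s' = f i) :
    Runs (.mapN v N arr row e) s (3 * M + 2) fun s' => Same [v, arr] [] s s' ∧
      ∀ a b, s'.nat arr a b = if a = ρ ∧ b < M then f b else s.nat arr a b := by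
  refine (Runs.forUp (T := 1) (M := M) (fun i s' => Same [v, arr] [] s s' ∧
      ∀ a b, s'.nat arr a b = if a = ρ ∧ b < i then f b else s.nat arr a b)
      ⟨(Same.refl _ _ _).setNat (by simp) _ _ _, by simp [hav]⟩ (fun i s' _ h => hN s' h.1) ?_
      fun s' h _ => h).mono (by omega) fun _ h => h
  rintro i s' hi ⟨h1, h2⟩ hv
  refine Runs.setNat ⟨by simp [hav.symm, hv], ((h1.setNat (by simp) _ _ _).setNat (by simp) _ _ _),
    fun a b => ?_⟩
  have := he i s' hi h1 hv (fun a b hab => by rw [h2, if_neg hab])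
  rw [Memory.setNat_nat_ne _ _ _ _ _ _ hav]
  simp only [Memory.setNat_nat, hρ s' h1, this, NExp.eval_get,
    NExp.eval_ofNat, hv, h2]
  by_cases h : a = ρ <;> by_cases h' : b = i
  · simp [h, h']
  · have : b < i + 1 ↔ b < i := by omega
    simp [h, h', this]
  · simp [h]
  · simp [h]

/-- `acc := ∑ v < N, e`. -/
def Program.sumR (v : ℕ) (N : NExp) (acc : ℕ) (e : RExp) : Program :=
  .setReal acc 0 0 0 ;; .forUp v N (.setReal acc 0 0 (rv acc + e))

theorem Runs.sumR {v : ℕ} {N : NExp} {acc : ℕ} {e : RExp} {s : Memory} (M : ℕ) (f : ℕ → ℝ)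
    (hN : ∀ s', Same [v] [acc] s s' → N.eval s' = M)
    (he : ∀ i s', i < M → Same [v] [acc] s s' → s'.nat v 0 0 = i → e.eval s' = f i) :
    Runs (.sumR v N acc e) s (3 * M + 3) fun s' => Same [v] [acc] s s' ∧
      s'.real acc 0 0 = ∑ i ∈ Finset.range M, f i := by
  refine (Runs.seq (Runs.setReal (Runs.forUp (T := 1) (M := M) (fun i s' => Same [v] [acc] s s' ∧
      s'.real acc 0 0 = ∑ i ∈ Finset.range i, f i)
      ⟨((Same.refl _ _ _).setReal (by simp) _ _ _).setNat (by simp) _ _ _, by simp⟩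
      (fun i s' _ h => hN s' h.1) ?_ fun s' h _ => h))).mono (by omega) fun _ h => h
  rintro i s' hi ⟨h1, h2⟩ hv
  refine Runs.setReal ⟨hv, ((h1.setReal (by simp) _ _ _).setNat (by simp) _ _ _), ?_⟩
  simp [he i s' hi h1 hv, h2, Finset.sum_range_succ]

/-- `acc := ∑ v < N, e`. -/
def Program.sumN (v : ℕ) (N : NExp) (acc : ℕ) (e : NExp) : Program :=
  .setNat acc 0 0 0 ;; .forUp v N (.setNat acc 0 0 (nv acc + e))

theorem Runs.sumN {v : ℕ} {N : NExp} {acc : ℕ} {e : NExp} {s : Memory} (M : ℕ) (f : ℕ → ℕ)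
    (hav : acc ≠ v)
    (hN : ∀ s', Same [v, acc] [] s s' → N.eval s' = M)
    (he : ∀ i s', i < M → Same [v, acc] [] s s' → s'.nat v 0 0 = i → e.eval s' = f i) :
    Runs (.sumN v N acc e) s (3 * M + 3) fun s' => Same [v, acc] [] s s' ∧
      s'.nat acc 0 0 = ∑ i ∈ Finset.range M, f i := by
  refine (Runs.seq (Runs.setNat (Runs.forUp (T := 1) (M := M)
      (fun i s' => Same [v, acc] [] s s' ∧ s'.nat acc 0 0 = ∑ i ∈ Finset.range i, f i)
      ⟨((Same.refl _ _ _).setNat (by simp) _ _ _).setNat (by simp) _ _ _, by simp [hav]⟩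
      (fun i s' _ h => hN s' h.1) ?_ fun s' h _ => h))).mono (by omega) fun _ h => h
  rintro i s' hi ⟨h1, h2⟩ hv
  refine Runs.setNat ⟨by simp [hav.symm, hv],
    ((h1.setNat (by simp) _ _ _).setNat (by simp) _ _ _), ?_⟩
  simp [he i s' hi h1 hv, h2, Finset.sum_range_succ, hav]

/-! ### Determinism and independence of unused coins -/

/-- Used for the probabilities: one sequence of coins cannot lead to two different outputs. -/
theorem Exec.deterministic {p : Program} {s s₁ s₂ : Memory} {t₁ t₂ : ℕ} (h₁ : Exec p s s₁ t₁)
    (h₂ : Exec p s s₂ t₂) : s₁ = s₂ := by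
  induction h₁ generalizing s₂ t₂ with
  | nop | setNat | setReal | coin | roots => cases h₂; rfl
  | seq _ _ ih1 ih2 =>
    cases h₂ with
    | seq a b =>
      obtain rfl := ih1 a
      exact ih2 b
  | iteTrue hb _ ih =>
    cases h₂ with
    | iteTrue _ a => exact ih a
    | iteFalse hb' _ => exact absurd hb hb'
  | iteFalse hb _ ih =>
    cases h₂ with
    | iteTrue hb' _ => exact absurd hb' hb
    | iteFalse _ a => exact ih a
  | loopDone hb =>
    cases h₂ with
    | loopDone => rfl
    | loopStep hb' => exact absurd hb' hb
  | loopStep hb _ _ ih1 ih2 =>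
    cases h₂ with
    | loopDone hb' => exact absurd hb hb'
    | loopStep _ a b =>
      obtain rfl := ih1 a
      exact ih2 b

/-- The program flips no coins. -/
def Program.coinFree : Program → Bool
  | .coin .. => false
  | .seq p r => p.coinFree && r.coinFree
  | .ite _ p r => p.coinFree && r.coinFree
  | .loop _ p => p.coinFree
  | _ => true

/-- The memory with another tape of coins. -/
def Memory.withTape (s : Memory) (τ : ℕ → Bool) : Memory := { s with tape := τ }

@[simp] theorem Memory.withTape_nat (s : Memory) (τ) : (s.withTape τ).nat = s.nat := rfl
@[simp] theorem Memory.withTape_real (s : Memory) (τ) : (s.withTape τ).real = s.real := rfl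
@[simp] theorem Memory.withTape_tape (s : Memory) (τ) : (s.withTape τ).tape = τ := rfl
@[simp] theorem Memory.withTape_withTape (s : Memory) (τ τ') :
    (s.withTape τ).withTape τ' = s.withTape τ' := rfl

@[simp] theorem NExp.eval_withTape (s : Memory) (τ : ℕ → Bool) (e : NExp) :
    e.eval (s.withTape τ) = e.eval s := by
  induction e with
  | const => rfl
  | get a i j hi hj => simp [hi, hj]
  | add e f he hf => simp [NExp.eval, he, hf]
  | sub e f he hf => simp [NExp.eval, he, hf]

@[simp] theorem RExp.eval_withTape (s : Memory) (τ : ℕ → Bool) (e : RExp) :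
    e.eval (s.withTape τ) = e.eval s := by
  induction e <;> simp_all [RExp.eval]

theorem Test.holds_withTape (s : Memory) (τ : ℕ → Bool) (b : Test) :
    b.Holds (s.withTape τ) ↔ b.Holds s := by
  cases b <;> simp [Test.Holds]

/-- Without coin flips the tape is never read, so a run found for one tape is a run for every tape.
This makes the final memories functions of the coins actually flipped. -/
theorem Exec.withTape {p : Program} {s s' : Memory} {t : ℕ} (h : Exec p s s' t)
    (hp : p.coinFree = true) (τ : ℕ → Bool) : Exec p (s.withTape τ) (s'.withTape τ) t := by
  induction h with
  | nop s => exact .nop _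
  | setNat s a i j e =>
    have := Exec.setNat (s.withTape τ) a i j e
    simp only [NExp.eval_withTape] at this
    exact this
  | setReal s a i j e =>
    have := Exec.setReal (s.withTape τ) a i j e
    simp only [NExp.eval_withTape, RExp.eval_withTape] at this
    exact this
  | coin => simp [Program.coinFree] at hp
  | roots s a b d =>
    have := Exec.roots (s.withTape τ) a b d
    simp only [NExp.eval_withTape] at this
    exact this
  | seq _ _ ih1 ih2 =>
    simp only [Program.coinFree, Bool.and_eq_true] at hp
    exact .seq (ih1 hp.1) (ih2 hp.2)
  | iteTrue hb _ ih =>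
    simp only [Program.coinFree, Bool.and_eq_true] at hp
    exact .iteTrue ((Test.holds_withTape ..).2 hb) (ih hp.1)
  | iteFalse hb _ ih =>
    simp only [Program.coinFree, Bool.and_eq_true] at hp
    exact .iteFalse (fun h => hb ((Test.holds_withTape ..).1 h)) (ih hp.2)
  | loopDone hb => exact .loopDone fun h => hb ((Test.holds_withTape ..).1 h)
  | loopStep hb _ _ ih1 ih2 =>
    exact .loopStep ((Test.holds_withTape ..).2 hb) (ih1 hp) (ih2 hp)

end DopedStab

namespace DopedStab

/-! ### Signed Pauli operators and the action of Clifford gates -/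

/-- A signed Pauli operator: X-part, Z-part and sign. -/
@[ext] structure Tab (n : ℕ) where
  x : Bits n
  z : Bits n
  r : Bool

/-- The letter with given X- and Z-part. -/
def letterOf : Bool → Bool → Letter
  | false, false => .I
  | true, false => .X
  | true, true => .Y
  | false, true => .Z

/-- X-part of a letter. -/
def Letter.xb : Letter → Bool
  | .I => false
  | .X => true
  | .Y => true
  | .Z => false

/-- Z-part of a letter. -/
def Letter.zb : Letter → Bool
  | .I => false
  | .X => false
  | .Y => true
  | .Z => true

theorem letterOf_bits (l : Letter) : letterOf l.xb l.zb = l := by cases l <;> rfl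

/-- The sign `(-1) ^ b`. -/
def sgn (b : Bool) : ℂ := if b then -1 else 1

theorem sgn_eq_one {b : Bool} : sgn b = 1 ↔ b = false := by
  cases b <;> norm_num [sgn]

variable {n : ℕ}

namespace Tab

/-- The Pauli string without its sign. -/
def letters (T : Tab n) : PauliString n := fun i => letterOf (T.x i) (T.z i)

/-- The matrix of a signed Pauli operator. -/
noncomputable def mat (T : Tab n) : Matrix (Bits n) (Bits n) ℂ := sgn T.r • T.letters.mat

end Tab

/-- A Pauli string with positive sign. -/
def PauliString.tab (P : PauliString n) : Tab n := ⟨fun i => (P i).xb, fun i => (P i).zb, false⟩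

theorem PauliString.mat_tab (P : PauliString n) : P.tab.mat = P.mat := by
  have : P.tab.letters = P := funext fun i => letterOf_bits _
  rw [Tab.mat, this]
  simp [PauliString.tab, sgn]

/-- Conjugation of a signed Pauli operator by a gate. -/
def Gate.act : Gate n → Tab n → Tab n
  | .had a, T => ⟨Function.update T.x a (T.z a), Function.update T.z a (T.x a),
      T.r ^^ (T.x a && T.z a)⟩
  | .phase a, T => ⟨T.x, Function.update T.z a (T.z a ^^ T.x a), T.r ^^ (T.x a && T.z a)⟩
  | .cnot a b _, T => ⟨Function.update T.x b (T.x b ^^ T.x a),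
      Function.update T.z a (T.z a ^^ T.z b),
      T.r ^^ (T.x a && T.z b && !(T.x b ^^ T.z a))⟩

/-- Conjugation of a signed Pauli operator by a circuit. -/
def actL (L : List (Gate n)) (T : Tab n) : Tab n := L.foldl (fun T g => g.act T) T

@[simp] theorem actL_nil (T : Tab n) : actL [] T = T := rfl
@[simp] theorem actL_append (L L' : List (Gate n)) (T : Tab n) :
    actL (L ++ L') T = actL L' (actL L T) := by simp [actL]
@[simp] theorem actL_cons (g : Gate n) (L : List (Gate n)) (T : Tab n) :
    actL (g :: L) T = actL L (g.act T) := rfl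

/-! ### Gates as matrices and their action on Pauli operators -/

theorem sum_eq_off (a : Fin n) (v : Bits n) (f : Bits n → ℂ) :
    (∑ u : Bits n, if ∀ i, i ≠ a → v i = u i then f u else 0) =
      f (Function.update v a true) + f (Function.update v a false) := by
  rw [← Finset.sum_filter]
  have : (Finset.univ.filter fun u : Bits n => ∀ i, i ≠ a → v i = u i) =
      {Function.update v a true, Function.update v a false} := by
    ext u
    simp only [Finset.mem_filter, Finset.mem_univ, true_and, Finset.mem_insert,
      Finset.mem_singleton]
    constructor
    · intro h
      cases hu : u a
      · right; ext i; by_cases hi : i = a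
        · subst hi; simp [hu]
        · simp [hi, h i hi]
      · left; ext i; by_cases hi : i = a
        · subst hi; simp [hu]
        · simp [hi, h i hi]
    · rintro (rfl | rfl) i hi <;> simp [hi]
  rw [this, Finset.sum_pair]
  intro h
  simpa using congrFun h a

/-- Isolates the tensor factor on which a gate acts. The remaining product is common to both sides
of an identity and can be generalized away, which leaves a check on finitely many bits. -/
theorem PauliString.mat_split (P : PauliString n) (a : Fin n) (v w : Bits n) :
    P.mat v w = (P a).entry (v a) (w a) *
      ∏ i ∈ Finset.univ.erase a, (P i).entry (v i) (w i) :=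
  (Finset.mul_prod_erase Finset.univ (fun i => (P i).entry (v i) (w i)) (Finset.mem_univ a)).symm

theorem PauliString.mat_split₂ (P : PauliString n) {a b : Fin n} (h : a ≠ b) (v w : Bits n) :
    P.mat v w = (P a).entry (v a) (w a) * ((P b).entry (v b) (w b) *
      ∏ i ∈ (Finset.univ.erase a).erase b, (P i).entry (v i) (w i)) := by
  rw [P.mat_split a, ← Finset.mul_prod_erase (Finset.univ.erase a) _ (Finset.mem_erase.2
    ⟨h.symm, Finset.mem_univ b⟩)]

/-- The permutation of the basis states performed by a controlled-not. -/
def cnotFun (a b : Fin n) (w : Bits n) : Bits n := Function.update w b (xor (w a) (w b))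

theorem cnotFun_cnotFun {a b : Fin n} (h : a ≠ b) (w : Bits n) :
    cnotFun a b (cnotFun a b w) = w := by
  ext i
  by_cases hi : i = b
  · subst hi; simp [cnotFun, h]
  · simp [cnotFun, hi]

theorem cnot_mul_apply {a b : Fin n} (h : a ≠ b) (M : Matrix (Bits n) (Bits n) ℂ) (v w : Bits n) :
    ((Gate.cnot a b h).mat * M) v w = M (cnotFun a b v) w := by
  rw [Matrix.mul_apply, Finset.sum_eq_single (cnotFun a b v)]
  · have : v = Function.update (cnotFun a b v) b (xor (cnotFun a b v a) (cnotFun a b v b)) :=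
      (cnotFun_cnotFun h v).symm
    simp only [Gate.mat, Matrix.of_apply]
    rw [if_pos this, one_mul]
  · intro u _ hu
    have : v ≠ Function.update u b (xor (u a) (u b)) := by
      rintro rfl
      exact hu (cnotFun_cnotFun h u).symm
    simp [Gate.mat, this]
  · simp

theorem mul_cnot_apply {a b : Fin n} (h : a ≠ b) (M : Matrix (Bits n) (Bits n) ℂ) (v w : Bits n) :
    (M * (Gate.cnot a b h).mat) v w = M v (cnotFun a b w) := by
  rw [Matrix.mul_apply, Finset.sum_eq_single (cnotFun a b w)]
  · simp [Gate.mat, cnotFun]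
  · intro u _ hu
    have : u ≠ Function.update w b (xor (w a) (w b)) := hu
    simp [Gate.mat, this]
  · simp

theorem had_mul_apply (a : Fin n) (M : Matrix (Bits n) (Bits n) ℂ) (v w : Bits n) :
    ((Gate.had a).mat * M) v w = ((Real.sqrt 2 : ℝ) : ℂ)⁻¹ *
      (sgn (v a) * M (Function.update v a true) w + M (Function.update v a false) w) := by
  rw [Matrix.mul_apply]
  have := sum_eq_off a v fun u => sgn (v a && u a) * ((Real.sqrt 2 : ℝ) : ℂ)⁻¹ * M u w
  refine Eq.trans (Finset.sum_congr rfl fun u _ => ?_) (this.trans ?_)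
  · simp only [Gate.mat, Matrix.of_apply, sgn]
    rw [ite_mul, zero_mul]
  · simp only [Function.update_self, Bool.and_true, Bool.and_false, sgn]
    split_ifs <;> ring_nf <;> simp_all

theorem mul_had_apply (a : Fin n) (M : Matrix (Bits n) (Bits n) ℂ) (v w : Bits n) :
    (M * (Gate.had a).mat) v w = ((Real.sqrt 2 : ℝ) : ℂ)⁻¹ *
      (sgn (w a) * M v (Function.update w a true) + M v (Function.update w a false)) := by
  rw [Matrix.mul_apply]
  have := sum_eq_off a w fun u => M v u * (sgn (u a && w a) * ((Real.sqrt 2 : ℝ) : ℂ)⁻¹)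
  refine Eq.trans (Finset.sum_congr rfl fun u _ => ?_) (this.trans ?_)
  · simp only [Gate.mat, Matrix.of_apply, sgn, eq_comm (a := w _)]
    rw [mul_ite, mul_zero]
  · simp only [Function.update_self, Bool.true_and, Bool.false_and, sgn]
    split_ifs <;> ring_nf <;> simp_all

/-- In this intertwining form no unitarity is needed. Once the qubits of the gate are split off,
both sides share the factor `R`, and the sign rules of `Gate.act` are verified on all values of the
bits involved. -/
theorem Gate.mat_mul_tab (g : Gate n) (T : Tab n) :
    g.mat * T.mat = (g.act T).mat * g.mat := by
  cases g with
  | had a =>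
    ext v w
    rw [had_mul_apply, mul_had_apply]
    simp only [Tab.mat, Matrix.smul_apply, smul_eq_mul]
    rw [PauliString.mat_split _ a, PauliString.mat_split _ a, PauliString.mat_split _ a,
      PauliString.mat_split _ a]
    have h1 : ∀ b : Bool, ∏ i ∈ Finset.univ.erase a, (T.letters i).entry (Function.update v a b i) (w i) =
        ∏ i ∈ Finset.univ.erase a, (T.letters i).entry (v i) (w i) := fun b =>
      Finset.prod_congr rfl fun i hi => by simp [Finset.ne_of_mem_erase hi]
    have h2 : ∀ b : Bool, ∏ i ∈ Finset.univ.erase a,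
        (((Gate.had a).act T).letters i).entry (v i) (Function.update w a b i) =
        ∏ i ∈ Finset.univ.erase a, (T.letters i).entry (v i) (w i) := fun b =>
      Finset.prod_congr rfl fun i hi => by
        simp [Finset.ne_of_mem_erase hi, Gate.act, Tab.letters]
    simp only [h1, h2]
    generalize ∏ i ∈ Finset.univ.erase a, (T.letters i).entry (v i) (w i) = R
    simp only [Tab.letters, Gate.act, Function.update_self]
    cases T.x a <;> cases T.z a <;> cases v a <;> cases w a <;> cases T.r <;>
      simp [letterOf, Letter.entry, sgn]
  | phase a =>
    ext v w
    simp only [Gate.mat, Matrix.diagonal_mul, Matrix.mul_diagonal]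
    simp only [Tab.mat, Matrix.smul_apply, smul_eq_mul]
    rw [PauliString.mat_split _ a, PauliString.mat_split _ a]
    have h2 : ∏ i ∈ Finset.univ.erase a, (((Gate.phase a).act T).letters i).entry (v i) (w i) =
        ∏ i ∈ Finset.univ.erase a, (T.letters i).entry (v i) (w i) :=
      Finset.prod_congr rfl fun i hi => by
        simp [Finset.ne_of_mem_erase hi, Gate.act, Tab.letters]
    simp only [h2]
    generalize ∏ i ∈ Finset.univ.erase a, (T.letters i).entry (v i) (w i) = R
    simp only [Tab.letters, Gate.act, Function.update_self]
    cases T.x a <;> cases T.z a <;> cases v a <;> cases w a <;> cases T.r <;>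
      simp [letterOf, Letter.entry, sgn] <;> ring_nf <;> simp
  | cnot a b h =>
    ext v w
    rw [cnot_mul_apply, mul_cnot_apply]
    simp only [Tab.mat, Matrix.smul_apply, smul_eq_mul]
    rw [PauliString.mat_split₂ _ h, PauliString.mat_split₂ _ h]
    have h2 : ∏ i ∈ (Finset.univ.erase a).erase b,
          (((Gate.cnot a b h).act T).letters i).entry (v i) (cnotFun a b w i) =
        ∏ i ∈ (Finset.univ.erase a).erase b, (T.letters i).entry (cnotFun a b v i) (w i) :=
      Finset.prod_congr rfl fun i hi => by
        have h1 := Finset.ne_of_mem_erase hi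
        have h2 := Finset.ne_of_mem_erase (Finset.mem_of_mem_erase hi)
        simp [h1, h2, Gate.act, Tab.letters, cnotFun]
    simp only [h2]
    generalize ∏ i ∈ (Finset.univ.erase a).erase b,
      (T.letters i).entry (cnotFun a b v i) (w i) = R
    simp only [Tab.letters, Gate.act, Function.update_self, cnotFun,
      Function.update_of_ne h, Function.update_of_ne h.symm]
    generalize T.x a = xa, T.z a = za, T.x b = xb, T.z b = zb, T.r = rr
    cases xa <;> cases za <;> cases xb <;> cases zb <;> simp only [letterOf, Bool.xor_false,
      Bool.xor_true, Bool.and_true, Bool.and_false, Bool.not_true, Bool.not_false] <;>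
      cases v a <;> cases v b <;> cases w a <;> cases w b <;> cases rr <;>
      simp [Letter.entry, sgn, ← mul_assoc]

theorem sqrt_two_inv_mul : ((Real.sqrt 2 : ℝ) : ℂ)⁻¹ * ((Real.sqrt 2 : ℝ) : ℂ)⁻¹ = 2⁻¹ := by
  rw [← mul_inv, ← Complex.ofReal_mul, Real.mul_self_sqrt (by norm_num)]
  simp

theorem Gate.mat_mul_conjTranspose (g : Gate n) : g.mat * g.matᴴ = 1 := by
  cases g with
  | had a =>
    have hH : (Gate.had a).matᴴ = (Gate.had a).mat := by
      ext v w
      simp only [Gate.mat, Matrix.conjTranspose_apply, Matrix.of_apply, eq_comm (a := w _),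
        Bool.and_comm (w a)]
      by_cases h : ∀ i, i ≠ a → v i = w i
      · rw [if_pos h]
        cases v a <;> cases w a <;> simp
      · rw [if_neg h, star_zero]
    rw [hH]
    ext v w
    rw [had_mul_apply]
    simp only [Gate.mat, Matrix.of_apply, Matrix.one_apply]
    have h1 : ∀ b, (∀ i, i ≠ a → Function.update v a b i = w i) ↔ ∀ i, i ≠ a → v i = w i :=
      fun b => forall_congr' fun i => ⟨fun h hi => by simpa [hi] using h hi,
        fun h hi => by simpa [hi] using h hi⟩
    simp only [h1]
    by_cases h : ∀ i, i ≠ a → v i = w i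
    · have h2 : v = w ↔ v a = w a := ⟨fun h => by rw [h], fun h' => funext fun i => by
        by_cases hi : i = a
        · exact hi ▸ h'
        · exact h i hi⟩
      simp only [if_pos h, h2, Function.update_self]
      have := sqrt_two_inv_mul
      cases v a <;> cases w a <;> simp [sgn] <;> linear_combination 2 * this
    · have h2 : v ≠ w := fun e => h fun i _ => by rw [e]
      simp [if_neg h, h2]
  | phase a =>
    simp only [Gate.mat, Matrix.diagonal_conjTranspose, Matrix.diagonal_mul_diagonal]
    rw [← Matrix.diagonal_one]
    congr 1
    ext v
    cases h : v a <;> simp [h]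
  | cnot a b h =>
    ext v w
    rw [cnot_mul_apply, Matrix.conjTranspose_apply]
    have : w = Function.update (cnotFun a b v) b (xor (cnotFun a b v a) (cnotFun a b v b)) ↔
      v = w := by
      rw [← cnotFun, cnotFun_cnotFun h, eq_comm]
    simp only [Gate.mat, Matrix.of_apply, this, Matrix.one_apply]
    split_ifs <;> simp

theorem circuitMat_mul_conjTranspose (L : List (Gate n)) :
    circuitMat L * (circuitMat L)ᴴ = 1 := by
  induction L with
  | nil => simp [circuitMat]
  | cons g L ih =>
    rw [circuitMat, Matrix.conjTranspose_mul, Matrix.mul_assoc, ← Matrix.mul_assoc g.mat,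
      g.mat_mul_conjTranspose, Matrix.one_mul, ih]

theorem conjTranspose_mul_circuitMat (L : List (Gate n)) :
    (circuitMat L)ᴴ * circuitMat L = 1 := mul_eq_one_comm.1 (circuitMat_mul_conjTranspose L)

theorem circuitMat_mul_tab (L : List (Gate n)) (T : Tab n) :
    circuitMat L * T.mat = (actL L T).mat * circuitMat L := by
  induction L generalizing T with
  | nil => simp [circuitMat]
  | cons g L ih =>
    rw [circuitMat, Matrix.mul_assoc, g.mat_mul_tab, ← Matrix.mul_assoc, ih, Matrix.mul_assoc,
      actL_cons]

theorem circuitMat_conj_tab (L : List (Gate n)) (T : Tab n) :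
    circuitMat L * T.mat * (circuitMat L)ᴴ = (actL L T).mat := by
  rw [circuitMat_mul_tab, Matrix.mul_assoc, circuitMat_mul_conjTranspose, Matrix.mul_one]

/-! ### Commutation -/

theorem PauliString.mat_mul_apply (P P' : PauliString n) (v w : Bits n) :
    (P.mat * P'.mat) v w = ∏ i, ∑ b, (P i).entry (v i) b * (P' i).entry b (w i) := by
  rw [Finset.prod_univ_sum, Fintype.piFinset_univ, Matrix.mul_apply]
  refine Finset.sum_congr rfl fun u _ => ?_
  rw [Finset.prod_mul_distrib]
  rfl

/-- The sign by which two Pauli operators commute. -/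
noncomputable def Tab.commSign (T T' : Tab n) : ℂ :=
  ∏ i, sgn ((T.x i && T'.z i) ^^ (T.z i && T'.x i))

theorem Tab.mat_mul_comm (T T' : Tab n) : T.mat * T'.mat = T.commSign T' • (T'.mat * T.mat) := by
  have : T.letters.mat * T'.letters.mat = T.commSign T' • (T'.letters.mat * T.letters.mat) := by
    ext v w
    rw [Matrix.smul_apply, PauliString.mat_mul_apply, PauliString.mat_mul_apply, Tab.commSign,
      smul_eq_mul, ← Finset.prod_mul_distrib]
    refine Finset.prod_congr rfl fun i _ => ?_
    simp only [Tab.letters]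
    cases T.x i <;> cases T.z i <;> cases T'.x i <;> cases T'.z i <;> cases v i <;> cases w i <;>
      simp [letterOf, Letter.entry, sgn]
  simp only [Tab.mat, Matrix.smul_mul, Matrix.mul_smul, this, smul_smul]
  congr 1
  ring

theorem Tab.mat_mul_self (T : Tab n) : T.mat * T.mat = 1 := by
  have : T.letters.mat * T.letters.mat = 1 := by
    ext v w
    rw [PauliString.mat_mul_apply, Matrix.one_apply]
    have h : ∀ i, (∑ b, (T.letters i).entry (v i) b * (T.letters i).entry b (w i)) =
        if v i = w i then 1 else 0 := fun i => by
      simp only [Tab.letters]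
      cases T.x i <;> cases T.z i <;> cases v i <;> cases w i <;> simp [letterOf, Letter.entry]
    simp only [h]
    split_ifs with hvw
    · simp [hvw]
    · obtain ⟨i, hi⟩ := Function.ne_iff.1 hvw
      exact Finset.prod_eq_zero (Finset.mem_univ i) (if_neg hi)
  simp only [Tab.mat, Matrix.smul_mul, Matrix.mul_smul, this, smul_smul]
  cases T.r <;> simp [sgn]

/-- If the operators commute, the product is annihilated by `1 - commSign`; both factors square to
the identity, so they can be cancelled and this scalar vanishes. -/
theorem Tab.commute_iff (T T' : Tab n) : Commute T.mat T'.mat ↔ T.commSign T' = 1 := by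
  constructor
  · intro h
    have h1 := T.mat_mul_comm T'
    rw [h.eq] at h1
    have h2 : (1 - T.commSign T') • (T'.mat * T.mat) = 0 := by
      rw [sub_smul, one_smul, ← h1, sub_self]
    have h3 : (1 - T.commSign T') • (1 : Matrix (Bits n) (Bits n) ℂ) = 0 := by
      have := congrArg (fun M => T'.mat * M * T.mat) h2
      simp only [Matrix.mul_smul, Matrix.smul_mul, Matrix.mul_zero, Matrix.zero_mul] at this
      rwa [← Matrix.mul_assoc, T'.mat_mul_self, Matrix.one_mul, T.mat_mul_self] at this
    have := congrFun (congrFun h3 fun _ => false) fun _ => false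
    simp only [Matrix.smul_apply, Matrix.one_apply_eq, smul_eq_mul, mul_one,
      Matrix.zero_apply] at this
    exact (sub_eq_zero.1 this).symm
  · intro h
    have := T.mat_mul_comm T'
    rwa [h, one_smul] at this

theorem commute_actL (L : List (Gate n)) {T T' : Tab n} (h : Commute T.mat T'.mat) :
    Commute (actL L T).mat (actL L T').mat := by
  rw [← circuitMat_conj_tab, ← circuitMat_conj_tab]
  have h1 := conjTranspose_mul_circuitMat L
  have key : ∀ A B : Matrix (Bits n) (Bits n) ℂ,
      circuitMat L * A * (circuitMat L)ᴴ * (circuitMat L * B * (circuitMat L)ᴴ) =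
      circuitMat L * (A * B) * (circuitMat L)ᴴ := fun A B => by
    calc _ = circuitMat L * A * ((circuitMat L)ᴴ * circuitMat L) * B * (circuitMat L)ᴴ := by
          simp only [Matrix.mul_assoc]
      _ = _ := by rw [h1]; simp only [Matrix.mul_assoc, Matrix.one_mul]
  rw [Commute, SemiconjBy, key, key, h.eq]

/-- Operators without X-part commute. -/
theorem Tab.commute_of_x_eq_false {T T' : Tab n} (h : ∀ i, T.x i = false)
    (h' : ∀ i, T'.x i = false) : Commute T.mat T'.mat :=
  (T.commute_iff T').2 (Finset.prod_eq_one fun i _ => by simp [h, h', sgn])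

/-- If `T'` is a product of `Z`s, the first of which stands at `p`, and commutes with `T`, which
has no X-part after `p`, then `T` has no X-part at `p` either. -/
theorem Tab.x_eq_false_of_commute {T T' : Tab n} (h : Commute T.mat T'.mat) (p : Fin n)
    (hx : ∀ i, T'.x i = false) (hz : ∀ i < p, T'.z i = false) (hp : T'.z p = true)
    (hT : ∀ i, p < i → T.x i = false) : T.x p = false := by
  have h1 := (T.commute_iff T').1 h
  -- Only `p` can contribute a sign: before `p` the operator `T'` is trivial, after `p` there is no
  -- X-part for its Z-part to meet.
  rw [Tab.commSign, Finset.prod_eq_single p] at h1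
  · simpa [hx, hp, sgn_eq_one] using h1
  · intro i _ hi
    rcases lt_or_gt_of_ne hi with hi | hi
    · simp [hx, hz i hi, sgn]
    · simp [hx, hT i hi, sgn]
  · simp

/-! ### Symplectic vectors -/

/-- A bit as an element of `ZMod 2`. -/
def b2z (b : Bool) : ZMod 2 := if b then 1 else 0

@[simp] theorem b2z_xor (a b : Bool) : b2z (a ^^ b) = b2z a + b2z b := by
  cases a <;> cases b <;> decide

@[simp] theorem b2z_false : b2z false = 0 := rfl
@[simp] theorem b2z_true : b2z true = 1 := rfl

/-- Vectors over `F₂` describing Pauli operators up to phase. -/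
abbrev SVec (n : ℕ) : Type := Fin n → ZMod 2 × ZMod 2

/-- The symplectic vector of a Pauli operator. -/
def Tab.vec (T : Tab n) : SVec n := fun i => (b2z (T.x i), b2z (T.z i))

/-- The linear map on symplectic vectors induced by a gate. -/
def Gate.lin : Gate n → SVec n →ₗ[ZMod 2] SVec n
  | .had a => LinearMap.pi fun i => if i = a then
      (LinearMap.prod (LinearMap.snd _ _ _) (LinearMap.fst _ _ _)).comp (LinearMap.proj a)
      else LinearMap.proj i
  | .phase a => LinearMap.pi fun i => if i = a then
      (LinearMap.prod (LinearMap.fst _ _ _) (LinearMap.fst _ _ _ + LinearMap.snd _ _ _)).comp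
        (LinearMap.proj a)
      else LinearMap.proj i
  | .cnot a b _ => LinearMap.pi fun i =>
      if i = a then LinearMap.prod ((LinearMap.fst _ _ _).comp (LinearMap.proj a))
        ((LinearMap.snd _ _ _).comp (LinearMap.proj a) +
          (LinearMap.snd _ _ _).comp (LinearMap.proj b))
      else if i = b then LinearMap.prod ((LinearMap.fst _ _ _).comp (LinearMap.proj b) +
          (LinearMap.fst _ _ _).comp (LinearMap.proj a))
        ((LinearMap.snd _ _ _).comp (LinearMap.proj b))
      else LinearMap.proj i

theorem Gate.vec_act (g : Gate n) (T : Tab n) : (g.act T).vec = g.lin T.vec := by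
  funext i
  cases g with
  | had a => by_cases h : i = a <;> simp [Tab.vec, Gate.act, Gate.lin, h]
  | phase a => by_cases h : i = a <;> simp [Tab.vec, Gate.act, Gate.lin, h, add_comm]
  | cnot a b hab =>
    by_cases h : i = a
    · subst h; simp [Tab.vec, Gate.act, Gate.lin, hab]
    · by_cases h' : i = b
      · subst h'; simp [Tab.vec, Gate.act, Gate.lin, h]
      · simp [Tab.vec, Gate.act, Gate.lin, h, h']

/-- Up to phases even the phase gate is an involution, its square being the Pauli operator `Z`.
Injectivity, and with it the invariance of the rank under a circuit, follows at once. -/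
theorem Gate.lin_involutive (g : Gate n) : Function.Involutive g.lin := by
  intro v
  have h2 : ∀ a b : ZMod 2, a + (a + b) = b := by decide
  have h3 : ∀ a b : ZMod 2, b + a + a = b := by decide
  funext i
  cases g with
  | had a => by_cases h : i = a <;> simp [Gate.lin, h]
  | phase a => by_cases h : i = a <;> simp [Gate.lin, h, h2]
  | cnot a b hab =>
    by_cases h : i = a
    · subst h; simp [Gate.lin, hab.symm, h3]
    · by_cases h' : i = b
      · subst h'; simp [Gate.lin, h, h3]
      · simp [Gate.lin, h, h']

/-- The linear map on symplectic vectors induced by a circuit. -/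
def linL : List (Gate n) → SVec n →ₗ[ZMod 2] SVec n
  | [] => LinearMap.id
  | g :: L => (linL L).comp g.lin

theorem vec_actL (L : List (Gate n)) (T : Tab n) : (actL L T).vec = linL L T.vec := by
  induction L generalizing T with
  | nil => rfl
  | cons g L ih => rw [actL_cons, ih, g.vec_act]; rfl

theorem linL_injective (L : List (Gate n)) : Function.Injective (linL L) := by
  induction L with
  | nil => exact Function.injective_id
  | cons g L ih => exact ih.comp g.lin_involutive.injective

end DopedStab

namespace DopedStab

/-! ### Programs acting on a signed Pauli operator held in memory -/

/-- Exclusive or of two bits. -/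
def NExp.bxor (e f : NExp) : NExp := (e - f) + (f - e)
/-- Conjunction of two bits. -/
def NExp.band (e f : NExp) : NExp := e - (e - f)

theorem NExp.eval_bxor {s : Memory} {e f : NExp} {a b : Bool} (he : e.eval s = a.toNat)
    (hf : f.eval s = b.toNat) : (e.bxor f).eval s = (a ^^ b).toNat := by
  simp only [NExp.bxor, NExp.eval_add, NExp.eval_sub, he, hf]
  cases a <;> cases b <;> rfl

theorem NExp.eval_band {s : Memory} {e f : NExp} {a b : Bool} (he : e.eval s = a.toNat)
    (hf : f.eval s = b.toNat) : (e.band f).eval s = (a && b).toNat := by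
  simp only [NExp.band, NExp.eval_sub, he, hf]
  cases a <;> cases b <;> rfl

theorem NExp.eval_not {s : Memory} {e : NExp} {a : Bool} (he : e.eval s = a.toNat) :
    (1 - e).eval s = (!a).toNat := by
  simp only [NExp.eval_sub, he, NExp.eval_ofNat]
  cases a <;> rfl

theorem one_le_toNat {b : Bool} : 1 ≤ b.toNat ↔ b = true := by cases b <;> simp

variable {n : ℕ}

/-- The memory holds the signed Pauli operator `T`. -/
structure TabAt (s : Memory) (T : Tab n) : Prop where
  x : ∀ i : Fin n, s.nat 10 0 i = (T.x i).toNat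
  z : ∀ i : Fin n, s.nat 11 0 i = (T.z i).toNat
  r : s.nat 12 0 0 = T.r.toNat

/-- The memory holds the circuit `L`. -/
structure CircAt (s : Memory) (L : List (Gate n)) : Prop where
  len : s.nat 7 0 0 = L.length
  gate : ∀ t (h : t < L.length), (s.nat 4 t 0, s.nat 4 t 1, s.nat 4 t 2) = (L[t]).code

theorem TabAt.same {s s' : Memory} {T : Tab n} (h : TabAt s T) {N R : List ℕ}
    (hS : Same N R s s') (hN : [10, 11, 12].all (· ∉ N) = true) : TabAt s' T := by
  simp at hN
  exact ⟨by rw [hS.nat _ hN.1]; exact h.x, by rw [hS.nat _ hN.2.1]; exact h.z,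
    by rw [hS.nat _ hN.2.2]; exact h.r⟩

theorem CircAt.same {s s' : Memory} {L : List (Gate n)} (h : CircAt s L) {N R : List ℕ}
    (hS : Same N R s s') (hN : [4, 7].all (· ∉ N) = true) : CircAt s' L := by
  simp at hN
  exact ⟨by rw [hS.nat _ hN.2]; exact h.len, by rw [hS.nat _ hN.1]; exact h.gate⟩

/-- Apply the gate described by the variables `16, 17, 18` to the Pauli operator in memory. -/
def actCore : Program :=
  let a := nv 17
  let b := nv 18
  let x : NExp → NExp := fun i => .get 10 0 i
  let z : NExp → NExp := fun i => .get 11 0 i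
  .ite (.le (nv 16) 0)
    -- The sign is updated first in all three cases because it depends on the old bits. Here
    -- variable `13` keeps the X-bit while the two bits are exchanged.
    (.setNat 12 0 0 ((nv 12).bxor ((x a).band (z a))) ;; .setNat 13 0 0 (x a) ;;
      .setNat 10 0 a (z a) ;; .setNat 11 0 a (nv 13))
  (.ite (.le (nv 16) 1)
    (.setNat 12 0 0 ((nv 12).bxor ((x a).band (z a))) ;;
      .setNat 11 0 a ((z a).bxor (x a)))
    (.setNat 12 0 0 ((nv 12).bxor (((x a).band (z b)).band (1 - (x b).bxor (z a)))) ;;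
      .setNat 10 0 b ((x b).bxor (x a)) ;;
      .setNat 11 0 a ((z a).bxor (z b))))

theorem runs_actCore {s : Memory} {T : Tab n} (g : Gate n) (hT : TabAt s T)
    (hg : (s.nat 16 0 0, s.nat 17 0 0, s.nat 18 0 0) = g.code) :
    Runs actCore s 6 fun s' => TabAt s' (g.act T) ∧ Same [10, 11, 12, 13] [] s s' := by
  cases g with
  | had a =>
    simp only [Gate.code, Prod.mk.injEq] at hg
    obtain ⟨h1, h2, h3⟩ := hg
    refine Runs.ite (T := 5) (fun _ => ?_) (fun h => absurd h (by simp [h1]))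
    refine Runs.mono (Runs.seq <| Runs.setNat <| Runs.seq <| Runs.setNat <| Runs.seq <|
      Runs.setNat <| Runs.setNat (Post := fun s' => TabAt s' ((Gate.had a).act T) ∧
        Same [10, 11, 12, 13] [] s s') ?_) (by norm_num) fun _ h => h
    rw [NExp.eval_bxor (a := T.r) (b := T.x a && T.z a) (by simp [hT.r])
      (NExp.eval_band (by simp [h2, hT.x]) (by simp [h2, hT.z]))]
    refine ⟨⟨fun i => ?_, fun i => ?_, ?_⟩, ?_⟩
    · by_cases hi : i = a
      · subst hi
        simp [h2, hT.x, hT.z, Gate.act]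
      · have hi' : (i : ℕ) ≠ a := fun h => hi (Fin.ext h)
        simp [h2, Gate.act, hi, hi', Memory.setNat_nat, hT.x]
    · by_cases hi : i = a
      · subst hi
        simp [h2, hT.x, Gate.act]
      · have hi' : (i : ℕ) ≠ a := fun h => hi (Fin.ext h)
        simp [h2, Gate.act, hi, hi', Memory.setNat_nat, hT.z]
    · simp [Gate.act]
    · exact ((((Same.refl _ _ _).setNat (by simp) _ _ _).setNat (by simp) _ _ _).setNat
        (by simp) _ _ _).setNat (by simp) _ _ _
  | phase a =>
    simp only [Gate.code, Prod.mk.injEq] at hg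
    obtain ⟨h1, h2, h3⟩ := hg
    refine Runs.ite (T := 5) (fun h => absurd h (by simp [h1])) (fun _ => ?_)
    refine Runs.ite (T := 4) (fun _ => ?_) (fun h => absurd h (by simp [h1]))
    refine Runs.mono (Runs.seq <| Runs.setNat <| Runs.setNat
      (Post := fun s' => TabAt s' ((Gate.phase a).act T) ∧
        Same [10, 11, 12, 13] [] s s') ?_) (by norm_num) fun _ h => h
    rw [NExp.eval_bxor (a := T.r) (b := T.x a && T.z a) (by simp [hT.r])
      (NExp.eval_band (by simp [h2, hT.x]) (by simp [h2, hT.z])),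
      NExp.eval_bxor (a := T.z a) (b := T.x a) (by simp [hT.z, h2]) (by simp [h2, hT.x])]
    refine ⟨⟨fun i => ?_, fun i => ?_, ?_⟩, ?_⟩
    · simp [Gate.act, hT.x]
    · by_cases hi : i = a
      · subst hi
        simp [h2, Gate.act]
      · have hi' : (i : ℕ) ≠ a := fun h => hi (Fin.ext h)
        simp [h2, Gate.act, hi, hi', Memory.setNat_nat, hT.z]
    · simp [Gate.act]
    · exact ((Same.refl _ _ _).setNat (by simp) _ _ _).setNat (by simp) _ _ _
  | cnot a b hab =>
    simp only [Gate.code, Prod.mk.injEq] at hg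
    obtain ⟨h1, h2, h3⟩ := hg
    have hab' : (a : ℕ) ≠ b := fun h => hab (Fin.ext h)
    refine Runs.ite (T := 5) (fun h => absurd h (by simp [h1])) (fun _ => ?_)
    refine Runs.ite (T := 4) (fun h => absurd h (by simp [h1])) (fun _ => ?_)
    refine Runs.mono (Runs.seq <| Runs.setNat <| Runs.seq <| Runs.setNat <| Runs.setNat
      (Post := fun s' => TabAt s' ((Gate.cnot a b hab).act T) ∧
        Same [10, 11, 12, 13] [] s s') ?_) (by norm_num) fun _ h => h
    rw [NExp.eval_bxor (s := s) (a := T.r) (b := T.x a && T.z b && !(T.x b ^^ T.z a)) (by simp [hT.r])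
      (NExp.eval_band (NExp.eval_band (by simp [h2, hT.x]) (by simp [h3, hT.z]))
        (NExp.eval_not (NExp.eval_bxor (by simp [h3, hT.x]) (by simp [h2, hT.z])))),
      NExp.eval_bxor (a := T.x b) (b := T.x a) (by simp [hT.x, h3]) (by simp [h2, hT.x]),
      NExp.eval_bxor (a := T.z a) (b := T.z b) (by simp [hT.z, h2]) (by simp [h3, hT.z])]
    refine ⟨⟨fun i => ?_, fun i => ?_, ?_⟩, ?_⟩
    · by_cases hi : i = b
      · subst hi
        simp [h3, Gate.act]
      · have hi' : (i : ℕ) ≠ b := fun h => hi (Fin.ext h)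
        simp [h3, Gate.act, hi, hi', Memory.setNat_nat, hT.x]
    · by_cases hi : i = a
      · subst hi
        simp [h2, Gate.act]
      · have hi' : (i : ℕ) ≠ a := fun h => hi (Fin.ext h)
        simp [h2, Gate.act, hi, hi', Memory.setNat_nat, hT.z]
    · simp [Gate.act]
    · exact (((Same.refl _ _ _).setNat (by simp) _ _ _).setNat (by simp) _ _ _).setNat
        (by simp) _ _ _

/-- Conjugate the Pauli operator in memory by the circuit in memory. -/
def conjProg : Program :=
  .forUp 22 (nv 7) (.setNat 16 0 0 (.get 4 (nv 22) 0) ;; .setNat 17 0 0 (.get 4 (nv 22) 1) ;;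
    .setNat 18 0 0 (.get 4 (nv 22) 2) ;; actCore)

theorem runs_conjProg {s : Memory} {T : Tab n} {L : List (Gate n)} (hT : TabAt s T)
    (hL : CircAt s L) : Runs conjProg s (L.length * 11 + 2) fun s' =>
      TabAt s' (actL L T) ∧ Same [10, 11, 12, 13, 16, 17, 18, 22] [] s s' := by
  refine Runs.forUp (T := 9) (M := L.length) (fun i s' => TabAt s' (actL (L.take i) T) ∧
      Same [10, 11, 12, 13, 16, 17, 18, 22] [] s s')
    ⟨?_, (Same.refl _ _ _).setNat (by simp) _ _ _⟩ ?_ ?_ ?_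
  · exact hT.same ((Same.refl [22] [] _).setNat (by simp) _ _ _) (by decide)
  · rintro i s' hi ⟨-, hS⟩
    simp [hS.nat, hL.len]
  · rintro i s' hi ⟨hT', hS⟩ hv
    have hS' : Same [10, 11, 12, 13, 16, 17, 18, 22] [] s
      (((s'.setNat 16 0 0 (s'.nat 4 i 0)).setNat 17 0 0 (s'.nat 4 i 1)).setNat 18 0 0
        (s'.nat 4 i 2)) :=
        ((hS.setNat (by simp) _ _ _).setNat (by simp) _ _ _).setNat (by simp) _ _ _
    refine Runs.seq (T₁ := 1) (T₂ := 8) <| Runs.setNat <| Runs.seq (T₁ := 1) (T₂ := 7) <|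
      Runs.setNat <| Runs.seq (T₁ := 1) (T₂ := 6) <| Runs.setNat ?_
    simp [hv]
    refine Runs.mono (runs_actCore (L[i]) (T := actL (L.take i) T) ?_ ?_) le_rfl ?_
    · exact hT'.same ((((Same.refl [16, 17, 18] [] s').setNat (by simp) _ _ _).setNat
        (by simp) _ _ _).setNat (by simp) _ _ _) (by decide)
    · simp [hS.nat, ← hL.gate i hi]
    · rintro s'' ⟨h1, h2⟩
      refine ⟨by simp [h2.nat, hv], ?_, ?_⟩
      · rw [List.take_succ_eq_append_getElem hi, actL_append, actL_cons, actL_nil]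
        exact h1.same ((Same.refl [22] [] _).setNat (by simp) _ _ _) (by decide)
      · exact (hS'.trans (h2.mono (by decide) (by decide))).setNat (by simp) _ _ _
  · rintro s' ⟨h1, h2⟩ -
    rw [List.take_length] at h1
    exact ⟨h1, h2⟩

/-- Append the gate with code `(k, a, b)` to the circuit and conjugate the Pauli operator by it. -/
def emit (k a b : NExp) : Program :=
  .setNat 16 0 0 k ;; .setNat 17 0 0 a ;; .setNat 18 0 0 b ;;
  .setNat 4 (nv 7) 0 (nv 16) ;; .setNat 4 (nv 7) 1 (nv 17) ;; .setNat 4 (nv 7) 2 (nv 18) ;;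
  .setNat 7 0 0 (nv 7 + 1) ;; actCore

/-- The three expressions are evaluated one after the other while the variables `16`, `17`, `18` are
being written; therefore `hg` is required for all memories that differ only there. -/
theorem runs_emit {s : Memory} {T : Tab n} {L : List (Gate n)} (g : Gate n) {k a b : NExp}
    (hT : TabAt s T) (hL : CircAt s L)
    (hg : ∀ s', Same [16, 17, 18] [] s s' → (k.eval s', a.eval s', b.eval s') = g.code) :
    Runs (emit k a b) s 13 fun s' => TabAt s' (g.act T) ∧ CircAt s' (L ++ [g]) ∧
      Same [4, 7, 10, 11, 12, 13, 16, 17, 18] [] s s' := by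
  have e0 := hg s (Same.refl _ _ _)
  have S1 : Same [16, 17, 18] [] s (s.setNat 16 0 0 g.code.1) :=
    (Same.refl _ _ _).setNat (by simp) _ _ _
  have e1 := hg _ S1
  have S2 := S1.setNat (a := 17) (by simp) 0 0 g.code.2.1
  have e2 := hg _ S2
  have S3 := S2.setNat (a := 18) (by simp) 0 0 g.code.2.2
  rw [Prod.ext_iff, Prod.ext_iff] at e0 e1 e2
  dsimp only at e0 e1 e2
  refine Runs.seq (T₁ := 1) (T₂ := 12) <| Runs.setNat ?_
  rw [e0.1, NExp.eval_ofNat]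
  refine Runs.seq (T₁ := 1) (T₂ := 11) <| Runs.setNat ?_
  rw [e1.2.1, NExp.eval_ofNat]
  refine Runs.seq (T₁ := 1) (T₂ := 10) <| Runs.setNat ?_
  rw [e2.2.2, NExp.eval_ofNat]
  generalize hs1 : ((s.setNat 16 0 0 g.code.1).setNat 17 0 0 g.code.2.1).setNat 18 0 0 g.code.2.2
    = s₁ at S3
  have hc1 : s₁.nat 16 0 0 = g.code.1 := by simp [← hs1]
  have hc2 : s₁.nat 17 0 0 = g.code.2.1 := by simp [← hs1]
  have hc3 : s₁.nat 18 0 0 = g.code.2.2 := by simp [← hs1]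
  have hlen : s₁.nat 7 0 0 = L.length := by simp [S3.nat, hL.len]
  refine Runs.seq (T₁ := 1) (T₂ := 9) <| Runs.setNat <| Runs.seq (T₁ := 1) (T₂ := 8) <|
    Runs.setNat <| Runs.seq (T₁ := 1) (T₂ := 7) <| Runs.setNat <|
    Runs.seq (T₁ := 1) (T₂ := 6) <| Runs.setNat ?_
  simp [hc1, hc2, hc3, hlen]
  generalize hs2 : (((s₁.setNat 4 L.length 0 g.code.1).setNat 4 L.length 1 g.code.2.1).setNat
    4 L.length 2 g.code.2.2).setNat 7 0 0 (L.length + 1) = s₂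
  have S4 : Same [4, 7] [] s₁ s₂ := by
    rw [← hs2]
    exact ((((Same.refl _ _ _).setNat (by simp) _ _ _).setNat (by simp) _ _ _).setNat (by simp)
      _ _ _).setNat (by simp) _ _ _
  refine Runs.mono (runs_actCore g (T := T) ?_ ?_) le_rfl ?_
  · exact (hT.same S3 (by decide)).same S4 (by decide)
  · simp [S4.nat, hc1, hc2, hc3]
  · rintro s' ⟨h1, h2⟩
    refine ⟨h1, CircAt.same ⟨?_, fun t ht => ?_⟩ h2 (by decide), ?_⟩
    · simp [← hs2]
    · simp only [List.length_append, List.length_singleton] at ht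
      by_cases h : t < L.length
      · have h' : t ≠ L.length := h.ne
        rw [List.getElem_append_left h, ← hL.gate t h]
        simp [← hs2, Memory.setNat_nat, h', S3.nat]
      · obtain rfl : t = L.length := by omega
        rw [List.getElem_append_right le_rfl]
        simp [← hs2, Memory.setNat_nat]
    · exact ((S3.mono (by decide) (by decide)).trans (S4.mono (by decide) (by decide))).trans
        (h2.mono (by decide) (by decide))

/-- Read operator number `nv 20` of array `A` into the working Pauli operator. -/
def loadProg (A : ℕ) : Program :=
  let c : NExp := .get A (nv 20) (nv 21)
  -- The letters `I, X, Y, Z` have codes `0, 1, 2, 3`. With truncated subtraction `c - (c - 1)`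
  -- indicates `c ≥ 1`, `c - 2` indicates `c = 3`, and `(c - 1) - (c - 2)` indicates `c ≥ 2`.
  .mapN 21 (nv 6) 10 0 ((c - (c - 1)) - (c - 2)) ;;
  .mapN 21 (nv 6) 11 0 ((c - 1) - (c - 2)) ;; .setNat 12 0 0 0

theorem runs_loadProg {A : ℕ} {s : Memory} {j : ℕ} {P : PauliString n}
    (hA : A ∉ [10, 11, 12, 21]) (hn : s.nat 6 0 0 = n) (hj : s.nat 20 0 0 = j)
    (hP : ∀ i : Fin n, s.nat A j i = (P i).code) :
    Runs (loadProg A) s (6 * n + 5) fun s' => TabAt s' P.tab ∧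
      Same [10, 11, 12, 21] [] s s' := by
  simp at hA
  have c1 : ∀ i : Fin n, (P i).code - ((P i).code - 1) - ((P i).code - 2) = ((P i).xb).toNat :=
    fun i => by cases P i <;> rfl
  have c2 : ∀ i : Fin n, (P i).code - 1 - ((P i).code - 2) = ((P i).zb).toNat :=
    fun i => by cases P i <;> rfl
  refine (Runs.seq' (T₁ := 3 * n + 2) (T₂ := 3 * n + 2 + 1) (Runs.mapN n 0
    (fun i => if h : i < n then ((P ⟨i, h⟩).xb).toNat else 0) (by simp)
    (fun s' h => by simp [h.nat, hn]) (fun s' h => by simp) ?_) ?_).mono (by omega) fun _ h => h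
  · intro i s' hi hS hv _
    have := hP ⟨i, hi⟩
    simp only at this
    simp [hS.nat, hA, hv, hj, this, hi, c1]
  · rintro s₁ ⟨S1, h1⟩
    refine Runs.seq' (Runs.mapN n 0
      (fun i => if h : i < n then ((P ⟨i, h⟩).zb).toNat else 0) (by simp)
      (fun s' h => by simp [h.nat, S1.nat, hn]) (fun s' h => by simp) ?_) ?_
    · intro i s' hi hS hv _
      have := hP ⟨i, hi⟩
      simp only at this
      simp [hS.nat, hA, hv, S1.nat, hj, this, hi, c2]
    · rintro s₂ ⟨S2, h2⟩
      refine Runs.setNat ⟨⟨fun i => ?_, fun i => ?_, ?_⟩, ?_⟩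
      · simp [S2.nat, h1, PauliString.tab]
      · simp [h2, PauliString.tab]
      · simp [PauliString.tab]
      · exact ((S1.mono (by decide) (by decide)).trans (S2.mono (by decide) (by decide))).setNat
          (by simp) _ _ _

end DopedStab

namespace DopedStab

variable {n : ℕ}

/-! ### Elimination: gates acting on the first qubits -/

/-- The gate acts on the first `N` qubits. -/
def Gate.Below (N : ℕ) : Gate n → Prop
  | .had a => a < N
  | .phase a => a < N
  | .cnot a b _ => a < N ∧ b < N

/-- The gate is a controlled-not. -/
def Gate.IsCnot : Gate n → Prop
  | .cnot .. => True
  | _ => False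

theorem Gate.act_x_of_le {N : ℕ} {g : Gate n} (h : g.Below N) (T : Tab n) {i : Fin n}
    (hi : N ≤ i) : (g.act T).x i = T.x i := by
  have ne : ∀ a : Fin n, (a : ℕ) < N → i ≠ a := fun a ha e => by subst e; omega
  cases g with
  | had a => simp [Gate.act, ne a h]
  | phase a => simp [Gate.act]
  | cnot a b _ => simp [Gate.act, ne b h.2]

theorem actL_x_of_le {N : ℕ} {M : List (Gate n)} (h : ∀ g ∈ M, g.Below N) (T : Tab n) {i : Fin n}
    (hi : N ≤ i) : (actL M T).x i = T.x i := by
  induction M generalizing T with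
  | nil => rfl
  | cons g M ih =>
    rw [actL_cons, ih (fun g hg => h g (by simp [hg])), Gate.act_x_of_le (h g (by simp)) T hi]

/-- Operators already eliminated are trivial on the first `N` qubits, so later gates confined to
these qubits do not change them, not even in sign. -/
theorem Gate.act_eq_self {N : ℕ} {g : Gate n} (h : g.Below N) {T : Tab n}
    (hx : ∀ i : Fin n, i < N → T.x i = false) (hz : ∀ i : Fin n, i < N → T.z i = false) :
    g.act T = T := by
  cases g with
  | had a =>
    have h1 := hx a h; have h2 := hz a h
    simp only [Gate.act, h1, h2]
    rw [← h1, Function.update_eq_self, h1, ← h2, Function.update_eq_self]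
    simp [h2]
  | phase a =>
    have h1 := hx a h; have h2 := hz a h
    simp [Gate.act, h1]
  | cnot a b _ =>
    have h1 := hx a h.1; have h2 := hz b h.2
    simp [Gate.act, h1, h2]

theorem actL_eq_self {N : ℕ} {M : List (Gate n)} (h : ∀ g ∈ M, g.Below N) {T : Tab n}
    (hx : ∀ i : Fin n, i < N → T.x i = false) (hz : ∀ i : Fin n, i < N → T.z i = false) :
    actL M T = T := by
  induction M with
  | nil => rfl
  | cons g M ih =>
    rw [actL_cons, Gate.act_eq_self (h g (by simp)) hx hz, ih fun g hg => h g (by simp [hg])]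

/-- A controlled-not changes an X-part only by copying it from the control, and there is nothing to
copy below `N`. This protects both the diagonal operators and the operators already shrunk during
the second elimination. -/
theorem Gate.act_x_of_cnot {N : ℕ} {g : Gate n} (h : g.Below N) (hc : g.IsCnot) {T : Tab n}
    (hx : ∀ i : Fin n, i < N → T.x i = false) : (g.act T).x = T.x := by
  cases g with
  | had a => exact hc.elim
  | phase a => exact hc.elim
  | cnot a b _ =>
    have h1 := hx a h.1
    simp [Gate.act, h1]

theorem actL_x_of_cnot {N : ℕ} {M : List (Gate n)} (h : ∀ g ∈ M, g.Below N ∧ g.IsCnot) {T : Tab n}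
    (hx : ∀ i : Fin n, i < N → T.x i = false) : (actL M T).x = T.x := by
  induction M generalizing T with
  | nil => rfl
  | cons g M ih =>
    have h1 := Gate.act_x_of_cnot (h g (by simp)).1 (h g (by simp)).2 hx
    rw [actL_cons, ih (fun g hg => h g (by simp [hg])) (by rw [h1]; exact hx), h1]

/-- The part of the operator that is eliminated: the X-part if `d`, otherwise the Z-part. -/
def Tab.main (d : Bool) (T : Tab n) : Bits n := if d then T.x else T.z

/-- The controlled-not that adds the entry at `p` of the main part to the entry at `i`. -/
def addGate (d : Bool) (i p : Fin n) (h : i ≠ p) : Gate n :=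
  if d then .cnot p i h.symm else .cnot i p h

/-- X-parts travel from control to target and Z-parts from target to control; this is why the
direction of the gate in `addGate` depends on `d`. -/
theorem main_addGate (d : Bool) {i p : Fin n} (h : i ≠ p) (T : Tab n) :
    ((addGate d i p h).act T).main d =
      Function.update (T.main d) i (T.main d i ^^ T.main d p) := by
  cases d <;> simp [addGate, Tab.main, Gate.act]

theorem addGate_isCnot (d : Bool) {i p : Fin n} (h : i ≠ p) : (addGate d i p h).IsCnot := by
  cases d <;> simp [addGate, Gate.IsCnot]

theorem addGate_below (d : Bool) {i p : Fin n} (h : i ≠ p) {N : ℕ} (hi : i < N) (hp : p < N) :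
    (addGate d i p h).Below N := by
  cases d <;> simp [addGate, Gate.Below, hi, hp]

/-- The state of an elimination: the circuit `L` has brought the main parts of the first `j`
operators into echelon form, supported on the last `r` qubits. -/
structure Elim (d : Bool) (F : ℕ → Tab n) (j r : ℕ) (L : List (Gate n)) : Prop where
  le : r ≤ n
  zero : ∀ j' < j, ∀ i : Fin n, i < n - r → (actL L (F j')).main d i = false
  tri : ∀ p : Fin n, n - r ≤ p → ∃ j' < j, (actL L (F j')).main d p = true ∧
    ∀ i < p, (actL L (F j')).main d i = false

theorem Elim.succ {d : Bool} {F : ℕ → Tab n} {j r : ℕ} {L : List (Gate n)} (h : Elim d F j r L)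
    (hj : ∀ i : Fin n, i < n - r → (actL L (F j)).main d i = false) : Elim d F (j + 1) r L where
  le := h.le
  zero j' hj' i hi := by
    rcases Nat.lt_succ_iff_lt_or_eq.1 hj' with h' | rfl
    · exact h.zero j' h' i hi
    · exact hj i hi
  tri p hp := by
    obtain ⟨j', h1, h2⟩ := h.tri p hp
    exact ⟨j', h1.trans (Nat.lt_succ_self j), h2⟩

/-- The case in which operator `j` supplies a new pivot. It stands at position `n - r - 1`, directly
before the old pivots, and the new gates `M` must not disturb the main parts of the earlier
operators. -/
theorem Elim.succ' {d : Bool} {F : ℕ → Tab n} {j r : ℕ} {L M : List (Gate n)}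
    (h : Elim d F j r L) (hM : ∀ j' < j, (actL M (actL L (F j'))).main d = (actL L (F j')).main d)
    (p : Fin n) (hp : (p : ℕ) + 1 = n - r) (h1 : (actL (L ++ M) (F j)).main d p = true)
    (h0 : ∀ i < p, (actL (L ++ M) (F j)).main d i = false) :
    Elim d F (j + 1) (r + 1) (L ++ M) where
  le := by omega
  zero j' hj' i hi := by
    rcases Nat.lt_succ_iff_lt_or_eq.1 hj' with h' | rfl
    · rw [actL_append, hM j' h']
      exact h.zero j' h' i (by omega)
    · exact h0 i (by rw [Fin.lt_def]; omega)
  tri p' hp' := by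
    by_cases hpp : p' = p
    · subst hpp
      exact ⟨j, Nat.lt_succ_self j, h1, h0⟩
    · have : (p' : ℕ) ≠ p := fun e => hpp (Fin.ext e)
      obtain ⟨j', h1, h2⟩ := h.tri p' (by omega)
      refine ⟨j', h1.trans (Nat.lt_succ_self j), ?_⟩
      rwa [actL_append, hM j' h1]

/-! ### Elimination: programs -/

/-- The array holding the main part. -/
def mainArr (d : Bool) : ℕ := if d then 10 else 11

theorem TabAt.main {s : Memory} {T : Tab n} (h : TabAt s T) (d : Bool) (i : Fin n) :
    s.nat (mainArr d) 0 i = (T.main d i).toNat := by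
  cases d
  · exact h.z i
  · exact h.x i

/-- Emit the gate `addGate d i p`. -/
def emitAdd (d : Bool) (i p : NExp) : Program :=
  emit 2 (if d then p else i) (if d then i else p)

theorem runs_emitAdd {s : Memory} {T : Tab n} {L : List (Gate n)} (d : Bool) {i p : Fin n}
    (h : i ≠ p) {ei ep : NExp} (hT : TabAt s T) (hL : CircAt s L)
    (hi : ∀ s', Same [16, 17, 18] [] s s' → ei.eval s' = i)
    (hp : ∀ s', Same [16, 17, 18] [] s s' → ep.eval s' = p) :
    Runs (emitAdd d ei ep) s 13 fun s' => TabAt s' ((addGate d i p h).act T) ∧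
      CircAt s' (L ++ [addGate d i p h]) ∧ Same [4, 7, 10, 11, 12, 13, 16, 17, 18] [] s s' :=
  runs_emit _ hT hL fun s' hS => by
    cases d <;> simp [addGate, Gate.code, hi s' hS, hp s' hS]

/-- Bring the main part of the working operator, on the first `nv 19` qubits, to the last of
these qubits, and count this in `nv 9`. -/
def pivotProg (d : Bool) : Program :=
  let a : NExp → NExp := fun i => .get (mainArr d) 0 i
  .forUp 21 (nv 19) (.ite (.le 1 (a (nv 21)))
    (.ite (.le 1 (a (nv 19 - 1))) .nop (emitAdd d (nv 19 - 1) (nv 21))) .nop) ;;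
  .ite (.le 1 (nv 19)) (.ite (.le 1 (a (nv 19 - 1)))
    (.forUp 21 (nv 19 - 1) (.ite (.le 1 (a (nv 21))) (emitAdd d (nv 21) (nv 19 - 1)) .nop) ;;
      .setNat 9 0 0 (nv 9 + 1)) .nop) .nop

/-- The first sweep produces an entry at the last of the `N` qubits unless the main part vanishes
there altogether; the second sweep uses this entry to clear all others. Each sweep emits at most one
gate per qubit, hence at most `2 * n` gates. -/
theorem runs_pivotProg (d : Bool) {s : Memory} {T : Tab n} {L : List (Gate n)} {N r : ℕ}
    (hT : TabAt s T) (hL : CircAt s L) (hN : s.nat 19 0 0 = N) (hNn : N ≤ n)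
    (hr : s.nat 9 0 0 = r) :
    Runs (pivotProg d) s (34 * n + 9) fun s' => ∃ M : List (Gate n),
      (∀ g ∈ M, g.Below N ∧ g.IsCnot) ∧ TabAt s' (actL M T) ∧ CircAt s' (L ++ M) ∧
      Same [4, 7, 9, 10, 11, 12, 13, 16, 17, 18, 21] [] s s' ∧
      ((s'.nat 9 0 0 = r ∧ M = [] ∧ ∀ i : Fin n, i < N → T.main d i = false) ∨
        (s'.nat 9 0 0 = r + 1 ∧ M.length ≤ 2 * n ∧ ∃ p : Fin n, (p : ℕ) + 1 = N ∧
          (actL M T).main d p = true ∧ ∀ i < p, (actL M T).main d i = false)) := by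
  refine (Runs.seq' (T₁ := N * (15 + 2) + 2) (T₂ := (N * (14 + 2) + 2 + 1) + 1 + 1)
    (Runs.forUp (T := 15) (M := N) (fun i s' => ∃ M : List (Gate n),
      (∀ g ∈ M, g.Below N ∧ g.IsCnot) ∧ TabAt s' (actL M T) ∧ CircAt s' (L ++ M) ∧
      Same [4, 7, 10, 11, 12, 13, 16, 17, 18, 21] [] s s' ∧ M.length ≤ i ∧
      -- As long as the last entry is zero nothing has been emitted, since the first nonzero entry
      -- met would have been added to it.
      ∀ p : Fin n, (p : ℕ) + 1 = N → (actL M T).main d p = false →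
        M = [] ∧ ∀ i' : Fin n, i' < i → T.main d i' = false) ?_ ?_ ?_ fun s' h _ => h) ?_).mono
    (by omega) fun _ h => h
  · have hS : Same [21] [] s (s.setNat 21 0 0 0) := (Same.refl _ _ _).setNat (by simp) _ _ _
    exact ⟨[], by simp, hT.same hS (by decide), by simpa using hL.same hS (by decide),
      hS.mono (by decide) (by decide), le_rfl, by simp⟩
  · rintro i s' - ⟨M, -, -, -, hS, -⟩
    simp [hS.nat, hN]
  · rintro i s' hi ⟨M, hM, hT', hL', hS, hlen, hz⟩ hv
    obtain ⟨p, hp⟩ : ∃ p : Fin n, (p : ℕ) + 1 = N := ⟨⟨N - 1, by omega⟩, by simp; omega⟩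
    have hN' : s'.nat 19 0 0 = p + 1 := by rw [hp]; simp [hS.nat, hN]
    have hai := hT'.main d ⟨i, by omega⟩
    have hap := hT'.main d p
    simp only at hai
    -- leaving the state unchanged
    have stay : ((actL M T).main d p = true ∨ (actL M T).main d ⟨i, by omega⟩ = false) →
        s'.nat 21 0 0 = i ∧ ∃ M : List (Gate n),
      (∀ g ∈ M, g.Below N ∧ g.IsCnot) ∧ TabAt (s'.setNat 21 0 0 (i + 1)) (actL M T) ∧
      CircAt (s'.setNat 21 0 0 (i + 1)) (L ++ M) ∧
      Same [4, 7, 10, 11, 12, 13, 16, 17, 18, 21] [] s (s'.setNat 21 0 0 (i + 1)) ∧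
      M.length ≤ i + 1 ∧
      ∀ p : Fin n, (p : ℕ) + 1 = N → (actL M T).main d p = false →
        M = [] ∧ ∀ i' : Fin n, i' < i + 1 → T.main d i' = false := by
      intro h
      have hS' : Same [21] [] s' (s'.setNat 21 0 0 (i + 1)) :=
        (Same.refl _ _ _).setNat (by simp) _ _ _
      refine ⟨hv, M, hM, hT'.same hS' (by decide), hL'.same hS' (by decide),
        hS.setNat (by simp) _ _ _, by omega, fun p' hp' h0 => ?_⟩
      obtain rfl : p' = p := Fin.ext (by omega)
      obtain ⟨h1, h2⟩ := hz p' hp' h0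
      refine ⟨h1, fun i' hi' => ?_⟩
      rcases Nat.lt_succ_iff_lt_or_eq.1 hi' with h' | h'
      · exact h2 i' h'
      · subst h1
        rcases h with h | h
        · rw [h0] at h; exact absurd h (by simp)
        · rw [actL_nil] at h
          rw [← h]; congr 1; exact Fin.ext h'
    refine Runs.ite (T := 14) (fun h1 => ?_) (fun h1 => ?_)
    · refine Runs.ite (T := 13) (fun h2 => ?_) (fun h2 => ?_)
      · refine (Runs.nop (stay (Or.inl ?_))).mono (by norm_num) fun _ h => h
        simpa [hN', hap, one_le_toNat] using h2
      · have h1' : (actL M T).main d ⟨i, by omega⟩ = true := by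
          simpa [hv, hai, one_le_toNat] using h1
        have h2' : (actL M T).main d p = false := by
          simpa [hN', hap, one_le_toNat] using h2
        have hip : p ≠ ⟨i, by omega⟩ := fun e => by
          rw [e, h1'] at h2'; exact absurd h2' (by simp)
        refine (runs_emitAdd d (i := p) (p := ⟨i, by omega⟩) hip hT' hL'
          (fun s'' hS'' => by simp [hS''.nat, hN']) (fun s'' hS'' => by simp [hS''.nat, hv])).mono
          le_rfl ?_
        rintro s'' ⟨e1, e2, e3⟩
        have hS' : Same [21] [] s'' (s''.setNat 21 0 0 (i + 1)) :=
          (Same.refl _ _ _).setNat (by simp) _ _ _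
        refine ⟨by simp [e3.nat, hv], M ++ [addGate d p ⟨i, by omega⟩ hip], ?_, ?_, ?_, ?_, ?_, ?_⟩
        · intro g hg
          rcases List.mem_append.1 hg with hg | hg
          · exact hM g hg
          · obtain rfl := List.mem_singleton.1 hg
            exact ⟨addGate_below d hip (by omega) hi, addGate_isCnot d hip⟩
        · simpa using e1.same hS' (by decide)
        · simpa using e2.same hS' (by decide)
        · exact (hS.trans (e3.mono (by decide) (by decide))).setNat (by simp) _ _ _
        · simp [hlen]
        · intro p' hp' h0
          obtain rfl : p' = p := Fin.ext (by omega)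
          simp [main_addGate, h1', h2'] at h0
    · refine (Runs.nop (stay (Or.inr ?_))).mono (by norm_num) fun _ h => h
      simpa [hv, hai, one_le_toNat] using h1
  · rintro s₁ ⟨M, hM, hT', hL', hS, hlen, hz⟩
    have hN' : s₁.nat 19 0 0 = N := by simp [hS.nat, hN]
    have hr' : s₁.nat 9 0 0 = r := by simp [hS.nat, hr]
    refine Runs.ite (fun h1 => ?_) (fun h1 => ?_)
    · obtain ⟨p, hp⟩ : ∃ p : Fin n, (p : ℕ) + 1 = N := ⟨⟨N - 1, by simp [hN'] at h1; omega⟩,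
        by simp [hN'] at h1; simp; omega⟩
      have hap := hT'.main d p
      have hN'' : N - 1 = p := by omega
      refine Runs.ite (fun h2 => ?_) (fun h2 => ?_)
      · have h2' : (actL M T).main d p = true := by
          simpa [hN', hN'', hap, one_le_toNat] using h2
        refine (Runs.seq' (T₁ := p * (14 + 2) + 2) (T₂ := 1)
          (Runs.forUp (T := 14) (M := p) (fun i s' => ∃ M : List (Gate n),
          (∀ g ∈ M, g.Below N ∧ g.IsCnot) ∧ TabAt s' (actL M T) ∧ CircAt s' (L ++ M) ∧
          Same [4, 7, 10, 11, 12, 13, 16, 17, 18, 21] [] s s' ∧ M.length ≤ N + i ∧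
          (actL M T).main d p = true ∧ ∀ i' : Fin n, i' < i → (actL M T).main d i' = false)
          ?_ ?_ ?_ fun s' h _ => h) ?_).mono (by omega) fun _ h => h
        · have hS' : Same [21] [] s₁ (s₁.setNat 21 0 0 0) := (Same.refl _ _ _).setNat (by simp) _ _ _
          exact ⟨M, hM, hT'.same hS' (by decide), by simpa using hL'.same hS' (by decide),
            hS.setNat (by simp) _ _ _, by omega, h2', by simp⟩
        · rintro i s' - ⟨M, -, -, -, hS, -⟩
          simp [hS.nat, hN, hN'']
        · rintro i s' hi ⟨M, hM, hT', hL', hS, hlen, h1, hz⟩ hv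
          have hai := hT'.main d ⟨i, by omega⟩
          simp only at hai
          refine Runs.ite (T := 13) (fun h3 => ?_) (fun h3 => ?_)
          · have h3' : (actL M T).main d ⟨i, by omega⟩ = true := by
              simpa [hv, hai, one_le_toNat] using h3
            have hip : ⟨i, by omega⟩ ≠ p := fun e => by
              have := congrArg Fin.val e; simp at this; omega
            refine (runs_emitAdd d (p := p) (i := ⟨i, by omega⟩) hip hT' hL'
              (fun s'' hS'' => by simp [hS''.nat, hv])
              (fun s'' hS'' => by simp [hS''.nat, hS.nat, hN, hN''])).mono
              le_rfl ?_
            rintro s'' ⟨e1, e2, e3⟩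
            have hS' : Same [21] [] s'' (s''.setNat 21 0 0 (i + 1)) :=
              (Same.refl _ _ _).setNat (by simp) _ _ _
            refine ⟨by simp [e3.nat, hv], M ++ [addGate d ⟨i, by omega⟩ p hip],
              ?_, ?_, ?_, ?_, ?_, ?_, ?_⟩
            · intro g hg
              rcases List.mem_append.1 hg with hg | hg
              · exact hM g hg
              · obtain rfl := List.mem_singleton.1 hg
                exact ⟨addGate_below d hip (by simp; omega) (by omega), addGate_isCnot d hip⟩
            · simpa using e1.same hS' (by decide)
            · simpa using e2.same hS' (by decide)
            · exact (hS.trans (e3.mono (by decide) (by decide))).setNat (by simp) _ _ _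
            · simp; omega
            · simp [main_addGate, Function.update_of_ne hip.symm, h1]
            · intro i' hi'
              by_cases hii : i' = ⟨i, by omega⟩
              · simp [main_addGate, hii, h3', h1]
              · have : (i' : ℕ) ≠ i := fun e => hii (Fin.ext e)
                simp [main_addGate, hii, hz i' (by omega)]
          · refine (Runs.nop ?_).mono (by norm_num) fun _ h => h
            have hS' : Same [21] [] s' (s'.setNat 21 0 0 (i + 1)) :=
              (Same.refl _ _ _).setNat (by simp) _ _ _
            refine ⟨hv, M, hM, hT'.same hS' (by decide), hL'.same hS' (by decide),
              hS.setNat (by simp) _ _ _, by omega, h1, fun i' hi' => ?_⟩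
            rcases Nat.lt_succ_iff_lt_or_eq.1 hi' with h' | h'
            · exact hz i' h'
            · have e : i' = ⟨i, by omega⟩ := Fin.ext h'
              rw [e]
              simpa [hv, hai, one_le_toNat] using h3
        · rintro s₂ ⟨M, hM, hT', hL', hS, hlen, h1, hz⟩
          have hS' : Same [9] [] s₂ (s₂.setNat 9 0 0 (r + 1)) :=
            (Same.refl _ _ _).setNat (by simp) _ _ _
          refine Runs.setNat ?_
          simp only [NExp.eval_add, NExp.eval_get, NExp.eval_ofNat, hS.nat 9 (by decide), hr]
          exact ⟨M, hM, hT'.same hS' (by decide), hL'.same hS' (by decide),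
            (hS.mono (by decide) (by decide)).setNat (by simp) _ _ _,
            Or.inr ⟨by simp, by omega, p, hp, h1, fun i hi => hz i hi⟩⟩
      · have h2' : (actL M T).main d p = false := by
          simpa [hN', hN'', hap, one_le_toNat] using h2
        obtain ⟨rfl, h3⟩ := hz p hp h2'
        exact (Runs.nop ⟨[], by simp, hT', hL', hS.mono (by decide) (by decide),
          Or.inl ⟨hr', rfl, h3⟩⟩).mono (by omega) fun _ h => h
    · have hN0 : N = 0 := by simpa [hN'] using h1
      subst hN0
      obtain rfl : M = [] := List.length_eq_zero_iff.1 (by omega)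
      exact (Runs.nop ⟨[], by simp, hT', hL', hS.mono (by decide) (by decide),
        Or.inl ⟨hr', rfl, by simp⟩⟩).mono (by omega) fun _ h => h

/-- Rotate the letters of the working operator on the first `nv 19` qubits to `I` or `Z`. -/
def rotateProg : Program :=
  .forUp 21 (nv 19) (.ite (.le 1 (.get 10 0 (nv 21)))
    (.ite (.le 1 (.get 11 0 (nv 21))) (emit 1 (nv 21) (nv 21)) .nop ;; emit 0 (nv 21) (nv 21)) .nop)

/-- A phase gate turns `Y` into `X` up to sign, and a Hadamard gate turns `X` into `Z`. The last
alternative matters for the length of the circuit: any emitted gates leave a `Z` behind, and so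
entail a new pivot in the step that follows. -/
theorem runs_rotateProg {s : Memory} {T : Tab n} {L : List (Gate n)} {N : ℕ}
    (hT : TabAt s T) (hL : CircAt s L) (hN : s.nat 19 0 0 = N) (hNn : N ≤ n) :
    Runs rotateProg s (30 * n + 2) fun s' => ∃ M : List (Gate n),
      (∀ g ∈ M, g.Below N) ∧ TabAt s' (actL M T) ∧ CircAt s' (L ++ M) ∧
      Same [4, 7, 10, 11, 12, 13, 16, 17, 18, 21] [] s s' ∧ M.length ≤ 2 * n ∧
      (∀ i : Fin n, i < N → (actL M T).x i = false) ∧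
      (M = [] ∨ ∃ i : Fin n, i < N ∧ (actL M T).z i = true) := by
  refine (Runs.forUp (T := 28) (M := N) (fun i s' => ∃ M : List (Gate n),
      (∀ g ∈ M, g.Below N) ∧ TabAt s' (actL M T) ∧ CircAt s' (L ++ M) ∧
      Same [4, 7, 10, 11, 12, 13, 16, 17, 18, 21] [] s s' ∧ M.length ≤ 2 * i ∧
      (∀ i' : Fin n, i' < i → (actL M T).x i' = false) ∧
      (M = [] ∨ ∃ i : Fin n, i < N ∧ (actL M T).z i = true)) ?_ ?_ ?_ ?_).mono (by omega) fun _ h => h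
  · have hS : Same [21] [] s (s.setNat 21 0 0 0) := (Same.refl _ _ _).setNat (by simp) _ _ _
    exact ⟨[], by simp, hT.same hS (by decide), by simpa using hL.same hS (by decide),
      hS.mono (by decide) (by decide), le_rfl, by simp⟩
  · rintro i s' - ⟨M, -, -, -, hS, -⟩
    simp [hS.nat, hN]
  · rintro i s' hi ⟨M, hM, hT', hL', hS, hlen, hz, hor⟩ hv
    have hax := hT'.x ⟨i, by omega⟩
    have haz := hT'.z ⟨i, by omega⟩
    simp only at hax haz
    refine Runs.ite (T := 27) (fun h1 => ?_) (fun h1 => ?_)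
    · have h1' : (actL M T).x ⟨i, by omega⟩ = true := by
        simpa [hv, hax, one_le_toNat] using h1
      refine Runs.seq' (T₁ := 14) (T₂ := 13) (Mid := fun s' => ∃ M : List (Gate n),
        (∀ g ∈ M, g.Below N) ∧ TabAt s' (actL M T) ∧ CircAt s' (L ++ M) ∧
        Same [4, 7, 10, 11, 12, 13, 16, 17, 18, 21] [] s s' ∧ M.length ≤ 2 * i + 1 ∧
        (∀ i' : Fin n, i' < i → (actL M T).x i' = false) ∧ s'.nat 21 0 0 = i ∧
        (actL M T).x ⟨i, by omega⟩ = true ∧ (actL M T).z ⟨i, by omega⟩ = false)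
        (Runs.ite (fun h2 => ?_) (fun h2 => ?_)) ?_
      · have h2' : (actL M T).z ⟨i, by omega⟩ = true := by
          simpa [hv, haz, one_le_toNat] using h2
        refine (runs_emit (.phase ⟨i, by omega⟩) hT' hL'
          (fun s'' hS'' => by simp [hS''.nat, hv, Gate.code])).mono le_rfl ?_
        rintro s'' ⟨e1, e2, e3⟩
        have hin : i < n := by omega
        refine ⟨M ++ [.phase ⟨i, hin⟩], ?_, by simpa using e1, by simpa using e2,
          hS.trans (e3.mono (by decide) (by decide)), by simp [hlen], ?_,
          by simp [e3.nat, hv], ?_, ?_⟩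
        · intro g hg
          rcases List.mem_append.1 hg with hg | hg
          · exact hM g hg
          · obtain rfl := List.mem_singleton.1 hg
            exact hi
        · intro i' hi'
          simp [Gate.act, hz i' hi']
        · simp [Gate.act, h1']
        · simp [Gate.act, h1', h2']
      · exact (Runs.nop ⟨M, hM, hT', hL', hS, by omega, hz, hv, h1', by
          simpa [hv, haz, one_le_toNat] using h2⟩).mono (by norm_num) fun _ h => h
      · rintro s₁ ⟨M, hM, hT', hL', hS, hlen, hz, hv, hx, hz'⟩
        refine (runs_emit (.had ⟨i, by omega⟩) hT' hL'
          (fun s'' hS'' => by simp [hS''.nat, hv, Gate.code])).mono le_rfl ?_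
        rintro s'' ⟨e1, e2, e3⟩
        have hS' : Same [21] [] s'' (s''.setNat 21 0 0 (i + 1)) :=
          (Same.refl _ _ _).setNat (by simp) _ _ _
        refine ⟨by simp [e3.nat, hv], M ++ [.had ⟨i, by omega⟩], ?_, ?_, ?_,
          (hS.trans (e3.mono (by decide) (by decide))).setNat (by simp) _ _ _,
          by simp; omega, ?_, Or.inr ⟨⟨i, by omega⟩, hi, ?_⟩⟩
        · intro g hg
          rcases List.mem_append.1 hg with hg | hg
          · exact hM g hg
          · obtain rfl := List.mem_singleton.1 hg
            exact hi
        · simpa using e1.same hS' (by decide)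
        · simpa using e2.same hS' (by decide)
        · intro i' hi'
          by_cases hii : i' = ⟨i, by omega⟩
          · simp [Gate.act, hii, hz']
          · have : (i' : ℕ) ≠ i := fun e => hii (Fin.ext e)
            simp [Gate.act, hii, hz i' (by omega)]
        · simp [Gate.act, hx]
    · refine (Runs.nop ?_).mono (by norm_num) fun _ h => h
      have hS' : Same [21] [] s' (s'.setNat 21 0 0 (i + 1)) :=
        (Same.refl _ _ _).setNat (by simp) _ _ _
      refine ⟨hv, M, hM, hT'.same hS' (by decide), hL'.same hS' (by decide),
        hS.setNat (by simp) _ _ _, by omega, fun i' hi' => ?_, hor⟩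
      rcases Nat.lt_succ_iff_lt_or_eq.1 hi' with h' | h'
      · exact hz i' h'
      · have e : i' = ⟨i, by omega⟩ := Fin.ext h'
        rw [e]
        simpa [hv, hax, one_le_toNat] using h1
  · rintro s' ⟨M, hM, hT', hL', hS, hlen, hz, hor⟩ -
    exact ⟨M, hM, hT', hL', hS, by omega, hz, hor⟩

end DopedStab

namespace DopedStab

/-! ### Elimination of a whole family of operators -/

variable {n : ℕ}

/-- The integer arrays changed by the elimination of one operator. -/
abbrev elimArrs : List ℕ := [4, 7, 9, 10, 11, 12, 13, 16, 17, 18, 19, 21, 22]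
/-- The integer arrays changed by the elimination of a family of operators. -/
abbrev elimArrs' : List ℕ := 20 :: elimArrs

/-- Make operator number `nv 20` diagonal, and all but the last qubits trivial. -/
def diagBody (ld : Program) : Program :=
  ld ;; conjProg ;; .setNat 19 0 0 (nv 6 - nv 9) ;; rotateProg ;; pivotProg false

/-- Remove the X-part of operator number `nv 20` from all but the last qubits. -/
def shrinkBody (ld : Program) : Program :=
  ld ;; conjProg ;; .setNat 19 0 0 (nv 6 - nv 9) ;; pivotProg true

/-- The next operator has no X-part on the pivot qubits because it commutes with the operators that
have their pivots there. Rotations and controlled-nots on the remaining `n - r` qubits thus suffice,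
and the earlier operators are trivial on these. An operator without a new pivot costs no gate and
one with a new pivot at most `4 * n` gates, which bounds the length by `4 * n * r`. -/
theorem runs_diag {s : Memory} {M Tl : ℕ} (F : ℕ → Tab n) {cnt : NExp} {ld : Program}
    (hc : ∀ s', Same elimArrs' [] s s' → cnt.eval s' = M)
    (hload : ∀ s' j, j < M → Same elimArrs' [] s s' → s'.nat 20 0 0 = j →
      Runs ld s' Tl fun s'' => TabAt s'' (F j) ∧ Same [10, 11, 12, 21] [] s' s'')
    (h6 : s.nat 6 0 0 = n) (h9 : s.nat 9 0 0 = 0) (hL : CircAt s ([] : List (Gate n)))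
    (hcomm : ∀ i j, i < M → j < M → Commute (F i).mat (F j).mat) :
    Runs (.forUp 20 cnt (diagBody ld)) s (M * (Tl + 44 * n ^ 2 + 64 * n + 16) + 2) fun s' =>
      ∃ (L : List (Gate n)) (r : ℕ), CircAt s' L ∧ s'.nat 9 0 0 = r ∧ L.length ≤ 4 * n * r ∧
        Elim false F M r L ∧ (∀ j < M, ∀ i, (actL L (F j)).x i = false) ∧
        Same elimArrs' [] s s' := by
  refine (Runs.forUp (T := Tl + 44 * n ^ 2 + 64 * n + 14) (M := M) (fun m s' =>
    ∃ (L : List (Gate n)) (r : ℕ), CircAt s' L ∧ s'.nat 9 0 0 = r ∧ L.length ≤ 4 * n * r ∧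
        Elim false F m r L ∧ (∀ j < m, ∀ i, (actL L (F j)).x i = false) ∧
        Same elimArrs' [] s s') ?_ ?_ ?_ ?_).mono (by simp [Nat.add_assoc]) fun _ h => h
  · have hS : Same [20] [] s (s.setNat 20 0 0 0) := (Same.refl _ _ _).setNat (by simp) _ _ _
    exact ⟨[], 0, hL.same hS (by decide), by simp [h9], by simp, ⟨Nat.zero_le _, by simp,
      fun p hp => absurd p.2 (by omega)⟩, by simp, hS.mono (by decide) (by decide)⟩
  · rintro i s' - ⟨L, r, -, -, -, -, -, hS⟩
    exact hc s' hS
  · rintro j s' hj ⟨L, r, hL, hr, hlen, hE, hx, hS⟩ hv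
    -- Conjugation takes time `11` per gate, and `4 * n * r ≤ 4 * n ^ 2`.
    have hlen' : L.length * 11 ≤ 44 * n ^ 2 := by nlinarith [hE.le]
    refine (Runs.seq' (T₁ := Tl) (T₂ := (L.length * 11 + 2) + (1 + ((30 * n + 2) + (34 * n + 9))))
      (hload s' j hj hS hv) ?_).mono (by omega) fun _ h => h
    rintro s₁ ⟨hT₁, S₁⟩
    refine Runs.seq' (runs_conjProg hT₁ (hL.same S₁ (by decide))) ?_
    rintro s₂ ⟨hT₂, S₂⟩
    have S₂' : Same elimArrs [] s' s₂ :=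
      (S₁.mono (by decide) (by decide)).trans (S₂.mono (by decide) (by decide))
    refine Runs.seq (Runs.setNat ?_)
    have h19 : s₂.nat 6 0 0 - s₂.nat 9 0 0 = n - r := by
      simp [S₂.nat, S₁.nat, hS.nat, h6, hr]
    simp only [NExp.eval_sub, NExp.eval_get, NExp.eval_ofNat, h19]
    have S₃ : Same [19] [] s₂ (s₂.setNat 19 0 0 (n - r)) := (Same.refl _ _ _).setNat (by simp) _ _ _
    have S₃' : Same elimArrs [] s' (s₂.setNat 19 0 0 (n - r)) :=
      S₂'.trans (S₃.mono (by decide) (by decide))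
    refine Runs.seq' (runs_rotateProg (hT₂.same S₃ (by decide))
      (((hL.same S₁ (by decide)).same S₂ (by decide)).same S₃ (by decide)) (N := n - r)
      (by simp) (Nat.sub_le _ _)) ?_
    rintro s₄ ⟨M₁, hM₁, hT₄, hL₄, S₄, hlen₁, hx₄, hor⟩
    have S₄' : Same elimArrs [] s' s₄ := S₃'.trans (S₄.mono (by decide) (by decide))
    refine (runs_pivotProg false hT₄ hL₄ (N := n - r) (r := r) (by simp [S₄.nat]) (Nat.sub_le _ _)
      (by simp [S₄.nat, S₂.nat, S₁.nat, hr])).mono le_rfl ?_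
    rintro s₅ ⟨M₂, hM₂, hT₅, hL₅, S₅, hcase⟩
    have S₅' : Same elimArrs [] s' s₅ := S₄'.trans (S₅.mono (by decide) (by decide))
    have hS₆ : Same [20] [] s₅ (s₅.setNat 20 0 0 (j + 1)) :=
      (Same.refl _ _ _).setNat (by simp) _ _ _
    have S₆ : Same elimArrs' [] s (s₅.setNat 20 0 0 (j + 1)) :=
      (hS.trans (S₅'.mono (by decide) (by decide))).setNat (by simp) _ _ _
    refine ⟨by simp [S₅'.nat, hv], ?_⟩
    -- the X-part of the conjugated operator
    have hxge : ∀ k, ∀ i : Fin n, n - 1 - (i : ℕ) = k → n - r ≤ i → (actL L (F j)).x i = false := by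
      intro k
      induction k using Nat.strong_induction_on with
      | _ k ih =>
        intro i hik hi
        -- The pivot qubits are visited from the last one downwards: by induction there is no X-part
        -- behind `i`, so the commuting operator with pivot `i` excludes one at `i`.
        obtain ⟨j', hj', h1, h2⟩ := hE.tri i hi
        refine Tab.x_eq_false_of_commute (commute_actL L (hcomm j j' hj (hj'.trans hj))) i
          (hx j' hj') h2 h1 fun i' hi' => ih (n - 1 - i') ?_ i' rfl ?_
        · rw [Fin.lt_def] at hi'; omega
        · rw [Fin.lt_def] at hi'; omega
    have hx₄' : ∀ i, (actL M₁ (actL L (F j))).x i = false := fun i => by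
      by_cases hi : (i : ℕ) < n - r
      · exact hx₄ i hi
      · rw [actL_x_of_le hM₁ _ (not_lt.1 hi)]
        exact hxge _ i rfl (not_lt.1 hi)
    have hx₅ : ∀ i, (actL M₂ (actL M₁ (actL L (F j)))).x i = false := fun i => by
      rw [actL_x_of_cnot hM₂ fun i _ => hx₄' i]
      exact hx₄' i
    have hself : ∀ j' < j, actL M₂ (actL M₁ (actL L (F j'))) = actL L (F j') := fun j' hj' => by
      rw [actL_eq_self hM₁ (fun i _ => hx j' hj' i) (fun i hi => hE.zero j' hj' i hi),
        actL_eq_self (fun g hg => (hM₂ g hg).1) (fun i _ => hx j' hj' i)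
          (fun i hi => hE.zero j' hj' i hi)]
    rcases hcase with ⟨hr₅, rfl, hz⟩ | ⟨hr₅, hlen₂, p, hp, hp1, hp0⟩
    · have hM₁' : M₁ = [] := by
        rcases hor with h | ⟨i, hi, h⟩
        · exact h
        · have := hz i hi
          simp only [Tab.main, Bool.false_eq_true, if_false] at this
          rw [this] at h; exact absurd h (by simp)
      subst hM₁'
      refine ⟨L, r, ?_, by simp [hr₅], hlen, hE.succ hz, fun j' hj' i => ?_, S₆⟩
      · simpa using hL₅.same hS₆ (by decide)
      · rcases Nat.lt_succ_iff_lt_or_eq.1 hj' with h' | rfl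
        · exact hx j' h' i
        · exact hx₄' i
    · refine ⟨L ++ (M₁ ++ M₂), r + 1, ?_, by simp [hr₅], ?_, ?_, fun j' hj' i => ?_, S₆⟩
      · simpa using hL₅.same hS₆ (by decide)
      · simp only [List.length_append]
        rw [Nat.mul_add]; omega
      · exact hE.succ' (fun j' hj' => by rw [actL_append, hself j' hj']) p hp
          (by simpa using hp1) (by simpa using hp0)
      · rw [actL_append, actL_append]
        rcases Nat.lt_succ_iff_lt_or_eq.1 hj' with h' | rfl
        · rw [hself j' h']; exact hx j' h' i
        · exact hx₅ i
  · rintro s' h -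
    exact h

/-- Only controlled-nots are emitted, on qubits where the operators already treated have no X-part.
Each new pivot costs at most `2 * n` gates, so the circuit `L₀` grows by at most `2 * n ^ 2`. The `F
j` need not commute here, as only their X-parts are reduced. -/
theorem runs_shrink {s : Memory} {M Tl : ℕ} (F : ℕ → Tab n) {cnt : NExp} {ld : Program}
    {L₀ : List (Gate n)} (hlen₀ : L₀.length ≤ 4 * n ^ 2)
    (hc : ∀ s', Same elimArrs' [] s s' → cnt.eval s' = M)
    (hload : ∀ s' j, j < M → Same elimArrs' [] s s' → s'.nat 20 0 0 = j →
      Runs ld s' Tl fun s'' => TabAt s'' (F j) ∧ Same [10, 11, 12, 21] [] s' s'')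
    (h6 : s.nat 6 0 0 = n) (h9 : s.nat 9 0 0 = 0) (hL : CircAt s L₀) :
    Runs (.forUp 20 cnt (shrinkBody ld)) s (M * (Tl + 66 * n ^ 2 + 34 * n + 14) + 2) fun s' =>
      ∃ (L : List (Gate n)) (r : ℕ), CircAt s' L ∧ L.length ≤ 6 * n ^ 2 ∧ Elim true F M r L ∧
        (∀ T : Tab n, (∀ i, (actL L₀ T).x i = false) → ∀ i, (actL L T).x i = false) ∧
        Same elimArrs' [] s s' := by
  refine (Runs.forUp (T := Tl + 66 * n ^ 2 + 34 * n + 12) (M := M) (fun m s' =>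
    ∃ (L : List (Gate n)) (r : ℕ), CircAt s' L ∧ s'.nat 9 0 0 = r ∧
        L.length ≤ 4 * n ^ 2 + 2 * n * r ∧ Elim true F m r L ∧
        (∀ T : Tab n, (∀ i, (actL L₀ T).x i = false) → ∀ i, (actL L T).x i = false) ∧
        Same elimArrs' [] s s') ?_ ?_ ?_ ?_).mono (by simp [Nat.add_assoc]) fun _ h => h
  · have hS : Same [20] [] s (s.setNat 20 0 0 0) := (Same.refl _ _ _).setNat (by simp) _ _ _
    exact ⟨L₀, 0, hL.same hS (by decide), by simp [h9], by simpa, ⟨Nat.zero_le _, by simp,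
      fun p hp => absurd p.2 (by omega)⟩, fun _ h => h, hS.mono (by decide) (by decide)⟩
  · rintro i s' - ⟨L, r, -, -, -, -, -, hS⟩
    exact hc s' hS
  · rintro j s' hj ⟨L, r, hL, hr, hlen, hE, hx, hS⟩ hv
    have hlen' : L.length * 11 ≤ 66 * n ^ 2 := by nlinarith [hE.le]
    refine (Runs.seq' (T₁ := Tl) (T₂ := (L.length * 11 + 2) + (1 + (34 * n + 9)))
      (hload s' j hj hS hv) ?_).mono (by omega) fun _ h => h
    rintro s₁ ⟨hT₁, S₁⟩
    refine Runs.seq' (runs_conjProg hT₁ (hL.same S₁ (by decide))) ?_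
    rintro s₂ ⟨hT₂, S₂⟩
    have S₂' : Same elimArrs [] s' s₂ :=
      (S₁.mono (by decide) (by decide)).trans (S₂.mono (by decide) (by decide))
    refine Runs.seq (Runs.setNat ?_)
    have h19 : s₂.nat 6 0 0 - s₂.nat 9 0 0 = n - r := by
      simp [S₂.nat, S₁.nat, hS.nat, h6, hr]
    simp only [NExp.eval_sub, NExp.eval_get, NExp.eval_ofNat, h19]
    have S₃ : Same [19] [] s₂ (s₂.setNat 19 0 0 (n - r)) := (Same.refl _ _ _).setNat (by simp) _ _ _
    have S₃' : Same elimArrs [] s' (s₂.setNat 19 0 0 (n - r)) :=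
      S₂'.trans (S₃.mono (by decide) (by decide))
    refine (runs_pivotProg true (hT₂.same S₃ (by decide))
      (((hL.same S₁ (by decide)).same S₂ (by decide)).same S₃ (by decide)) (N := n - r) (r := r)
      (by simp) (Nat.sub_le _ _) (by simp [S₂.nat, S₁.nat, hr])).mono le_rfl ?_
    rintro s₅ ⟨M₂, hM₂, hT₅, hL₅, S₅, hcase⟩
    have S₅' : Same elimArrs [] s' s₅ := S₃'.trans (S₅.mono (by decide) (by decide))
    have hS₆ : Same [20] [] s₅ (s₅.setNat 20 0 0 (j + 1)) :=
      (Same.refl _ _ _).setNat (by simp) _ _ _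
    have S₆ : Same elimArrs' [] s (s₅.setNat 20 0 0 (j + 1)) :=
      (hS.trans (S₅'.mono (by decide) (by decide))).setNat (by simp) _ _ _
    refine ⟨by simp [S₅'.nat, hv], ?_⟩
    rcases hcase with ⟨hr₅, rfl, hz⟩ | ⟨hr₅, hlen₂, p, hp, hp1, hp0⟩
    · exact ⟨L, r, by simpa using hL₅.same hS₆ (by decide), by simp [hr₅], hlen, hE.succ hz, hx, S₆⟩
    · refine ⟨L ++ M₂, r + 1, by simpa using hL₅.same hS₆ (by decide), by simp [hr₅], ?_, ?_,
        fun T hT i => ?_, S₆⟩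
      · simp only [List.length_append]
        rw [Nat.mul_add]; omega
      · exact hE.succ' (fun j' hj' => actL_x_of_cnot hM₂ fun i hi => hE.zero j' hj' i hi) p hp
          (by simpa using hp1) (by simpa using hp0)
      · rw [actL_append, actL_x_of_cnot hM₂ fun i _ => hx T hT i]
        exact hx T hT i
  · rintro s' ⟨L, r, h1, -, h2, h3, h4, h5⟩ -
    exact ⟨L, r, h1, by nlinarith [h3.le], h3, h4, h5⟩

/-! ### The elimination computes the rank -/

/-- The coordinates of the main part. -/
def mainLin (d : Bool) (i : Fin n) : SVec n →ₗ[ZMod 2] ZMod 2 :=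
  (if d then LinearMap.fst _ _ _ else LinearMap.snd _ _ _).comp (LinearMap.proj i)

theorem mainLin_vec (d : Bool) (i : Fin n) (T : Tab n) : mainLin d i T.vec = b2z (T.main d i) := by
  cases d <;> rfl

/-- The operators that carry the pivots, restricted to the pivot coordinates, form a triangular
matrix with ones on the diagonal. Hence their images under the circuit are independent, and so are
they. -/
theorem Elim.le_finrank {d : Bool} {F : ℕ → Tab n} {j r : ℕ} {L : List (Gate n)}
    (h : Elim d F j r L) : r ≤ Module.finrank (ZMod 2)
      (Submodule.span (ZMod 2) (Set.range fun j' : Fin j => (F j').vec)) := by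
  have hr := h.le
  let pos : Fin r → Fin n := fun t => ⟨n - r + t, by omega⟩
  choose J hJ h1 h0 using fun t : Fin r => h.tri (pos t) (by simp [pos])
  set W := Submodule.span (ZMod 2) (Set.range fun j' : Fin j => (F j').vec)
  let w : Fin r → W := fun t => ⟨(F (J t)).vec, Submodule.subset_span ⟨⟨J t, hJ t⟩, rfl⟩⟩
  have hli : LinearIndependent (ZMod 2) w := by
    let f : W →ₗ[ZMod 2] (Fin r → ZMod 2) :=
      (LinearMap.pi fun t => mainLin d (pos t)).comp ((linL L).comp W.subtype)
    let A : Matrix (Fin r) (Fin r) (ZMod 2) := Matrix.of fun t t' => f (w t) t'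
    have hA : ∀ t t', A t t' = b2z ((actL L (F (J t))).main d (pos t')) := fun t t' => by
      rw [← mainLin_vec, vec_actL]; rfl
    have htri : A.BlockTriangular id := fun t t' htt => by
      rw [hA, h0 t (pos t') (by simp only [pos, Fin.lt_def]; simp at htt; omega)]; rfl
    have hdet : A.det ≠ 0 := by
      rw [Matrix.det_of_isUpperTriangular htri]
      simp only [hA, h1]
      simp
    have := Matrix.linearIndependent_rows_of_det_ne_zero hdet
    exact LinearIndependent.of_comp f this
  simpa using hli.fintype_card_le_finrank

theorem finrank_span_vec_actL (L : List (Gate n)) {j : ℕ} (F : ℕ → Tab n) :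
    Module.finrank (ZMod 2) (Submodule.span (ZMod 2)
        (Set.range fun j' : Fin j => (actL L (F j')).vec)) =
      Module.finrank (ZMod 2) (Submodule.span (ZMod 2) (Set.range fun j' : Fin j => (F j').vec)) := by
  have : (Set.range fun j' : Fin j => (actL L (F j')).vec) =
      linL L '' (Set.range fun j' : Fin j => (F j').vec) := by
    rw [← Set.range_comp]
    exact congrArg _ (funext fun j' => vec_actL L _)
  rw [this, Submodule.span_image]
  exact (Submodule.equivMapOfInjective _ (linL_injective L) _).finrank_eq.symm

/-- When X-parts are absent and Z-parts live on the last `r` qubits, the span after conjugation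
embeds into a space of dimension `r`; conjugation does not change the rank. -/
theorem Elim.finrank_eq {F : ℕ → Tab n} {j r : ℕ} {L : List (Gate n)}
    (h : Elim false F j r L) (hx : ∀ j' < j, ∀ i, (actL L (F j')).x i = false) :
    Module.finrank (ZMod 2)
      (Submodule.span (ZMod 2) (Set.range fun j' : Fin j => (F j').vec)) = r := by
  refine le_antisymm ?_ h.le_finrank
  have hr := h.le
  rw [← finrank_span_vec_actL L]
  let pos : Fin r → Fin n := fun t => ⟨n - r + t, by omega⟩
  set W := Submodule.span (ZMod 2) (Set.range fun j' : Fin j => (actL L (F j')).vec) with hW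
  let f : SVec n →ₗ[ZMod 2] (Fin r → ZMod 2) := LinearMap.pi fun t => mainLin false (pos t)
  have hzero : ∀ v ∈ W, ∀ i : Fin n, (v i).1 = 0 ∧ ((i : ℕ) < n - r → (v i).2 = 0) := by
    intro v hv
    induction hv using Submodule.span_induction with
    | mem v hv =>
      obtain ⟨j', rfl⟩ := hv
      intro i
      refine ⟨by simp [Tab.vec, hx j' j'.2], fun hi => ?_⟩
      have := h.zero j' j'.2 i hi
      simp only [Tab.main, Bool.false_eq_true, if_false] at this
      simp [Tab.vec, this]
    | zero => simp
    | add v w _ _ hv hw =>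
      intro i
      exact ⟨by simp [hv i, hw i], fun hi => by simp [(hv i).2 hi, (hw i).2 hi]⟩
    | smul c v _ hv =>
      intro i
      exact ⟨by simp [hv i], fun hi => by simp [(hv i).2 hi]⟩
  have hinj : Function.Injective (f.comp W.subtype) := by
    rw [← LinearMap.ker_eq_bot, LinearMap.ker_eq_bot']
    rintro ⟨v, hv⟩ h0
    ext i
    · simpa using (hzero v hv i).1
    · by_cases hi : (i : ℕ) < n - r
      · simpa using (hzero v hv i).2 hi
      · have := congrFun h0 ⟨i - (n - r), by omega⟩
        have hpos : pos ⟨i - (n - r), by omega⟩ = i := Fin.ext (by simp [pos]; omega)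
        simp [f, mainLin, hpos] at this
        simpa using this
  simpa using LinearMap.finrank_le_finrank_of_injective hinj

end DopedStab

namespace DopedStab

/-! ### The rank of the perturbation and the Clifford circuit -/

variable {n m k : ℕ}

/-- A finite family of Pauli strings, continued by the identity. -/
def famTab (P : Fin k → PauliString n) (j : ℕ) : PauliString n :=
  if h : j < k then P ⟨j, h⟩ else fun _ => .I

theorem famTab_fin (P : Fin k → PauliString n) (j : Fin k) : famTab P j = P j := by
  simp [famTab]

theorem vec_tab (P : PauliString n) : P.tab.vec = fun i => (P i).symp := by
  funext i
  simp only [Tab.vec, PauliString.tab]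
  cases P i <;> rfl

theorem pauliDim_eq (P : Fin k → PauliString n) : pauliDim P = Module.finrank (ZMod 2)
    (Submodule.span (ZMod 2) (Set.range fun j : Fin k => (famTab P j).tab.vec)) := by
  have : (fun j : Fin k => (famTab P j).tab.vec) = fun j i => (P j i).symp := by
    funext j
    rw [famTab_fin, vec_tab]
  rw [this, pauliDim]

/-- The symplectic vector of a Pauli string, written as a product of `Z`s on `2 n` qubits. -/
def PauliString.double (P : PauliString n) : Tab (n + n) where
  x _ := false
  z i := if h : (i : ℕ) < n then (P ⟨i, h⟩).xb else (P ⟨i - n, by omega⟩).zb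
  r := false

/-- The linear map underlying `PauliString.double`. -/
def doubleLin (n : ℕ) : SVec n →ₗ[ZMod 2] SVec (n + n) :=
  LinearMap.pi fun i => if h : (i : ℕ) < n
    then LinearMap.prod 0 ((LinearMap.fst _ _ _).comp (LinearMap.proj ⟨i, h⟩))
    else LinearMap.prod 0 ((LinearMap.snd _ _ _).comp (LinearMap.proj ⟨i - n, by omega⟩))

theorem double_vec (P : PauliString n) : P.double.vec = doubleLin n P.tab.vec := by
  funext i
  by_cases h : (i : ℕ) < n <;> simp [Tab.vec, PauliString.double, doubleLin, h, PauliString.tab]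

theorem doubleLin_injective (n : ℕ) : Function.Injective (doubleLin n) := by
  rw [← LinearMap.ker_eq_bot, LinearMap.ker_eq_bot']
  intro v hv
  funext i
  have h1 := congrFun hv ⟨i, by omega⟩
  have h2 := congrFun hv ⟨n + i, by omega⟩
  simp [doubleLin] at h1 h2
  exact Prod.ext h1 h2

/-- The perturbing operators need not commute, but products of `Z` do. Doubling the qubits therefore
makes the diagonalizing elimination applicable to them, and by `Elim.finrank_eq` its number of
pivots is `|K|`. -/
theorem finrank_span_double (P : Fin k → PauliString n) : Module.finrank (ZMod 2)
    (Submodule.span (ZMod 2) (Set.range fun j : Fin k => (famTab P j).double.vec)) =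
      pauliDim P := by
  have : (Set.range fun j : Fin k => (famTab P j).double.vec) =
      doubleLin n '' (Set.range fun j : Fin k => (famTab P j).tab.vec) := by
    rw [← Set.range_comp]
    exact congrArg _ (funext fun j => double_vec _)
  rw [this, Submodule.span_image, pauliDim_eq]
  exact (Submodule.equivMapOfInjective _ (doubleLin_injective n) _).finrank_eq.symm

/-- Read the symplectic vector of operator number `nv 20` of array `2` into the Z-part of the
working operator on `2 n` qubits. -/
def loadDouble : Program :=
  let c : NExp := .get 2 (nv 20) (nv 21 - nv 0)
  let c' : NExp := .get 2 (nv 20) (nv 21)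
  -- For indices below `n` the subtraction in `c` truncates and meaningless bits are written; the
  -- following loop replaces them by the X-bits.
  .mapN 21 (nv 6) 11 0 ((c - 1) - (c - 2)) ;;
  .mapN 21 (nv 0) 11 0 ((c' - (c' - 1)) - (c' - 2)) ;;
  .mapN 21 (nv 6) 10 0 0 ;; .setNat 12 0 0 0

theorem runs_loadDouble {s : Memory} {j : ℕ} {P : PauliString n}
    (hn : s.nat 6 0 0 = n + n) (h0 : s.nat 0 0 0 = n) (hj : s.nat 20 0 0 = j)
    (hP : ∀ i : Fin n, s.nat 2 j i = (P i).code) :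
    Runs loadDouble s (15 * n + 7) fun s' => TabAt s' P.double ∧
      Same [10, 11, 12, 21] [] s s' := by
  have c1 : ∀ i : Fin n, (P i).code - ((P i).code - 1) - ((P i).code - 2) = ((P i).xb).toNat :=
    fun i => by cases P i <;> rfl
  have c2 : ∀ i : Fin n, (P i).code - 1 - ((P i).code - 2) = ((P i).zb).toNat :=
    fun i => by cases P i <;> rfl
  refine (Runs.seq' (T₁ := 3 * (n + n) + 2) (T₂ := 3 * n + 2 + (3 * (n + n) + 2 + 1))
    (Runs.mapN (n + n) 0 (fun i => s.nat 2 j (i - n) - 1 - (s.nat 2 j (i - n) - 2)) (by simp)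
    (fun s' h => by simp [h.nat, hn]) (fun s' h => by simp) ?_) ?_).mono (by omega) fun _ h => h
  · intro i s' hi hS hv _
    simp [hS.nat, hv, hj, h0]
  · rintro s₁ ⟨S1, h1⟩
    refine Runs.seq' (Runs.mapN n 0
      (fun i => s.nat 2 j i - (s.nat 2 j i - 1) - (s.nat 2 j i - 2)) (by simp)
      (fun s' h => by simp [h.nat, S1.nat, h0]) (fun s' h => by simp) ?_) ?_
    · intro i s' hi hS hv _
      simp [hS.nat, hv, S1.nat, hj]
    · rintro s₂ ⟨S2, h2⟩
      refine Runs.seq' (Runs.mapN (n + n) 0 (fun i => 0) (by simp)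
        (fun s' h => by simp [h.nat, S1.nat, S2.nat, hn]) (fun s' h => by simp)
        fun i s' hi hS hv _ => by simp) ?_
      rintro s₃ ⟨S3, h3⟩
      refine Runs.setNat ⟨⟨fun i => ?_, fun i => ?_, ?_⟩, ?_⟩
      · simp [h3, PauliString.double]
      · by_cases hi : (i : ℕ) < n
        · have := hP ⟨i, hi⟩
          simp only at this
          simp [S3.nat, h2, PauliString.double, hi, this, c1]
        · have := hP ⟨i - n, by omega⟩
          simp only at this
          simp [S3.nat, h2, h1, PauliString.double, hi, this, c2]
      · simp [PauliString.double]
      · exact (((S1.mono (by decide) (by decide)).trans (S2.mono (by decide) (by decide))).trans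
          (S3.mono (by decide) (by decide))).setNat (by simp) _ _ _

theorem input_Q (D : Hamiltonian n m k) (ω : ℕ → Bool) (j : ℕ) (hj : j < m) (i : Fin n) :
    (D.input ω).nat 1 j i = (famTab D.Q j i).code := by
  simp [Hamiltonian.input, famTab, hj]

theorem input_P (D : Hamiltonian n m k) (ω : ℕ → Bool) (j : ℕ) (hj : j < k) (i : Fin n) :
    (D.input ω).nat 2 j i = (famTab D.P j i).code := by
  simp [Hamiltonian.input, famTab, hj]

/-- Compute the rank `|K|`, the number `q` and the Clifford circuit. -/
def circuitProg : Program :=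
  .setNat 6 0 0 (nv 0 + nv 0) ;; .forUp 20 (.get 0 0 2) (diagBody loadDouble) ;;
  -- With truncated subtraction `n - (n - r)` is the minimum of `n` and `r`. The circuit found so
  -- far served only to compute the rank and is discarded.
  .setNat 8 0 0 (nv 0 - (nv 0 - nv 9)) ;; .setNat 7 0 0 0 ;; .setNat 9 0 0 0 ;;
  .setNat 6 0 0 (nv 0) ;; .forUp 20 (.get 0 0 1) (diagBody (loadProg 1)) ;; .setNat 9 0 0 0 ;;
  .forUp 20 (.get 0 0 2) (shrinkBody (loadProg 2))

/-- The integer arrays changed by `circuitProg`. -/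
abbrev circArrs : List ℕ := 6 :: 8 :: elimArrs'

/-- The circuit makes the `Q` diagonal and the `P` diagonal on the first `n - q` qubits. -/
structure GoodCircuit (D : Hamiltonian n m k) (q : ℕ) (L : List (Gate n)) : Prop where
  len : L.length ≤ 6 * n ^ 2
  Q : ∀ j i, (actL L (D.Q j).tab).x i = false
  P : ∀ j, ∀ i : Fin n, i < n - q → (actL L (D.P j).tab).x i = false

theorem runs_circuitProg (D : Hamiltonian n m k) (ω : ℕ → Bool) :
    Runs circuitProg (D.input ω) (600 * ((m + k) * (n ^ 2 + 1) + 1)) fun s =>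
      ∃ L : List (Gate n), CircAt s L ∧ GoodCircuit D (min D.dimK n) L ∧
        s.nat 8 0 0 = min D.dimK n ∧ s.nat 6 0 0 = n ∧ Same circArrs [] (D.input ω) s := by
  have i0 : (D.input ω).nat 0 0 0 = n := rfl
  have i1 : (D.input ω).nat 0 0 1 = m := rfl
  have i2 : (D.input ω).nat 0 0 2 = k := rfl
  have i4 : (D.input ω).nat 9 0 0 = 0 := by simp [Hamiltonian.input]
  have i5 : (D.input ω).nat 7 0 0 = 0 := by simp [Hamiltonian.input]
  refine (Runs.seq (T₁ := 1) (T₂ := (k * (15 * n + 7 + 44 * (n + n) ^ 2 + 64 * (n + n) + 16) + 2)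
    + (1 + (1 + (1 + (1 + ((m * (6 * n + 5 + 44 * n ^ 2 + 64 * n + 16) + 2) + (1 +
      (k * (6 * n + 5 + 66 * n ^ 2 + 34 * n + 14) + 2))))))))
    (Runs.setNat ?_)).mono ?_ fun _ h => h
  swap
  · have hn : n ≤ n ^ 2 := by nlinarith
    have h1 : k * n ≤ k * n ^ 2 := Nat.mul_le_mul_left _ hn
    have h2 : m * n ≤ m * n ^ 2 := Nat.mul_le_mul_left _ hn
    ring_nf
    ring_nf at h1 h2
    omega
  simp only [NExp.eval_add, NExp.eval_get, NExp.eval_ofNat, i0]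
  have S₁ : Same [6] [] (D.input ω) ((D.input ω).setNat 6 0 0 (n + n)) :=
    (Same.refl _ _ _).setNat (by simp) _ _ _
  have h6 : ((D.input ω).setNat 6 0 0 (n + n)).nat 6 0 0 = n + n := by simp
  generalize (D.input ω).setNat 6 0 0 (n + n) = s₁ at *
  refine Runs.seq' (runs_diag (n := n + n) (M := k) (Tl := 15 * n + 7)
    (fun j => (famTab D.P j).double) ?_ ?_ h6 ?_ ⟨?_, by simp⟩ ?_) ?_
  · intro s' hS; simp [hS.nat, S₁.nat, i2]
  · intro s' j hj hS hv
    exact runs_loadDouble (by simp [hS.nat, h6]) (by simp [hS.nat, S₁.nat, i0]) hv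
      (fun i => by rw [hS.nat _ (by decide), S₁.nat _ (by decide), input_P _ _ _ hj])
  · simp [S₁.nat, i4]
  · simp [S₁.nat, i5]
  · intro i j _ _
    exact Tab.commute_of_x_eq_false (fun _ => rfl) (fun _ => rfl)
  rintro s₂ ⟨L₂, r, -, hr, -, hE, hx, S₂⟩
  have hrank : r = D.dimK := by
    rw [Hamiltonian.dimK, ← finrank_span_double, hE.finrank_eq hx]
  have S₂' : Same circArrs [] (D.input ω) s₂ :=
    (S₁.mono (by decide) (by decide)).trans (S₂.mono (by decide) (by decide))
  refine Runs.seq <| Runs.setNat <| Runs.seq <| Runs.setNat <| Runs.seq <| Runs.setNat <|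
    Runs.seq <| Runs.setNat ?_
  have hq : n - (n - r) = min D.dimK n := by omega
  have j0 : s₂.nat 0 0 0 = n := by simp [S₂'.nat, i0]
  simp [j0, hr, hq]
  have S₃ : Same circArrs [] (D.input ω) ((((s₂.setNat 8 0 0 (min D.dimK n)).setNat 7 0 0 0).setNat
      9 0 0 0).setNat 6 0 0 n) := (((S₂'.setNat (by simp) _ _ _).setNat (by simp) _ _ _).setNat
        (by simp) _ _ _).setNat (by simp) _ _ _
  generalize hs₃ : (((s₂.setNat 8 0 0 (min D.dimK n)).setNat 7 0 0 0).setNat 9 0 0 0).setNat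
    6 0 0 n = s₃ at S₃
  have a6 : s₃.nat 6 0 0 = n := by simp [← hs₃]
  have a7 : s₃.nat 7 0 0 = 0 := by simp [← hs₃]
  have a8 : s₃.nat 8 0 0 = min D.dimK n := by simp [← hs₃]
  have a9 : s₃.nat 9 0 0 = 0 := by simp [← hs₃]
  refine Runs.seq' (runs_diag (n := n) (M := m) (Tl := 6 * n + 5)
    (fun j => (famTab D.Q j).tab) ?_ ?_ a6 a9 ⟨by simp [a7], by simp⟩ ?_) ?_
  · intro s' hS; simp [hS.nat, S₃.nat, i1]
  · intro s' j hj hS hv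
    exact runs_loadProg (by decide) (by simp [hS.nat, a6]) hv
      (fun i => by rw [hS.nat _ (by decide), S₃.nat _ (by decide), input_Q _ _ _ hj])
  · intro i j hi hj
    rw [PauliString.mat_tab, PauliString.mat_tab]
    simpa [famTab, hi, hj] using D.Q_commute ⟨i, hi⟩ ⟨j, hj⟩
  rintro s₄ ⟨L, r', hL, hr', hlen, hE', hx', S₄⟩
  refine Runs.seq <| Runs.setNat ?_
  simp only [NExp.eval_ofNat]
  have S₅ : Same circArrs [] (D.input ω) (s₄.setNat 9 0 0 0) :=
    (S₃.trans (S₄.mono (by decide) (by decide))).setNat (by simp) _ _ _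
  refine (runs_shrink (n := n) (M := k) (Tl := 6 * n + 5) (L₀ := L)
    (fun j => (famTab D.P j).tab) (hlen.trans ?_) ?_ ?_ ?_ ?_ ?_).mono le_rfl ?_
  · nlinarith [hE'.le]
  · intro s' hS; simp [hS.nat, S₄.nat, S₃.nat, i2]
  · intro s' j hj hS hv
    exact runs_loadProg (by decide) (by simp [hS.nat, S₄.nat, a6]) hv
      (fun i => by rw [hS.nat _ (by decide), S₅.nat _ (by decide), input_P _ _ _ hj])
  · simp [S₄.nat, a6]
  · simp
  · exact hL.same ((Same.refl [9] [] _).setNat (by simp) _ _ _) (by decide)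
  rintro s₅ ⟨L', r₅, hL', hlen', hE₅, hpres, S₆⟩
  refine ⟨L', hL', ⟨hlen', fun j i => ?_, fun j i hi => ?_⟩, ?_, ?_,
    S₅.trans (S₆.mono (by decide) (by decide))⟩
  · rw [← famTab_fin D.Q]
    exact hpres _ (hx' j j.2) i
  · rw [← famTab_fin D.P]
    have h1 := hE₅.le_finrank
    rw [← pauliDim_eq] at h1
    have h2 := hE₅.le
    -- The X-parts alone may have a smaller rank than `|K|`; then some of the last `q` qubits carry
    -- no pivot, which does no harm.
    have h3 : r₅ ≤ min D.dimK n := le_min h1 h2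
    exact hE₅.zero j j.2 i (by omega)
  · simp [S₆.nat, S₄.nat, a8]
  · simp [S₆.nat, S₄.nat, a6]

end DopedStab

namespace DopedStab

/-! ### The Lanczos process with restarts -/

section Lanczos

variable {E : Type*} [NormedAddCommGroup E] [InnerProductSpace ℂ E]

/-- What remains of `w` after projecting out `U 0, …, U (r - 1)`. -/
noncomputable def resid (U : ℕ → E) (r : ℕ) (w : E) : E :=
  w - ∑ s ∈ Finset.range r, inner ℂ (U s) w • U s

theorem resid_congr {U U' : ℕ → E} {r : ℕ} (h : ∀ t < r, U' t = U t) (w : E) :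
    resid U' r w = resid U r w := by
  unfold resid
  congr 1
  exact Finset.sum_congr rfl fun s hs => by rw [h s (Finset.mem_range.1 hs)]

theorem inner_resid {U : ℕ → E} {r : ℕ}
    (h : ∀ s < r, ∀ t < r, inner ℂ (U s) (U t) = if s = t then (1 : ℂ) else 0) (w : E) {s : ℕ}
    (hs : s < r) : inner ℂ (U s) (resid U r w) = (0 : ℂ) := by
  rw [resid, inner_sub_right, inner_sum, Finset.sum_eq_single s]
  · rw [inner_smul_right, h s hs s hs, if_pos rfl, mul_one, sub_self]
  · intro t ht hts
    rw [inner_smul_right, h s hs t (Finset.mem_range.1 ht), if_neg hts.symm, mul_zero]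
  · intro h'; exact absurd (Finset.mem_range.2 hs) h'

/-- Invariant of the process: `r` orthonormal vectors have been found, `j` seed vectors have been
used, and `w` is the next candidate, obtained from the operator if `flag = 1` and from a seed
vector if `flag = 0`. -/
structure Lanczos (A : E →ₗ[ℂ] E) (e : ℕ → E) (r j flag : ℕ) (w : E) (U : ℕ → E) (a b : ℕ → ℝ)
    (K : ℕ → ℕ) : Prop where
  orth : ∀ s < r, ∀ t < r, inner ℂ (U s) (U t) = if s = t then (1 : ℂ) else 0
  worth : ∀ s < r, inner ℂ (U s) w = (0 : ℂ)
  diag : ∀ t < r, a t = (inner ℂ (U t) (A (U t)) : ℂ).re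
  sub : ∀ t, t + 1 < r → resid U (t + 1) (A (U t)) = (b (t + 1) : ℂ) • U (t + 1)
  last : ∀ t, t + 1 = r → resid U r (A (U t)) = if flag = 1 then w else 0
  bK : ∀ t < r, (K t = 0 ∧ b t = 0) ∨ (K t = 1 ∧ 0 < b t)
  K0 : 0 < r → K 0 = 0
  flag01 : flag = 0 ∨ flag = 1 ∧ 0 < r
  seeds : ∀ i < j, e i ∈ Submodule.span ℂ (U '' Set.Iio r) ∨
    (i + 1 = j ∧ flag = 0 ∧ e i - w ∈ Submodule.span ℂ (U '' Set.Iio r))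

theorem Lanczos.start (A : E →ₗ[ℂ] E) (e : ℕ → E) (U : ℕ → E) (a b : ℕ → ℝ) (K : ℕ → ℕ) :
    Lanczos A e 0 0 0 0 U a b K where
  orth := by simp
  worth := by simp
  diag := by simp
  sub := by simp
  last := by simp
  bK := by simp
  K0 := by simp
  flag01 := Or.inl rfl
  seeds := by simp

variable {A : E →ₗ[ℂ] E} {e : ℕ → E} {r j flag : ℕ} {w : E} {U U' : ℕ → E} {a b a' b' : ℕ → ℝ}
  {K K' : ℕ → ℕ}

theorem resid_sub_mem (U : ℕ → E) (r : ℕ) (w : E) :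
    w - resid U r w ∈ Submodule.span ℂ (U '' Set.Iio r) := by
  rw [resid, sub_sub_cancel]
  exact Submodule.sum_mem _ fun s hs => Submodule.smul_mem _ _
    (Submodule.subset_span ⟨s, Finset.mem_range.1 hs, rfl⟩)

/-- With a vanishing candidate both alternatives of `last` say that the image of the last vector
stays in the span found so far. A new direction may thus be taken from the next seed without
creating a subdiagonal entry. -/
theorem Lanczos.restart (h : Lanczos A e r j flag 0 U a b K) :
    Lanczos A e r (j + 1) 0 (resid U r (e j)) U a b K where
  orth := h.orth
  worth s hs := inner_resid h.orth _ hs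
  diag := h.diag
  sub := h.sub
  last t ht := by simpa using h.last t ht
  bK := h.bK
  K0 := h.K0
  flag01 := Or.inl rfl
  seeds i hi := by
    rcases Nat.lt_succ_iff_lt_or_eq.1 hi with hi | rfl
    · left
      rcases h.seeds i hi with h' | ⟨-, -, h'⟩
      · exact h'
      · simpa using h'
    · exact Or.inr ⟨rfl, rfl, resid_sub_mem U r _⟩

/-- The norm removed by normalizing is the subdiagonal entry if the candidate came from the
operator. A candidate that came from a seed gets the entry zero, which marks the start of a new
block; `K` records the same fact as an integer. -/
theorem Lanczos.append (h : Lanczos A e r j flag w U a b K) (hw : w ≠ 0)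
    (hU : ∀ t < r, U' t = U t) (hUr : U' r = ((‖w‖⁻¹ : ℝ) : ℂ) • w)
    (ha : ∀ t < r, a' t = a t) (har : a' r = (inner ℂ (U' r) (A (U' r)) : ℂ).re)
    (hb : ∀ t < r, b' t = b t) (hbr : b' r = if flag = 1 then ‖w‖ else 0)
    (hK : ∀ t < r, K' t = K t) (hKr : K' r = flag) :
    Lanczos A e (r + 1) j 1 (resid U' (r + 1) (A (U' r))) U' a' b' K' := by
  have hn : ‖w‖ ≠ 0 := norm_ne_zero_iff.2 hw
  have hn' : (‖w‖ : ℂ) ≠ 0 := by exact_mod_cast hn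
  have hwr : (‖w‖ : ℂ) • U' r = w := by
    rw [hUr, smul_smul]
    push_cast
    rw [mul_inv_cancel₀ hn', one_smul]
  have h1 : ∀ s < r, inner ℂ (U' s) (U' r) = (0 : ℂ) := fun s hs => by
    rw [hU s hs, hUr, inner_smul_right, h.worth s hs, mul_zero]
  have h2 : inner ℂ (U' r) (U' r) = (1 : ℂ) := by
    rw [inner_self_eq_norm_sq_to_K, hUr, norm_smul]
    simp [hn]
  have orth : ∀ s < r + 1, ∀ t < r + 1, inner ℂ (U' s) (U' t) = if s = t then (1 : ℂ) else 0 := by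
    intro s hs t ht
    rcases Nat.lt_succ_iff_lt_or_eq.1 hs with hs | hs <;>
      rcases Nat.lt_succ_iff_lt_or_eq.1 ht with ht | ht
    · rw [hU s hs, hU t ht, h.orth s hs t ht]
    · subst ht; rw [h1 s hs, if_neg hs.ne]
    · subst hs; rw [← inner_conj_symm, h1 t ht, if_neg ht.ne', map_zero]
    · subst hs; subst ht; rw [h2, if_pos rfl]
  have hspan : Submodule.span ℂ (U '' Set.Iio r) ≤ Submodule.span ℂ (U' '' Set.Iio (r + 1)) := by
    refine Submodule.span_mono ?_
    rintro _ ⟨t, ht, rfl⟩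
    exact ⟨t, Nat.lt_succ_of_lt ht, hU t ht⟩
  have hwmem : w ∈ Submodule.span ℂ (U' '' Set.Iio (r + 1)) := by
    rw [← hwr]
    exact Submodule.smul_mem _ _ (Submodule.subset_span ⟨r, Nat.lt_succ_self r, rfl⟩)
  refine ⟨orth, fun s hs => inner_resid orth _ hs, ?_, ?_, ?_, ?_, ?_, Or.inr ⟨rfl, by omega⟩, ?_⟩
  · intro t ht
    rcases Nat.lt_succ_iff_lt_or_eq.1 ht with ht | rfl
    · rw [ha t ht, hU t ht, h.diag t ht]
    · exact har
  · intro t ht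
    rw [hU t (by omega), resid_congr (U := U) fun s hs => hU s (by omega)]
    rcases Nat.lt_succ_iff_lt_or_eq.1 ht with ht | ht
    · rw [hb _ ht, hU _ ht, h.sub t ht]
    · rw [ht, h.last t ht, hbr]
      split_ifs
      · exact hwr.symm
      · simp
  · intro t ht
    obtain rfl : t = r := by omega
    rw [if_pos rfl]
  · intro t ht
    rcases Nat.lt_succ_iff_lt_or_eq.1 ht with ht | rfl
    · rw [hb t ht, hK t ht]; exact h.bK t ht
    · rw [hbr, hKr]
      rcases h.flag01 with h0 | ⟨h0, -⟩
      · left; simp [h0]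
      · right; simp [h0, hw]
  · intro _
    by_cases hr : 0 < r
    · rw [hK 0 hr, h.K0 hr]
    · obtain rfl : r = 0 := by omega
      rw [hKr]
      rcases h.flag01 with h0 | ⟨h0, h'⟩
      · exact h0
      · omega
  · intro i hi
    left
    rcases h.seeds i hi with h' | ⟨-, -, h'⟩
    · exact hspan h'
    · simpa using Submodule.add_mem _ (hspan h') hwmem

theorem orthonormal_of_orth
    (h : ∀ s < r, ∀ t < r, inner ℂ (U s) (U t) = if s = t then (1 : ℂ) else 0) :
    Orthonormal ℂ fun s : Fin r => U s := by
  rw [orthonormal_iff_ite]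
  intro s t
  simp [h s s.2 t t.2, Fin.ext_iff]

theorem range_fin_eq {α : Type*} (U : ℕ → α) (r : ℕ) : (Set.range fun s : Fin r => U s) = U '' Set.Iio r := by
  ext v
  constructor
  · rintro ⟨s, rfl⟩; exact ⟨s, s.2, rfl⟩
  · rintro ⟨s, hs, rfl⟩; exact ⟨⟨s, hs⟩, rfl⟩

/-- The subdiagonal, set to zero from `d` on. -/
def cutoff (b : ℕ → ℝ) (d t : ℕ) : ℝ := if t < d then b t else 0

/-- The operator is tridiagonal in the orthonormal vectors `U 0, …, U (d - 1)`; `K` marks the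
nonzero entries of the subdiagonal `b`. -/
structure Tridiag (A : E →ₗ[ℂ] E) (d : ℕ) (U : ℕ → E) (a b : ℕ → ℝ) (K : ℕ → ℕ) : Prop where
  orth : ∀ s < d, ∀ t < d, inner ℂ (U s) (U t) = if s = t then (1 : ℂ) else 0
  -- For `t = 0` the index `t - 1` is truncated, but its coefficient is zero by `K0` and `bK`; for
  -- `t = d - 1` the last coefficient is zero by `cutoff`.
  act : ∀ t < d, A (U t) = (cutoff b d t : ℂ) • U (t - 1) + (a t : ℂ) • U t +
    (cutoff b d (t + 1) : ℂ) • U (t + 1)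
  bK : ∀ t < d, (K t = 0 ∧ b t = 0) ∨ (K t = 1 ∧ 0 < b t)
  K0 : 0 < d → K 0 = 0

theorem Lanczos.le_finrank [FiniteDimensional ℂ E] (h : Lanczos A e r j flag w U a b K) :
    r ≤ Module.finrank ℂ E := by
  simpa using (orthonormal_of_orth h.orth).linearIndependent.fintype_card_le_finrank

/-- Once all seeds have been used, the orthonormal vectors span the space, and the pending
candidate, being orthogonal to all of them, is zero. By construction the image of `U t` has no
components beyond `t + 1`; symmetry transposes this and removes the components before `t - 1`. -/
theorem Lanczos.tridiag [FiniteDimensional ℂ E] (hA : A.IsSymmetric)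
    (h : Lanczos A e r j flag w U a b K) (hj : Module.finrank ℂ E < j)
    (he : Submodule.span ℂ (e '' Set.Iio (Module.finrank ℂ E)) = ⊤) :
    r = Module.finrank ℂ E ∧ Tridiag A r U a b K := by
  have hspan : Submodule.span ℂ (U '' Set.Iio r) = ⊤ := by
    rw [eq_top_iff, ← he, Submodule.span_le]
    rintro _ ⟨i, hi, rfl⟩
    rw [Set.mem_Iio] at hi
    -- A seed still pending has number `j - 1`, which by `hj` is not below the dimension.
    rcases h.seeds i (by omega) with h' | ⟨h', -⟩
    · exact h'
    · omega
  have hr : r = Module.finrank ℂ E := by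
    refine le_antisymm h.le_finrank ?_
    rw [← range_fin_eq] at hspan
    rw [← finrank_top, ← hspan]
    have := finrank_range_le_card (R := ℂ) (fun s : Fin r => U s)
    rwa [Fintype.card_fin] at this
  have hw : w = 0 := by
    have : w ∈ Submodule.span ℂ (U '' Set.Iio r) := hspan ▸ Submodule.mem_top
    have hall : ∀ v ∈ Submodule.span ℂ (U '' Set.Iio r), inner ℂ v w = (0 : ℂ) := by
      intro v hv
      induction hv using Submodule.span_induction with
      | mem v hv => obtain ⟨s, hs, rfl⟩ := hv; exact h.worth s hs
      | zero => simp
      | add v v' _ _ h1 h2 => rw [inner_add_left, h1, h2, add_zero]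
      | smul c v _ h1 => rw [inner_smul_left, h1, mul_zero]
    exact inner_self_eq_zero.1 (hall w this)
  refine ⟨hr, h.orth, ?_, h.bK, h.K0⟩
  have hres : ∀ t < r, resid U (t + 1) (A (U t)) = (cutoff b r (t + 1) : ℂ) • U (t + 1) := by
    intro t ht
    by_cases ht' : t + 1 < r
    · rw [h.sub t ht', cutoff, if_pos ht']
    · have e : t + 1 = r := by omega
      rw [e, h.last t e, hw, cutoff]
      simp
  have hexp : ∀ t < r, A (U t) = ∑ s ∈ Finset.range (t + 1), inner ℂ (U s) (A (U t)) • U s +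
      (cutoff b r (t + 1) : ℂ) • U (t + 1) := by
    intro t ht
    rw [← hres t ht, resid]
    abel
  have hcut : ∀ s, ∀ t < r, inner ℂ ((cutoff b r (s + 1) : ℂ) • U (s + 1)) (U t) =
      if s + 1 = t then (b t : ℂ) else 0 := by
    intro s t ht
    by_cases hs : s + 1 < r
    · rw [inner_smul_left, h.orth _ hs _ ht, cutoff, if_pos hs]
      split_ifs with h'
      · simp [h']
      · simp
    · rw [cutoff, if_neg hs, if_neg (show ¬ s + 1 = t by omega)]
      simp
  -- By symmetry the operator may act on `U s` instead, whose image reaches only up to `s + 1 ≤ t`.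
  have hlow : ∀ t < r, ∀ s < t, inner ℂ (U s) (A (U t)) = if s + 1 = t then (b t : ℂ) else 0 := by
    intro t ht s hs
    rw [← hA, hexp s (by omega), inner_add_left, hcut s t ht, sum_inner, Finset.sum_eq_zero, zero_add]
    intro s' hs'
    rw [Finset.mem_range] at hs'
    rw [inner_smul_left, h.orth s' (by omega) t ht, if_neg (by omega), mul_zero]
  intro t ht
  have hdiag : inner ℂ (U t) (A (U t)) = (a t : ℂ) := by
    rw [h.diag t ht]
    have : (starRingEnd ℂ) (inner ℂ (U t) (A (U t))) = inner ℂ (U t) (A (U t)) := by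
      rw [inner_conj_symm, hA]
    exact (Complex.conj_eq_iff_re.1 this).symm
  rw [hexp t ht, Finset.sum_range_succ, hdiag]
  congr 2
  -- Of the components before `t` only the one at `t - 1` survives; for `t = 0` there is none, in
  -- accordance with `b 0 = 0`.
  by_cases h0 : t = 0
  · subst h0
    have : cutoff b r 0 = 0 := by
      rw [cutoff, if_pos ht]
      rcases h.bK 0 ht with h' | h'
      · exact h'.2
      · rw [h.K0 ht] at h'; exact absurd h'.1 (by norm_num)
    simp [this]
  · rw [Finset.sum_eq_single (t - 1)]
    · rw [hlow t ht (t - 1) (by omega), if_pos (by omega), cutoff, if_pos ht]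
    · intro s hs hst
      rw [hlow t ht s (Finset.mem_range.1 hs), if_neg (by omega), zero_smul]
    · intro h'; exact absurd (Finset.mem_range.2 (by omega)) h'

end Lanczos

/-! ### The polynomials of a tridiagonal matrix -/

/-- The polynomials `0, 1, …` with
`β (l + 1) * J (l + 2) = (X - α l) * J (l + 1) - β l * J l`. -/
noncomputable def jacobi (α β : ℕ → ℝ) : ℕ → Polynomial ℝ
  | 0 => 0
  | 1 => 1
  | l + 2 => Polynomial.C (β (l + 1))⁻¹ *
      ((Polynomial.X - Polynomial.C (α l)) * jacobi α β (l + 1) - Polynomial.C (β l) * jacobi α β l)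

theorem jacobi_coeff (α β : ℕ → ℝ) (l c : ℕ) (h : l ≤ c) : (jacobi α β l).coeff c = 0 := by
  induction l using Nat.strong_induction_on generalizing c with
  | _ l ih =>
    match l with
    | 0 => simp [jacobi]
    | 1 => simp [jacobi, Polynomial.coeff_one]; omega
    | l + 2 =>
      obtain ⟨c, rfl⟩ : ∃ c', c = c' + 1 := ⟨c - 1, by omega⟩
      rw [jacobi, sub_mul, Polynomial.coeff_C_mul, Polynomial.coeff_sub, Polynomial.coeff_sub,
        Polynomial.coeff_X_mul, Polynomial.coeff_C_mul, Polynomial.coeff_C_mul,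
        ih (l + 1) (by omega) c (by omega), ih (l + 1) (by omega) (c + 1) (by omega),
        ih l (by omega) (c + 1) (by omega)]
      simp

/-- The leading coefficient is the product of the inverses of `β 1, …, β l`. With the index shifted
by one, polynomial number `l + 1` thus has degree exactly `l`. -/
theorem jacobi_coeff_top (α β : ℕ → ℝ) (l : ℕ) (h : ∀ t < l, β (t + 1) ≠ 0) :
    (jacobi α β (l + 1)).coeff l ≠ 0 := by
  induction l with
  | zero => simp [jacobi]
  | succ l ih =>
    rw [jacobi, sub_mul, Polynomial.coeff_C_mul, Polynomial.coeff_sub, Polynomial.coeff_sub,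
        Polynomial.coeff_X_mul, Polynomial.coeff_C_mul, Polynomial.coeff_C_mul,
        jacobi_coeff α β (l + 1) (l + 1) le_rfl, jacobi_coeff α β l (l + 1) (by omega)]
    simp only [mul_zero, sub_zero]
    exact mul_ne_zero (inv_ne_zero (h l (by omega))) (ih fun t ht => h t (by omega))

theorem jacobi_natDegree (α β : ℕ → ℝ) (l : ℕ) (h : ∀ t < l, β (t + 1) ≠ 0) :
    (jacobi α β (l + 1)).natDegree = l :=
  Polynomial.natDegree_eq_of_le_of_coeff_ne_zero
    (Polynomial.natDegree_le_iff_coeff_eq_zero.2 fun c hc => jacobi_coeff α β _ c hc)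
    (jacobi_coeff_top α β l h)

end DopedStab

namespace DopedStab

/-! ### Eigenvectors of a tridiagonal operator -/

section Block

variable {E : Type*} [NormedAddCommGroup E] [InnerProductSpace ℂ E]
variable {A : E →ₗ[ℂ] E} {d : ℕ} {U : ℕ → E} {a b : ℕ → ℝ} {K : ℕ → ℕ}

/-- `[s, s + L)` is a maximal block of the tridiagonal operator. -/
structure IsBlock (d : ℕ) (K : ℕ → ℕ) (s L : ℕ) : Prop where
  pos : 0 < L
  le : s + L ≤ d
  start : K s = 0
  inner : ∀ l, 0 < l → l < L → K (s + l) ≠ 0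
  next_start : s + L < d → K (s + L) = 0

/-- The diagonal of the block. -/
def blockDiag (a : ℕ → ℝ) (s l : ℕ) : ℝ := a (s + l)
/-- The subdiagonal of the block, with a `1` after its end. -/
def blockSub (b : ℕ → ℝ) (s L l : ℕ) : ℝ := if l = L then 1 else b (s + l)

/-- The vector with coordinates `x 1, …, x L` in the block. -/
noncomputable def blockVec (U : ℕ → E) (s L : ℕ) (x : ℕ → ℂ) : E :=
  ∑ l ∈ Finset.range L, x (l + 1) • U (s + l)

/-- Proved for every initial piece of a block, by adding one coordinate at a time. The last two
terms correct the sum at the right boundary: what flows out to `s + L`, and what the sum wrongly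
counts as flowing in from there. -/
theorem Tridiag.map_blockVec (h : Tridiag A d U a b K) {s L : ℕ} (hs : s + L ≤ d) (hs0 : b s = 0)
    (x : ℕ → ℂ) : A (blockVec U s L x) = ∑ l ∈ Finset.range L,
        ((cutoff b d (s + l) : ℂ) * x l + a (s + l) * x (l + 1) +
          cutoff b d (s + l + 1) * x (l + 2)) • U (s + l) +
      ((cutoff b d (s + L) : ℂ) * x L) • U (s + L) -
      ((cutoff b d (s + L) : ℂ) * x (L + 1)) • U (s + L - 1) := by
  induction L with
  | zero =>
    have : cutoff b d s = 0 := by simp [cutoff, hs0]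
    simp [blockVec, this]
  | succ L ih =>
    have h1 : blockVec U s (L + 1) x = blockVec U s L x + x (L + 1) • U (s + L) := by
      simp [blockVec, Finset.sum_range_succ]
    rw [h1, map_add, map_smul, ih (by omega), h.act (s + L) (by omega), Finset.sum_range_succ,
      show s + (L + 1) - 1 = s + L by omega, show s + (L + 1) = s + L + 1 by omega]
    module

/-- Solutions of the (inhomogeneous) recurrence are (generalized) eigenvectors. -/
theorem Tridiag.map_blockVec_of_rec (h : Tridiag A d U a b K) {s L : ℕ} (hB : IsBlock d K s L)
    {x z : ℕ → ℂ} {μ : ℂ} (hxL : x (L + 1) = 0)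
    (hrec : ∀ l < L, (blockSub b s L (l + 1) : ℂ) * x (l + 2) =
      z (l + 1) + (μ - blockDiag a s l) * x (l + 1) - blockSub b s L l * x l) :
    A (blockVec U s L x) = μ • blockVec U s L x + blockVec U s L z := by
  have hb0 : ∀ t < d, K t = 0 → b t = 0 := fun t ht hK => by
    rcases h.bK t ht with h' | h'
    · exact h'.2
    · omega
  -- Behind the block there is either the start of another one, with zero subdiagonal entry, or the
  -- end of the matrix.
  have hend : cutoff b d (s + L) = 0 := by
    rw [cutoff]
    split_ifs with h'
    · exact hb0 _ h' (hB.next_start h')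
    · rfl
  have hs : s < d := by have := hB.pos; have := hB.le; omega
  rw [h.map_blockVec hB.le (hb0 s hs hB.start), hend]
  simp only [Complex.ofReal_zero, zero_mul, zero_smul, add_zero, sub_zero, blockVec,
    Finset.smul_sum, ← Finset.sum_add_distrib, smul_smul, ← add_smul]
  refine Finset.sum_congr rfl fun l hl => ?_
  rw [Finset.mem_range] at hl
  congr 1
  have h1 : cutoff b d (s + l) = blockSub b s L l := by
    rw [cutoff, if_pos (by have := hB.le; omega), blockSub, if_neg hl.ne]
  have h2 := hrec l hl
  rw [h1]
  -- In the last row the entry `1` of `blockSub` multiplies `x (L + 1) = 0`, in place of the true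
  -- entry, which is zero.
  by_cases hl' : l + 1 = L
  · have h3 : x (l + 2) = 0 := by rw [← hxL, ← hl']
    rw [h3] at h2 ⊢
    rw [blockDiag] at h2
    linear_combination h2
  · have h3 : cutoff b d (s + l + 1) = blockSub b s L (l + 1) := by
      rw [cutoff, if_pos (by have := hB.le; omega), blockSub, if_neg hl', add_assoc]
    rw [h3]
    rw [blockDiag] at h2
    linear_combination h2

theorem Tridiag.inner_blockVec (h : Tridiag A d U a b K) {s L s' L' : ℕ} (hs : s + L ≤ d)
    (hs' : s' + L' ≤ d) (hd : s + L ≤ s' ∨ s' + L' ≤ s) (x y : ℕ → ℂ) :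
    inner ℂ (blockVec U s L x) (blockVec U s' L' y) = (0 : ℂ) := by
  rw [blockVec, sum_inner]
  refine Finset.sum_eq_zero fun l hl => ?_
  rw [blockVec, inner_sum]
  refine Finset.sum_eq_zero fun l' hl' => ?_
  rw [Finset.mem_range] at hl hl'
  rw [inner_smul_left, inner_smul_right, h.orth _ (by omega) _ (by omega), if_neg (by omega)]
  simp

theorem Tridiag.norm_sq_blockVec (h : Tridiag A d U a b K) {s L : ℕ} (hs : s + L ≤ d)
    (x : ℕ → ℂ) : ‖blockVec U s L x‖ ^ 2 = ∑ l ∈ Finset.range L, ‖x (l + 1)‖ ^ 2 := by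
  have : (inner ℂ (blockVec U s L x) (blockVec U s L x) : ℂ) =
      ∑ l ∈ Finset.range L, ((‖x (l + 1)‖ ^ 2 : ℝ) : ℂ) := by
    rw [blockVec, sum_inner]
    refine Finset.sum_congr rfl fun l hl => ?_
    rw [inner_sum, Finset.sum_eq_single l]
    · rw [Finset.mem_range] at hl
      rw [inner_smul_left, inner_smul_right, h.orth _ (by omega) _ (by omega), if_pos rfl, mul_one,
        Complex.conj_mul']
      push_cast; rfl
    · intro l' hl' hll
      rw [Finset.mem_range] at hl hl'
      rw [inner_smul_left, inner_smul_right, h.orth _ (by omega) _ (by omega), if_neg (by omega)]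
      simp
    · intro h'; exact absurd hl h'
  rw [inner_self_eq_norm_sq_to_K] at this
  have h2 : ((‖blockVec U s L x‖ ^ 2 : ℝ) : ℂ) = ((∑ l ∈ Finset.range L, ‖x (l + 1)‖ ^ 2 : ℝ) : ℂ) := by
    push_cast
    push_cast at this
    exact this
  exact_mod_cast h2

/-- The polynomials of the block. -/
noncomputable def blockPoly (a b : ℕ → ℝ) (s L l : ℕ) : Polynomial ℝ :=
  jacobi (blockDiag a s) (blockSub b s L) l

/-- The recurrence divides by these numbers `L` times. Inside the block they are nonzero by
maximality, and the last one is the conventional `1`, which affects the last polynomial only by a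
factor. -/
theorem Tridiag.blockSub_ne (h : Tridiag A d U a b K) {s L : ℕ} (hB : IsBlock d K s L) :
    ∀ t < L, blockSub b s L (t + 1) ≠ 0 := by
  intro t ht
  rw [blockSub]
  split_ifs with h'
  · norm_num
  · rcases h.bK (s + (t + 1)) (by have := hB.le; omega) with h1 | h1
    · exact absurd h1.1 (hB.inner _ (by omega) (by omega))
    · exact h1.2.ne'

open Polynomial in
theorem Tridiag.blockPoly_rec (h : Tridiag A d U a b K) {s L : ℕ} (hB : IsBlock d K s L) {l : ℕ}
    (hl : l < L) : C (blockSub b s L (l + 1)) * blockPoly a b s L (l + 2) =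
      (X - C (blockDiag a s l)) * blockPoly a b s L (l + 1) -
        C (blockSub b s L l) * blockPoly a b s L l := by
  simp only [blockPoly, jacobi]
  rw [← mul_assoc, ← C_mul, mul_inv_cancel₀ (h.blockSub_ne hB l hl), C_1, one_mul]

open Polynomial in
/-- A root of the last polynomial of the block yields an eigenvector. -/
theorem Tridiag.map_blockVec_root (h : Tridiag A d U a b K) {s L : ℕ} (hB : IsBlock d K s L)
    {μ : ℂ} (hμ : aeval μ (blockPoly a b s L (L + 1)) = 0) :
    A (blockVec U s L fun l => aeval μ (blockPoly a b s L l)) =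
      μ • blockVec U s L fun l => aeval μ (blockPoly a b s L l) := by
  have := h.map_blockVec_of_rec hB (x := fun l => aeval μ (blockPoly a b s L l)) (z := 0) (μ := μ)
    hμ fun l hl => by
      have := congrArg (aeval μ) (h.blockPoly_rec hB hl)
      simp only [map_mul, map_sub, aeval_C, aeval_X] at this
      simpa using this
  simpa [blockVec] using this

/-- The first coordinate is the constant polynomial `1`. -/
theorem Tridiag.blockVec_ne_zero (h : Tridiag A d U a b K) {s L : ℕ} (hB : IsBlock d K s L)
    (μ : ℂ) : blockVec U s L (fun l => Polynomial.aeval μ (blockPoly a b s L l)) ≠ 0 := by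
  intro h0
  have h1 := h.norm_sq_blockVec hB.le fun l => Polynomial.aeval μ (blockPoly a b s L l)
  rw [h0] at h1
  have h2 : 0 < ∑ l ∈ Finset.range L, ‖Polynomial.aeval μ (blockPoly a b s L (l + 1))‖ ^ 2 :=
    Finset.sum_pos' (fun _ _ => by positivity) ⟨0, Finset.mem_range.2 hB.pos, by
      simp [blockPoly, jacobi]⟩
  rw [← h1] at h2
  simp at h2

-- Every complex root is an eigenvalue, by `Tridiag.map_blockVec_root`, and a symmetric operator has
-- only real eigenvalues.
open Polynomial in
theorem Tridiag.root_real (h : Tridiag A d U a b K) (hA : A.IsSymmetric) {s L : ℕ}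
    (hB : IsBlock d K s L) {μ : ℂ} (hμ : aeval μ (blockPoly a b s L (L + 1)) = 0) :
    (starRingEnd ℂ) μ = μ :=
  hA.conj_eigenvalue_eq_self (Module.End.hasEigenvalue_of_hasEigenvector
    (Module.End.hasEigenvector_iff.2
      ⟨Module.End.mem_eigenspace_iff.2 (h.map_blockVec_root hB hμ), h.blockVec_ne_zero hB μ⟩))

open Polynomial in
/-- The last polynomial of a block has only simple real roots. -/
theorem Tridiag.card_roots (h : Tridiag A d U a b K) (hA : A.IsSymmetric) {s L : ℕ}
    (hB : IsBlock d K s L) : Multiset.card (blockPoly a b s L (L + 1)).roots = L ∧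
      (blockPoly a b s L (L + 1)).roots.Nodup := by
  set f := blockPoly a b s L (L + 1) with hf
  have hdeg : f.natDegree = L := jacobi_natDegree _ _ _ (h.blockSub_ne hB)
  have hf0 : f ≠ 0 := by
    intro h0
    rw [h0, natDegree_zero] at hdeg
    have := hB.pos; omega
  -- All complex roots being real, the polynomial splits already over the reals.
  have hsplit : f.Splits := by
    refine Splits.of_splits_map (algebraMap ℝ ℂ)
      (IsAlgClosed.splits _) ?_
    intro μ hμ
    rw [mem_roots (map_ne_zero hf0), IsRoot.def, eval_map_algebraMap] at hμ
    exact ⟨μ.re, Complex.conj_eq_iff_re.1 (h.root_real hA hB hμ)⟩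
  refine ⟨by rw [← hsplit.natDegree_eq_card_roots, hdeg], ?_⟩
  rw [Multiset.nodup_iff_count_le_one]
  intro μ
  by_contra hc
  rw [count_roots, not_le, one_lt_rootMultiplicity_iff_isRoot hf0] at hc
  obtain ⟨h1, h2⟩ := hc
  have h1' : aeval (μ : ℂ) f = 0 := by
    rw [← Complex.coe_algebraMap, aeval_algebraMap_apply]
    simpa using h1
  have h2' : aeval (μ : ℂ) (derivative f) = 0 := by
    rw [← Complex.coe_algebraMap, aeval_algebraMap_apply]
    simpa using h2
  -- At a double root the differentiated recurrence gives a vector `Y` with `A Y = μ Y + X`, where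
  -- `X` is the eigenvector. Comparing `⟪A X, Y⟫` with `⟪X, A Y⟫` yields `⟪X, X⟫ = 0`, a
  -- contradiction.
  set x : ℕ → ℂ := fun l => aeval (μ : ℂ) (blockPoly a b s L l) with hx
  set y : ℕ → ℂ := fun l => aeval (μ : ℂ) (derivative (blockPoly a b s L l)) with hy
  have hX := h.map_blockVec_root hB h1'
  have hY := h.map_blockVec_of_rec hB (x := y) (z := x) (μ := μ)
    h2' fun l hl => by
      have := congrArg (fun p => aeval (μ : ℂ) (derivative p)) (h.blockPoly_rec hB hl)
      simp only [derivative_mul, derivative_C, derivative_X, map_mul, map_sub,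
        map_add, aeval_C, aeval_X, zero_mul, zero_add, sub_zero, one_mul] at this
      simpa using this
  have h3 := hA (blockVec U s L x) (blockVec U s L y)
  rw [hX, hY, inner_smul_left, inner_add_right, inner_smul_right, Complex.conj_ofReal] at h3
  exact h.blockVec_ne_zero hB μ (inner_self_eq_zero.1 (by linear_combination -h3))

/-- The normalized eigenvector of the block belonging to the root `μ`. -/
noncomputable def blockEig (U : ℕ → E) (a b : ℕ → ℝ) (s L : ℕ) (μ : ℝ) : E :=
  (((Real.sqrt (∑ l ∈ Finset.range L, (blockPoly a b s L (l + 1)).eval μ ^ 2))⁻¹ : ℝ) : ℂ) •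
    blockVec U s L fun l => (((blockPoly a b s L l).eval μ : ℝ) : ℂ)

theorem aeval_ofReal (p : Polynomial ℝ) (μ : ℝ) :
    Polynomial.aeval (μ : ℂ) p = ((p.eval μ : ℝ) : ℂ) := by
  rw [← Complex.coe_algebraMap, Polynomial.aeval_algebraMap_apply]
  simp

theorem Tridiag.norm_blockEig (h : Tridiag A d U a b K) {s L : ℕ} (hB : IsBlock d K s L) (μ : ℝ) :
    ‖blockEig U a b s L μ‖ = 1 := by
  have h0 := h.blockVec_ne_zero hB μ
  have h1 := h.norm_sq_blockVec hB.le fun l => Polynomial.aeval (μ : ℂ) (blockPoly a b s L l)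
  simp only [aeval_ofReal] at h0 h1
  have h2 : Real.sqrt (∑ l ∈ Finset.range L, (blockPoly a b s L (l + 1)).eval μ ^ 2) =
      ‖blockVec U s L fun l => (((blockPoly a b s L l).eval μ : ℝ) : ℂ)‖ := by
    rw [Real.sqrt_eq_iff_eq_sq (Finset.sum_nonneg fun _ _ => by positivity) (norm_nonneg _), h1]
    refine Finset.sum_congr rfl fun l _ => ?_
    rw [Complex.norm_real, Real.norm_eq_abs, sq_abs]
  rw [blockEig, norm_smul, h2, Complex.norm_real, norm_inv, norm_norm,
    inv_mul_cancel₀ (norm_ne_zero_iff.2 h0)]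

theorem Tridiag.map_blockEig (h : Tridiag A d U a b K) {s L : ℕ} (hB : IsBlock d K s L) {μ : ℝ}
    (hμ : (blockPoly a b s L (L + 1)).eval μ = 0) :
    A (blockEig U a b s L μ) = (μ : ℂ) • blockEig U a b s L μ := by
  have := h.map_blockVec_root hB (μ := μ) (by rw [aeval_ofReal, hμ, Complex.ofReal_zero])
  simp only [aeval_ofReal] at this
  rw [blockEig, map_smul, this, smul_comm]

/-- The sorted roots of the block. -/
noncomputable def blockRoots (a b : ℕ → ℝ) (s L : ℕ) : List ℝ :=
  (blockPoly a b s L (L + 1)).roots.sort (· ≤ ·)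

/-- A block starts where `K` vanishes and contains no other zero of `K`, so two blocks that overlap
start, and then also end, at the same place. -/
theorem IsBlock.eq_or_disjoint {s L s' L' : ℕ} (h : IsBlock d K s L) (h' : IsBlock d K s' L') :
    (s = s' ∧ L = L') ∨ s + L ≤ s' ∨ s' + L' ≤ s := by
  by_contra hc
  have := h.pos; have := h'.pos; have := h.le; have := h'.le
  have hs : s = s' := by
    rcases lt_trichotomy s s' with hs | hs | hs
    · have := h.inner (s' - s) (by omega) (by omega)
      rw [show s + (s' - s) = s' by omega] at this
      exact absurd h'.start this
    · exact hs
    · have := h'.inner (s - s') (by omega) (by omega)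
      rw [show s' + (s - s') = s by omega] at this
      exact absurd h.start this
  subst hs
  rcases lt_trichotomy L L' with hs | hs | hs
  · exact absurd (h.next_start (by omega)) (h'.inner L (by omega) hs)
  · subst hs; omega
  · exact absurd (h'.next_start (by omega)) (h.inner L' (by omega) hs)

/-- The eigenvectors found in all blocks form an orthonormal system of eigenvectors. -/
theorem Tridiag.orthonormal (h : Tridiag A d U a b K) (hA : A.IsSymmetric) (S L : Fin d → ℕ)
    (hB : ∀ i, IsBlock d K (S i) (L i)) (hi : ∀ i : Fin d, S i ≤ i ∧ i < S i + L i) :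
    let μ : Fin d → ℝ := fun i => (blockRoots a b (S i) (L i)).getD (i - S i) 0
    (Orthonormal ℂ fun i => blockEig U a b (S i) (L i) (μ i)) ∧
      ∀ i, A (blockEig U a b (S i) (L i) (μ i)) =
        (μ i : ℂ) • blockEig U a b (S i) (L i) (μ i) := by
  intro μ
  have hlen : ∀ i, (blockRoots a b (S i) (L i)).length = L i := fun i => by
    rw [blockRoots, Multiset.length_sort, (h.card_roots hA (hB i)).1]
  have hμ : ∀ i, ∃ h' : i - S i < (blockRoots a b (S i) (L i)).length,
      μ i = (blockRoots a b (S i) (L i))[i - S i] := fun i => by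
    have h' : i - S i < (blockRoots a b (S i) (L i)).length := by
      rw [hlen]; have := hi i; omega
    exact ⟨h', List.getD_eq_getElem _ _ h'⟩
  have hroot : ∀ i, (blockPoly a b (S i) (L i) (L i + 1)).eval (μ i) = 0 := fun i => by
    obtain ⟨h', he⟩ := hμ i
    have : μ i ∈ (blockPoly a b (S i) (L i) (L i + 1)).roots := by
      rw [he, ← Multiset.mem_sort (r := (· ≤ ·))]
      exact List.getElem_mem h'
    exact (Polynomial.mem_roots'.1 this).2
  have hA' := fun i => h.map_blockEig (hB i) (hroot i)
  refine ⟨⟨fun i => h.norm_blockEig (hB i) _, fun i j hij => ?_⟩, hA'⟩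
  dsimp only
  -- Within one block different indices select different roots, and eigenvectors to different
  -- eigenvalues are orthogonal; eigenvectors of different blocks have disjoint supports.
  rcases (hB i).eq_or_disjoint (hB j) with ⟨hS, hL⟩ | hd
  · have hne : μ i ≠ μ j := by
      obtain ⟨h1, e1⟩ := hμ i
      obtain ⟨h2, e2⟩ := hμ j
      have hnd : (blockRoots a b (S i) (L i)).Nodup := by
        rw [blockRoots, ← Multiset.coe_nodup, Multiset.sort_eq]
        exact (h.card_roots hA (hB i)).2
      intro he
      rw [e1, e2] at he
      have e3 : (blockRoots a b (S j) (L j)) = (blockRoots a b (S i) (L i)) := by rw [hS, hL]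
      simp only [e3] at he
      have := (hnd.getElem_inj_iff).1 he
      have := hi i; have := hi j
      exact hij (Fin.ext (by omega))
    have h1 := hA (blockEig U a b (S i) (L i) (μ i)) (blockEig U a b (S j) (L j) (μ j))
    rw [hA' i, hA' j, inner_smul_left, inner_smul_right, Complex.conj_ofReal] at h1
    have h2 : ((μ i : ℂ) - μ j) * inner ℂ (blockEig U a b (S i) (L i) (μ i))
        (blockEig U a b (S j) (L j) (μ j)) = 0 := by linear_combination h1
    rcases mul_eq_zero.1 h2 with h3 | h3
    · exact absurd (by exact_mod_cast sub_eq_zero.1 h3) hne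
    · exact h3
  · rw [blockEig, blockEig, inner_smul_left, inner_smul_right,
      h.inner_blockVec (hB i).le (hB j).le hd]
    simp

end Block

end DopedStab

namespace DopedStab

/-! ### The Lanczos process as a program -/

/-- The complex vector in row `i` of the real arrays `R` (real parts) and `J` (imaginary parts). -/
noncomputable def memVec (s : Memory) (R J i d : ℕ) : EuclideanSpace ℂ (Fin d) :=
  WithLp.toLp 2 fun v => ⟨s.real R i v, s.real J i v⟩

@[simp] theorem memVec_re (s : Memory) (R J i d : ℕ) (v : Fin d) :
    (memVec s R J i d v).re = s.real R i v := rfl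
@[simp] theorem memVec_im (s : Memory) (R J i d : ℕ) (v : Fin d) :
    (memVec s R J i d v).im = s.real J i v := rfl

theorem memVec_congr {s s' : Memory} {R J i d : ℕ}
    (hR : ∀ v, v < d → s'.real R i v = s.real R i v) (hJ : ∀ v, v < d → s'.real J i v = s.real J i v) :
    memVec s' R J i d = memVec s R J i d := by
  ext v
  exact Complex.ext (hR v v.2) (hJ v v.2)

theorem Same.memVec {N R : List ℕ} {s s' : Memory} (h : Same N R s s') {a b : ℕ} (ha : a ∉ R)
    (hb : b ∉ R) (i d : ℕ) : memVec s' a b i d = memVec s a b i d :=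
  memVec_congr (fun v _ => by rw [h.real a ha]) (fun v _ => by rw [h.real b hb])

variable {d : ℕ}

theorem re_inner_eq (x y : EuclideanSpace ℂ (Fin d)) :
    (inner ℂ x y : ℂ).re = ∑ v, ((x v).re * (y v).re + (x v).im * (y v).im) := by
  rw [PiLp.inner_apply, Complex.re_sum]
  refine Finset.sum_congr rfl fun v _ => ?_
  simp
  ring

theorem im_inner_eq (x y : EuclideanSpace ℂ (Fin d)) :
    (inner ℂ x y : ℂ).im = ∑ v, ((x v).re * (y v).im - (x v).im * (y v).re) := by
  rw [PiLp.inner_apply, Complex.im_sum]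
  refine Finset.sum_congr rfl fun v _ => ?_
  simp
  ring

theorem norm_sq_eq_sum (x : EuclideanSpace ℂ (Fin d)) :
    ‖x‖ ^ 2 = ∑ v, ((x v).re * (x v).re + (x v).im * (x v).im) := by
  rw [EuclideanSpace.norm_sq_eq]
  exact Finset.sum_congr rfl fun v _ => by rw [Complex.sq_norm, Complex.normSq_apply]

/-- The inner product of row `row` of the basis vectors with the candidate. -/
def innerProg (row : NExp) : Program :=
  .sumR 23 (nv 15) 21 (.get 15 row (nv 23) * .get 17 0 (nv 23) +
    .get 16 row (nv 23) * .get 18 0 (nv 23)) ;;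
  .sumR 23 (nv 15) 22 (.get 15 row (nv 23) * .get 18 0 (nv 23) -
    .get 16 row (nv 23) * .get 17 0 (nv 23))

theorem runs_innerProg {s : Memory} {row : NExp} {ρ : ℕ} (hd : s.nat 15 0 0 = d)
    (hρ : ∀ s', Same [23] [21, 22] s s' → row.eval s' = ρ) :
    Runs (innerProg row) s (6 * d + 6) fun s' => Same [23] [21, 22] s s' ∧
      s'.real 21 0 0 = (inner ℂ (memVec s 15 16 ρ d) (memVec s 17 18 0 d) : ℂ).re ∧
      s'.real 22 0 0 = (inner ℂ (memVec s 15 16 ρ d) (memVec s 17 18 0 d) : ℂ).im := by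
  refine (Runs.seq' (T₁ := 3 * d + 3) (T₂ := 3 * d + 3) (Runs.sumR d
    (fun v => s.real 15 ρ v * s.real 17 0 v + s.real 16 ρ v * s.real 18 0 v)
    (fun s' h => by simp [h.nat, hd]) ?_) ?_).mono (by omega) fun _ h => h
  · intro i s' hi hS hv
    simp [hS.real, hv, hρ s' (hS.mono (by decide) (by decide))]
  · rintro s₁ ⟨S₁, h₁⟩
    refine (Runs.sumR d (fun v => s.real 15 ρ v * s.real 18 0 v - s.real 16 ρ v * s.real 17 0 v)
      (fun s' h => by simp [h.nat, S₁.nat, hd]) ?_).mono le_rfl ?_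
    · intro i s' hi hS hv
      simp [hS.real, S₁.real, hv,
        hρ s' ((S₁.mono (by decide) (by decide)).trans (hS.mono (by decide) (by decide)))]
    · rintro s₂ ⟨S₂, h₂⟩
      refine ⟨(S₁.mono (by decide) (by decide)).trans (S₂.mono (by decide) (by decide)), ?_, ?_⟩
      · rw [S₂.real 21 (by decide), h₁, re_inner_eq, Finset.sum_range]
        rfl
      · rw [h₂, im_inner_eq, Finset.sum_range]
        rfl

/-- The memory holds the matrix `M` in the real arrays `13` and `14`. -/
def MatAt (s : Memory) (M : Matrix (Fin d) (Fin d) ℂ) : Prop :=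
  ∀ v w : Fin d, s.real 13 v w = (M v w).re ∧ s.real 14 v w = (M v w).im

/-- Replace the candidate by the image of the basis vector in row `nv 30`. -/
def matVecProg : Program :=
  .forUp 24 (nv 15) (
    .sumR 23 (nv 15) 21 (.get 13 (nv 24) (nv 23) * .get 15 (nv 30) (nv 23) -
      .get 14 (nv 24) (nv 23) * .get 16 (nv 30) (nv 23)) ;;
    .sumR 23 (nv 15) 22 (.get 13 (nv 24) (nv 23) * .get 16 (nv 30) (nv 23) +
      .get 14 (nv 24) (nv 23) * .get 15 (nv 30) (nv 23)) ;;
    .setReal 17 0 (nv 24) (rv 21) ;; .setReal 18 0 (nv 24) (rv 22))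

theorem runs_matVecProg {s : Memory} {M : Matrix (Fin d) (Fin d) ℂ} {r : ℕ}
    (hd : s.nat 15 0 0 = d) (hM : MatAt s M) (hr : s.nat 30 0 0 = r) :
    Runs matVecProg s (6 * d ^ 2 + 10 * d + 2) fun s' =>
      Same [23, 24] [17, 18, 21, 22] s s' ∧
      memVec s' 17 18 0 d = Matrix.toEuclideanLin M (memVec s 15 16 r d) := by
  refine (Runs.forUp (T := 6 * d + 8) (M := d) (fun i s' => Same [23, 24] [17, 18, 21, 22] s s' ∧
    ∀ v : Fin d, v < i →
      memVec s' 17 18 0 d v = Matrix.toEuclideanLin M (memVec s 15 16 r d) v)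
    ⟨(Same.refl _ _ _).setNat (by simp) _ _ _, by simp⟩
    (fun i s' _ h => by simp [h.1.nat, hd]) ?_ ?_).mono (by ring_nf; omega) fun _ h => h
  · rintro i s' hi ⟨hS, hvec⟩ hv
    refine (Runs.seq' (T₁ := 3 * d + 3) (T₂ := (3 * d + 3) + (1 + 1)) (Runs.sumR d
      (fun w => s.real 13 i w * s.real 15 r w - s.real 14 i w * s.real 16 r w)
      (fun s' h => by simp [h.nat, hS.nat, hd]) ?_) ?_).mono (by omega) fun _ h => h
    · intro w s₁ hw S₁ hw'
      simp [S₁.real, hS.real, hw', S₁.nat, hS.nat, hv, hr]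
    · rintro s₁ ⟨S₁, h₁⟩
      refine Runs.seq' (Runs.sumR d
        (fun w => s.real 13 i w * s.real 16 r w + s.real 14 i w * s.real 15 r w)
        (fun s' h => by simp [h.nat, S₁.nat, hS.nat, hd]) ?_) ?_
      · intro w s₂ hw S₂ hw'
        simp [S₂.real, S₁.real, hS.real, hw', S₂.nat, S₁.nat, hS.nat, hv, hr]
      · rintro s₂ ⟨S₂, h₂⟩
        refine Runs.seq (Runs.setReal (Runs.setReal ?_))
        have hv₂ : s₂.nat 24 0 0 = i := by simp [S₂.nat, S₁.nat, hv]
        simp only [NExp.eval_get, NExp.eval_ofNat, RExp.eval_get, Memory.setReal_nat, hv₂]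
        have S₃ : Same [23, 24] [17, 18, 21, 22] s' s₂ :=
          (S₁.mono (by decide) (by decide)).trans (S₂.mono (by decide) (by decide))
        refine ⟨by simp, (((hS.trans S₃).setReal (by simp) _ _ _).setReal (by simp) _ _ _).setNat
          (by simp) _ _ _, fun v hvi => ?_⟩
        have hcoord : (Matrix.toEuclideanLin M (memVec s 15 16 r d) v) =
          ∑ w, M v w * memVec s 15 16 r d w := by
          rw [Matrix.toLpLin_apply]; rfl
        have h15 : ∀ w, s₂.real 21 w = s₁.real 21 w := fun w => by rw [S₂.real 21 (by decide)]
        by_cases hvv : (v : ℕ) = i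
        · rw [hcoord]
          refine Complex.ext ?_ ?_
          · rw [Complex.re_sum, memVec_re]
            simp only [Memory.setNat_real]
            rw [Memory.setReal_real_ne _ _ _ _ _ _ (by norm_num), hvv, Memory.setReal_real_same,
              h15, h₁, Finset.sum_range]
            refine Finset.sum_congr rfl fun w _ => ?_
            rw [Complex.mul_re, ← (hM v w).1, ← (hM v w).2, hvv]
            simp
          · rw [Complex.im_sum, memVec_im]
            simp only [Memory.setNat_real]
            rw [hvv, Memory.setReal_real_same, Memory.setReal_real_ne _ _ _ _ _ _ (by norm_num),
              h₂, Finset.sum_range]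
            refine Finset.sum_congr rfl fun w _ => ?_
            rw [Complex.mul_im, ← (hM v w).1, ← (hM v w).2, hvv]
            simp
        · rw [← hvec v (by omega)]
          refine Complex.ext ?_ ?_
          · simp [Memory.setReal_real, hvv, S₂.real, S₁.real]
          · simp [Memory.setReal_real, hvv, S₂.real, S₁.real]
  · rintro s' ⟨hS, hvec⟩ -
    exact ⟨hS, by ext v; exact hvec v v.2⟩

/-- Project the basis vectors out of the candidate. -/
def gramSchmidtProg : Program :=
  .forUp 25 (nv 30) (innerProg (nv 25) ;;
    .mapR 23 (nv 15) 17 0 (.get 17 0 (nv 23) -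
      (rv 21 * .get 15 (nv 25) (nv 23) - rv 22 * .get 16 (nv 25) (nv 23))) ;;
    .mapR 23 (nv 15) 18 0 (.get 18 0 (nv 23) -
      (rv 21 * .get 16 (nv 25) (nv 23) + rv 22 * .get 15 (nv 25) (nv 23))))

theorem runs_gramSchmidtProg {s : Memory} {r : ℕ} (hd : s.nat 15 0 0 = d)
    (hr : s.nat 30 0 0 = r) (hrd : r ≤ d)
    (horth : ∀ t < r, ∀ t' < r, inner ℂ (memVec s 15 16 t d) (memVec s 15 16 t' d) =
      if t = t' then (1 : ℂ) else 0) :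
    Runs gramSchmidtProg s (12 * d ^ 2 + 12 * d + 2) fun s' =>
      Same [23, 25] [17, 18, 21, 22] s s' ∧
      memVec s' 17 18 0 d = resid (fun t => memVec s 15 16 t d) r (memVec s 17 18 0 d) := by
  refine (Runs.forUp (T := 12 * d + 10) (M := r) (fun i s' => Same [23, 25] [17, 18, 21, 22] s s' ∧
    memVec s' 17 18 0 d = resid (fun t => memVec s 15 16 t d) i (memVec s 17 18 0 d))
    ⟨(Same.refl _ _ _).setNat (by simp) _ _ _, by simp [resid]; rfl⟩
    (fun i s' _ h => by simp [h.1.nat, hr]) ?_ ?_).mono (by nlinarith) fun _ h => h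
  · rintro i s' hi ⟨hS, hvec⟩ hv
    refine (Runs.seq' (T₁ := 6 * d + 6) (T₂ := (3 * d + 2) + (3 * d + 2))
      (runs_innerProg (ρ := i) (by simp [hS.nat, hd]) fun s₁ S₁ => by simp [S₁.nat, hv]) ?_).mono
      (by omega) fun _ h => h
    rintro s₁ ⟨S₁, hre, him⟩
    rw [hS.memVec (by decide) (by decide)] at hre him
    -- The program takes the coefficient with the partly reduced candidate. Since the basis vectors
    -- are orthonormal, it equals the coefficient with the original one, as `resid` demands.
    have hinner : (inner ℂ (memVec s 15 16 i d) (memVec s' 17 18 0 d) : ℂ) =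
        inner ℂ (memVec s 15 16 i d) (memVec s 17 18 0 d) := by
      rw [hvec, resid, inner_sub_right, inner_sum, Finset.sum_eq_zero, sub_zero]
      intro t ht
      rw [Finset.mem_range] at ht
      rw [inner_smul_right, horth i hi t (by omega), if_neg (by omega), mul_zero]
    rw [hinner] at hre him
    set c : ℂ := inner ℂ (memVec s 15 16 i d) (memVec s 17 18 0 d) with hc
    refine Runs.seq' (Runs.mapR d 0
      (fun v => s'.real 17 0 v - (c.re * s.real 15 i v - c.im * s.real 16 i v))
      (fun s₂ S₂ => by simp [S₂.nat, S₁.nat, hS.nat, hd]) (fun s₂ S₂ => by simp) ?_) ?_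
    · intro v s₂ hvd S₂ hv₂ hold
      have : s₂.real 17 0 v = s'.real 17 0 v := by
        rw [hold 0 v (by omega), S₁.real 17 (by decide)]
      simp [hv₂, this, S₂.real, hre, him, S₁.real, hS.real, S₂.nat, S₁.nat, hv]
    rintro s₂ ⟨S₂, h₂⟩
    refine (Runs.mapR d 0
      (fun v => s'.real 18 0 v - (c.re * s.real 16 i v + c.im * s.real 15 i v))
      (fun s₃ S₃ => by simp [S₃.nat, S₂.nat, S₁.nat, hS.nat, hd]) (fun s₃ S₃ => by simp) ?_).mono
      le_rfl ?_
    · intro v s₃ hvd S₃ hv₃ hold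
      have : s₃.real 18 0 v = s'.real 18 0 v := by
        rw [hold 0 v (by omega), S₂.real 18 (by decide), S₁.real 18 (by decide)]
      simp [hv₃, this, S₃.real, S₂.real, hre, him, S₁.real, hS.real, S₃.nat, S₂.nat, S₁.nat, hv]
    rintro s₃ ⟨S₃, h₃⟩
    have S₃' : Same [23, 25] [17, 18, 21, 22] s' s₃ :=
      ((S₁.mono (by decide) (by decide)).trans (S₂.mono (by decide) (by decide))).trans
        (S₃.mono (by decide) (by decide))
    refine ⟨by simp [S₃.nat, S₂.nat, S₁.nat, hv],
      (hS.trans S₃').setNat (by simp) _ _ _, ?_⟩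
    have hstep : resid (fun t => memVec s 15 16 t d) (i + 1) (memVec s 17 18 0 d) =
        resid (fun t => memVec s 15 16 t d) i (memVec s 17 18 0 d) - c • memVec s 15 16 i d := by
      rw [resid, resid, Finset.sum_range_succ, sub_sub]
    rw [hstep, ← hvec]
    ext v
    refine Complex.ext ?_ ?_
    · simp only [memVec_re, Memory.setNat_real]
      rw [S₃.real 17 (by decide), h₂, if_pos ⟨rfl, v.2⟩]
      simp
    · simp only [memVec_im, Memory.setNat_real]
      rw [h₃, if_pos ⟨rfl, v.2⟩]
      simp
  · rintro s' h -
    exact h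

/-- The seed vectors. -/
noncomputable def seedVec (d i : ℕ) : EuclideanSpace ℂ (Fin d) :=
  WithLp.toLp 2 fun v => if (v : ℕ) = i then 1 else 0

/-- The state of the Lanczos process in memory. -/
structure LanczosAt (s : Memory) (M : Matrix (Fin d) (Fin d) ℂ) (r j : ℕ) : Prop where
  dim : s.nat 15 0 0 = d
  mat : MatAt s M
  r_eq : s.nat 30 0 0 = r
  j_eq : s.nat 31 0 0 = j
  inv : Lanczos (Matrix.toEuclideanLin M) (seedVec d) r j (s.nat 32 0 0) (memVec s 17 18 0 d)
    (fun t => memVec s 15 16 t d) (s.real 23 0) (s.real 24 0) (s.nat 33 0)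

/-- One step of the Lanczos process. -/
def lanczosStep : Program :=
  .sumR 23 (nv 15) 21 (.get 17 0 (nv 23) * .get 17 0 (nv 23) +
    .get 18 0 (nv 23) * .get 18 0 (nv 23)) ;;
  .ite (.rle (rv 21) 0)
    (.mapR 23 (nv 15) 17 0 0 ;; .mapR 23 (nv 15) 18 0 0 ;; .setReal 17 0 (nv 31) 1 ;;
      .setNat 31 0 0 (nv 31 + 1) ;; .setNat 32 0 0 0)
    (.setReal 19 0 0 (.sqrt (rv 21)) ;;
      .mapR 23 (nv 15) 15 (nv 30) (.get 17 0 (nv 23) / rv 19) ;;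
      .mapR 23 (nv 15) 16 (nv 30) (.get 18 0 (nv 23) / rv 19) ;;
      .ite (.le 1 (nv 32)) (.setReal 24 0 (nv 30) (rv 19)) (.setReal 24 0 (nv 30) 0) ;;
      .setNat 33 0 (nv 30) (nv 32) ;;
      matVecProg ;; innerProg (nv 30) ;; .setReal 23 0 (nv 30) (rv 21) ;;
      .setNat 30 0 0 (nv 30 + 1) ;; .setNat 32 0 0 1) ;;
  gramSchmidtProg

/-- The integer arrays changed by the Lanczos process, without the main counter. -/
abbrev lanNat : List ℕ := [23, 24, 25, 30, 31, 32, 33]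
/-- The real arrays changed by the Lanczos process. -/
abbrev lanReal : List ℕ := [15, 16, 17, 18, 19, 21, 22, 23, 24]

theorem MatAt.same {s s' : Memory} {M : Matrix (Fin d) (Fin d) ℂ} (h : MatAt s M) {N R : List ℕ}
    (hS : Same N R s s') (hR : [13, 14].all (· ∉ R) = true) : MatAt s' M := by
  simp at hR
  intro v w
  rw [hS.real _ hR.1, hS.real _ hR.2]
  exact h v w

/-- Either the candidate is nonzero and becomes a basis vector, its image being the next candidate,
or it is zero and the next seed takes its place. Orthogonalizing the new candidate restores the
invariant in both cases. -/
theorem runs_lanczosStep {s : Memory} {M : Matrix (Fin d) (Fin d) ℂ} {r j : ℕ}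
    (h : LanczosAt s M r j) :
    Runs lanczosStep s (18 * d ^ 2 + 40 * d + 40) fun s' => Same lanNat lanReal s s' ∧
      (LanczosAt s' M (r + 1) j ∨ LanczosAt s' M r (j + 1)) := by
  have hrd : r ≤ d := by simpa using h.inv.le_finrank
  refine (Runs.seq' (T₁ := 3 * d + 3) (T₂ := (6 * d ^ 2 + 22 * d + 30 + 1) +
    (12 * d ^ 2 + 12 * d + 2)) (Runs.sumR d
    (fun v => s.real 17 0 v * s.real 17 0 v + s.real 18 0 v * s.real 18 0 v)
    (fun s' h' => by simp [h'.nat, h.dim]) ?_) ?_).mono (by omega) fun _ h => h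
  · intro i s' hi hS hv
    simp [hS.real, hv]
  rintro s₁ ⟨S₁, h₁⟩
  have hnorm : s₁.real 21 0 0 = ‖memVec s 17 18 0 d‖ ^ 2 := by
    rw [h₁, norm_sq_eq_sum, Finset.sum_range]; rfl
  -- The intermediate assertion is the invariant for the candidate as it will be after Gram–Schmidt.
  refine Runs.seq' (Mid := fun s' => Same lanNat lanReal s s' ∧ ∃ r' j', r' ≤ d ∧
    (r' = r + 1 ∧ j' = j ∨ r' = r ∧ j' = j + 1) ∧ s'.nat 30 0 0 = r' ∧ s'.nat 31 0 0 = j' ∧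
    ∀ w, w = resid (fun t => memVec s' 15 16 t d) r' (memVec s' 17 18 0 d) →
    Lanczos (Matrix.toEuclideanLin M) (seedVec d) r' j' (s'.nat 32 0 0) w
      (fun t => memVec s' 15 16 t d) (s'.real 23 0) (s'.real 24 0) (s'.nat 33 0))
    (Runs.ite (fun hz => ?_) (fun hz => ?_)) ?_
  · have hw0 : memVec s 17 18 0 d = 0 := by
      have : ‖memVec s 17 18 0 d‖ ^ 2 ≤ 0 := by simpa [hnorm] using hz
      have := sq_nonpos_iff _ |>.1 this
      exact norm_eq_zero.1 this
    refine (Runs.seq' (T₁ := 3 * d + 2) (T₂ := (3 * d + 2) + (1 + (1 + 1))) (Runs.mapR d 0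
      (fun v => 0) (fun s' h' => by simp [h'.nat, S₁.nat, h.dim]) (fun s' h' => by simp)
      fun i s' _ _ _ _ => by simp) ?_).mono (by nlinarith) fun _ h => h
    rintro s₂ ⟨S₂, h₂⟩
    refine Runs.seq' (Runs.mapR d 0
      (fun v => 0) (fun s' h' => by simp [h'.nat, S₂.nat, S₁.nat, h.dim]) (fun s' h' => by simp)
      fun i s' _ _ _ _ => by simp) ?_
    rintro s₃ ⟨S₃, h₃⟩
    refine Runs.seq <| Runs.setReal <| Runs.seq <| Runs.setNat <| Runs.setNat ?_
    have hj₃ : s₃.nat 31 0 0 = j := by simp [S₃.nat, S₂.nat, S₁.nat, h.j_eq]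
    simp only [NExp.eval_ofNat, NExp.eval_get, NExp.eval_add, RExp.eval_ofNat, hj₃,
      Memory.setReal_nat, Nat.cast_one]
    have S₄ : Same [23, 31, 32] [17, 18, 21] s
        (((s₃.setReal 17 0 j 1).setNat 31 0 0 (j + 1)).setNat 32 0 0 0) :=
      (((((S₁.mono (by decide) (by decide)).trans (S₂.mono (by decide) (by decide))).trans
        (S₃.mono (by decide) (by decide))).setReal (by simp) _ _ _).setNat (by simp) _ _ _).setNat
          (by simp) _ _ _
    refine ⟨S₄.mono (by decide) (by decide), r, j + 1, hrd, Or.inr ⟨rfl, rfl⟩, ?_, ?_, ?_⟩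
    · simp [S₃.nat, S₂.nat, S₁.nat, h.r_eq]
    · simp
    · rintro w rfl
      have hseed : memVec (((s₃.setReal 17 0 j 1).setNat 31 0 0 (j + 1)).setNat 32 0 0 0) 17 18 0 d =
          seedVec d j := by
        ext v
        refine Complex.ext ?_ ?_
        · simp only [memVec_re, Memory.setNat_real, Memory.setReal_real, seedVec]
          by_cases hv : (v : ℕ) = j
          · simp [hv]
          · simp [hv, S₃.real, h₂]
        · simp only [memVec_im, Memory.setNat_real, seedVec]
          rw [Memory.setReal_real_ne _ _ _ _ _ _ (by norm_num), h₃, if_pos ⟨rfl, v.2⟩]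
          split_ifs <;> simp
      have hU : (fun t => memVec (((s₃.setReal 17 0 j 1).setNat 31 0 0 (j + 1)).setNat 32 0 0 0)
          15 16 t d) = fun t => memVec s 15 16 t d :=
        funext fun t => S₄.memVec (by decide) (by decide) t d
      rw [hseed, hU, S₄.real 23 (by decide), S₄.real 24 (by decide)]
      have := h.inv
      rw [hw0] at this
      have h33 : s₃.nat 33 = s.nat 33 := by
        rw [← S₄.nat 33 (by decide)]; simp
      simpa [h33] using this.restart
  · have hw0 : memVec s 17 18 0 d ≠ 0 := by
      intro h0
      rw [h0] at hnorm
      apply hz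
      simp [hnorm]
    refine (Runs.seq (T₁ := 1) (T₂ := (3 * d + 2) + ((3 * d + 2) + ((1 + 1) + (1 +
      ((6 * d ^ 2 + 10 * d + 2) + ((6 * d + 6) + (1 + (1 + 1)))))))) (Runs.setReal ?_)).mono
      (by omega) fun _ h => h
    have hsq : Real.sqrt (‖memVec s 17 18 0 d‖ ^ 2) = ‖memVec s 17 18 0 d‖ :=
      Real.sqrt_sq (norm_nonneg _)
    simp only [NExp.eval_ofNat, RExp.eval_sqrt, RExp.eval_get, hnorm, hsq]
    set ν := ‖memVec s 17 18 0 d‖ with hν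
    have S₂ : Same [23] [19, 21] s (s₁.setReal 19 0 0 ν) :=
      (S₁.mono (by decide) (by decide)).setReal (by simp) _ _ _
    have h19 : (s₁.setReal 19 0 0 ν).real 19 0 0 = ν := by simp
    generalize s₁.setReal 19 0 0 ν = s₂ at S₂ h19
    refine Runs.seq' (Runs.mapR d r (fun v => s.real 17 0 v / ν)
      (fun s' h' => by simp [h'.nat, S₂.nat, h.dim])
      (fun s' h' => by simp [h'.nat, S₂.nat, h.r_eq])
      fun i s' _ hS hv _ => by simp [hv, hS.real, S₂.real, h19]) ?_
    rintro s₃ ⟨S₃, h₃⟩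
    refine Runs.seq' (Runs.mapR d r (fun v => s.real 18 0 v / ν)
      (fun s' h' => by simp [h'.nat, S₃.nat, S₂.nat, h.dim])
      (fun s' h' => by simp [h'.nat, S₃.nat, S₂.nat, h.r_eq])
      fun i s' _ hS hv _ => by simp [hv, hS.real, S₃.real, S₂.real, h19]) ?_
    rintro s₄ ⟨S₄, h₄⟩
    have S₄' : Same [23] [15, 16, 19, 21] s s₄ :=
      ((S₂.mono (by decide) (by decide)).trans (S₃.mono (by decide) (by decide))).trans
        (S₄.mono (by decide) (by decide))
    refine Runs.seq' (Mid := fun s₅ => s₅ = s₄.setReal 24 0 r (if s.nat 32 0 0 = 1 then ν else 0))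
      (Runs.ite (fun hf => Runs.setReal ?_) (fun hf => Runs.setReal ?_)) ?_
    · have hf' : s.nat 32 0 0 = 1 := by
        rcases h.inv.flag01 with h0 | h0
        · simp [S₄'.nat, h0] at hf
        · exact h0.1
      simp [S₄'.nat, h.r_eq, hf', S₄.real, S₃.real, h19]
    · have hf' : s.nat 32 0 0 ≠ 1 := by
        intro h0
        simp [S₄'.nat, h0] at hf
      simp [S₄'.nat, h.r_eq, hf']
    rintro s₅ hs₅
    have S₅ : Same [23] [15, 16, 19, 21, 24] s s₅ := by
      rw [hs₅]
      exact (S₄'.mono (by decide) (by decide)).setReal (by simp) _ _ _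
    have h15 : s₅.real 15 = s₄.real 15 := by rw [hs₅]; simp
    have h16 : s₅.real 16 = s₄.real 16 := by rw [hs₅]; simp
    have h24 : ∀ t, s₅.real 24 0 t = if t = r then (if s.nat 32 0 0 = 1 then ν else 0)
        else s.real 24 0 t := fun t => by
      rw [hs₅, Memory.setReal_real, S₄'.real 24 (by decide)]; simp
    refine Runs.seq (Runs.setNat ?_)
    simp only [NExp.eval_get, NExp.eval_ofNat, S₅.nat 30 (by decide), h.r_eq, S₅.nat 32 (by decide)]
    have S₆ : Same [23, 33] [15, 16, 19, 21, 24] s (s₅.setNat 33 0 r (s.nat 32 0 0)) :=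
      (S₅.mono (by decide) (by decide)).setNat (by simp) _ _ _
    have h33 : ∀ t, (s₅.setNat 33 0 r (s.nat 32 0 0)).nat 33 0 t =
        if t = r then s.nat 32 0 0 else s.nat 33 0 t := fun t => by
      rw [Memory.setNat_nat, S₅.nat 33 (by decide)]; simp
    have r15 : (s₅.setNat 33 0 r (s.nat 32 0 0)).real = s₅.real := rfl
    generalize s₅.setNat 33 0 r (s.nat 32 0 0) = s₆ at S₆ h33 r15
    rw [← r15] at h15 h16 h24
    refine Runs.seq' (runs_matVecProg (M := M) (r := r) (by simp [S₆.nat, h.dim])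
      (h.mat.same S₆ (by decide)) (by simp [S₆.nat, h.r_eq])) ?_
    rintro s₇ ⟨S₇, hw₇⟩
    refine Runs.seq' (runs_innerProg (ρ := r) (by simp [S₇.nat, S₆.nat, h.dim])
      fun s' h' => by simp [h'.nat, S₇.nat, S₆.nat, h.r_eq]) ?_
    rintro s₈ ⟨S₈, hre, -⟩
    refine Runs.seq <| Runs.setReal <| Runs.seq <| Runs.setNat <| Runs.setNat ?_
    have h30 : s₈.nat 30 0 0 = r := by simp [S₈.nat, S₇.nat, S₆.nat, h.r_eq]
    simp only [NExp.eval_get, NExp.eval_ofNat, NExp.eval_add, RExp.eval_get, h30,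
      Memory.setReal_nat]
    generalize hs₉ : ((s₈.setReal 23 0 r (s₈.real 21 0 0)).setNat 30 0 0 (r + 1)).setNat 32 0 0 1
      = s₉
    have S₉ : Same [30, 32] [23] s₈ s₉ := by
      rw [← hs₉]
      exact (((Same.refl _ _ _).setReal (by simp) _ _ _).setNat (by simp) _ _ _).setNat
        (by simp) _ _ _
    have hU : ∀ t, memVec s₉ 15 16 t d = memVec s₆ 15 16 t d := fun t => by
      rw [S₉.memVec (by decide) (by decide), S₈.memVec (by decide) (by decide),
        S₇.memVec (by decide) (by decide)]
    have hW : memVec s₉ 17 18 0 d = Matrix.toEuclideanLin M (memVec s₆ 15 16 r d) := by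
      rw [S₉.memVec (by decide) (by decide), S₈.memVec (by decide) (by decide), hw₇]
    have hUr : memVec s₆ 15 16 r d = ((ν⁻¹ : ℝ) : ℂ) • memVec s 17 18 0 d := by
      ext v
      refine Complex.ext ?_ ?_
      · rw [memVec_re, h15, S₄.real 15 (by decide), h₃, if_pos ⟨rfl, v.2⟩]
        show _ = (((ν⁻¹ : ℝ) : ℂ) * memVec s 17 18 0 d v).re
        rw [Complex.re_ofReal_mul, memVec_re, div_eq_inv_mul]
      · rw [memVec_im, h16, h₄, if_pos ⟨rfl, v.2⟩]
        show _ = (((ν⁻¹ : ℝ) : ℂ) * memVec s 17 18 0 d v).im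
        rw [Complex.im_ofReal_mul, memVec_im, div_eq_inv_mul]
    have hUt : ∀ t < r, memVec s₆ 15 16 t d = memVec s 15 16 t d := fun t ht => by
      refine memVec_congr (fun v _ => ?_) (fun v _ => ?_)
      · rw [h15, S₄.real 15 (by decide), h₃, if_neg (by omega), S₂.real 15 (by decide)]
      · rw [h16, h₄, if_neg (by omega), S₃.real 16 (by decide), S₂.real 16 (by decide)]
    have h23 : ∀ t, s₉.real 23 0 t = if t = r then s₈.real 21 0 0 else s.real 23 0 t := fun t => by
      rw [← hs₉, Memory.setNat_real, Memory.setNat_real, Memory.setReal_real,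
        S₈.real 23 (by decide), S₇.real 23 (by decide), S₆.real 23 (by decide)]
      simp
    have h24' : s₉.real 24 = s₆.real 24 := by
      rw [S₉.real 24 (by decide), S₈.real 24 (by decide), S₇.real 24 (by decide)]
    have h33' : s₉.nat 33 = s₆.nat 33 := by
      rw [S₉.nat 33 (by decide), S₈.nat 33 (by decide), S₇.nat 33 (by decide)]
    have key := h.inv.append (U' := fun t => memVec s₆ 15 16 t d) (a' := s₉.real 23 0)
      (b' := s₉.real 24 0) (K' := s₉.nat 33 0) hw0 hUt hUr
      (fun t ht => by rw [h23, if_neg ht.ne])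
      (by rw [h23, if_pos rfl, hre, hw₇, S₇.memVec (by decide) (by decide)])
      (fun t ht => by rw [h24', h24, if_neg ht.ne])
      (by rw [h24', h24, if_pos rfl])
      (fun t ht => by rw [h33', h33, if_neg ht.ne])
      (by rw [h33', h33, if_pos rfl])
    have hS : Same lanNat lanReal s s₉ :=
      (((S₆.mono (by decide) (by decide)).trans (S₇.mono (by decide) (by decide))).trans
        (S₈.mono (by decide) (by decide))).trans (S₉.mono (by decide) (by decide))
    refine ⟨hS, r + 1, j, by simpa using key.le_finrank, Or.inl ⟨rfl, rfl⟩, by simp [← hs₉],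
      ?_, ?_⟩
    · simp [S₉.nat, S₈.nat, S₇.nat, S₆.nat, h.j_eq]
    · rintro w rfl
      have h32 : s₉.nat 32 0 0 = 1 := by simp [← hs₉]
      simp only [hU, hW, h32]
      exact key
  · rintro s₂ ⟨S₂, r', j', hr', hcase, h30, h31, hinv⟩
    refine (runs_gramSchmidtProg (by simp [S₂.nat, h.dim]) h30 hr' (hinv _ rfl).orth).mono le_rfl ?_
    rintro s₃ ⟨S₃, hw⟩
    have hU : ∀ t, memVec s₃ 15 16 t d = memVec s₂ 15 16 t d :=
      fun t => S₃.memVec (by decide) (by decide) t d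
    have : LanczosAt s₃ M r' j' := by
      refine ⟨by simp [S₃.nat, S₂.nat, h.dim], (h.mat.same S₂ (by decide)).same S₃ (by decide),
        by simp [S₃.nat, h30], by simp [S₃.nat, h31], ?_⟩
      have := hinv _ hw
      simp only [hU]
      rwa [S₃.nat 32 (by decide), S₃.nat 33 (by decide), S₃.real 23 (by decide),
        S₃.real 24 (by decide)]
    refine ⟨S₂.trans (S₃.mono (by decide) (by decide)), ?_⟩
    rcases hcase with ⟨rfl, rfl⟩ | ⟨rfl, rfl⟩
    · exact Or.inl this
    · exact Or.inr this

/-- The Lanczos process. -/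
def lanczosProg : Program :=
  .setNat 30 0 0 0 ;; .setNat 31 0 0 0 ;; .setNat 32 0 0 0 ;; .mapR 23 (nv 15) 17 0 0 ;;
  .mapR 23 (nv 15) 18 0 0 ;; .forUp 26 (nv 15 + nv 15 + 1) lanczosStep

/-- Every step increases `r + j` by one. As `r ≤ d`, after `2 * d + 1` steps `j` exceeds `d` and all
seeds have been used. There are `O(d)` steps of cost `O(d ^ 2)`. -/
theorem runs_lanczosProg {s : Memory} {M : Matrix (Fin d) (Fin d) ℂ} (hM : M.IsHermitian)
    (hd : s.nat 15 0 0 = d) (hMs : MatAt s M) :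
    Runs lanczosProg s (300 * (d + 1) ^ 3) fun s' => Same (26 :: lanNat) lanReal s s' ∧
      Tridiag (Matrix.toEuclideanLin M) d (fun t => memVec s' 15 16 t d) (s'.real 23 0)
        (s'.real 24 0) (s'.nat 33 0) := by
  refine (Runs.seq (T₁ := 1) (T₂ := 1 + (1 + ((3 * d + 2) + ((3 * d + 2) +
    ((d + d + 1) * (18 * d ^ 2 + 40 * d + 40 + 2) + 2))))) <| Runs.setNat <| Runs.seq <|
    Runs.setNat <| Runs.seq <| Runs.setNat ?_).mono (by ring_nf; omega) fun _ h => h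
  simp only [NExp.eval_ofNat]
  generalize hs₁ : ((s.setNat 30 0 0 0).setNat 31 0 0 0).setNat 32 0 0 0 = s₁
  have S₁ : Same [30, 31, 32] [] s s₁ := by
    rw [← hs₁]
    exact (((Same.refl _ _ _).setNat (by simp) _ _ _).setNat (by simp) _ _ _).setNat (by simp) _ _ _
  refine Runs.seq' (Runs.mapR d 0
      (fun v => 0) (fun s' h' => by simp [h'.nat, S₁.nat, hd]) (fun s' h' => by simp)
      fun i s' _ _ _ _ => by simp) ?_
  rintro s₂ ⟨S₂, h₂⟩
  refine Runs.seq' (Runs.mapR d 0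
      (fun v => 0) (fun s' h' => by simp [h'.nat, S₂.nat, S₁.nat, hd]) (fun s' h' => by simp)
      fun i s' _ _ _ _ => by simp) ?_
  rintro s₃ ⟨S₃, h₃⟩
  have S₃' : Same lanNat lanReal s s₃ :=
    ((S₁.mono (by decide) (by decide)).trans (S₂.mono (by decide) (by decide))).trans
      (S₃.mono (by decide) (by decide))
  refine Runs.forUp (M := d + d + 1) (fun i s' => Same (26 :: lanNat) lanReal s s' ∧
    ∃ r j, r + j = i ∧ LanczosAt s' M r j) ?_ ?_ ?_ ?_
  · refine ⟨(S₃'.mono (by decide) (by decide)).setNat (by simp) _ _ _, 0, 0, rfl, ?_, ?_, ?_, ?_, ?_⟩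
    · simp [S₃'.nat, hd]
    · exact (hMs.same S₃' (by decide)).same ((Same.refl [26] [] s₃).setNat (by simp) _ _ _)
        (by decide)
    · simp [S₃.nat, S₂.nat, ← hs₁]
    · simp [S₃.nat, S₂.nat, ← hs₁]
    · have hw : memVec (s₃.setNat 26 0 0 0) 17 18 0 d = 0 := by
        ext v
        refine Complex.ext ?_ ?_
        · simp [S₃.real, h₂]
        · simp [h₃]
      have h32 : (s₃.setNat 26 0 0 0).nat 32 0 0 = 0 := by
        simp [S₃.nat, S₂.nat, ← hs₁]
      rw [hw, h32]
      exact Lanczos.start _ _ _ _ _ _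
  · rintro i s' - ⟨hS, -⟩
    simp [hS.nat, hd]
  · rintro i s' hi ⟨hS, r, j, hrj, h⟩ hv
    refine (runs_lanczosStep h).mono le_rfl ?_
    rintro s'' ⟨hS', hor⟩
    have hS₂ : Same [26] [] s'' (s''.setNat 26 0 0 (i + 1)) := (Same.refl _ _ _).setNat (by simp) _ _ _
    refine ⟨by simp [hS'.nat, hv], (hS.trans (hS'.mono (by decide) (by decide))).setNat
      (by simp) _ _ _, ?_⟩
    have step : ∀ r j, LanczosAt s'' M r j → LanczosAt (s''.setNat 26 0 0 (i + 1)) M r j := by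
      intro r j h
      refine ⟨by simpa using h.dim, h.mat.same hS₂ (by decide), by simpa using h.r_eq,
        by simpa using h.j_eq, ?_⟩
      have := h.inv
      simp only [hS₂.memVec (R := []) (by simp) (by simp)]
      rw [hS₂.nat 32 (by decide), hS₂.nat 33 (by decide), hS₂.real 23 (by decide),
        hS₂.real 24 (by decide)]
      exact this
    rcases hor with h' | h'
    · exact ⟨r + 1, j, by omega, step _ _ h'⟩
    · exact ⟨r, j + 1, by omega, step _ _ h'⟩
  · rintro s' ⟨hS, r, j, hrj, h⟩ -
    refine ⟨hS, ?_⟩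
    have hr : r ≤ d := by simpa using h.inv.le_finrank
    obtain ⟨h1, h2⟩ := h.inv.tridiag (Matrix.isSymmetric_toEuclideanLin_iff.2 hM)
      (by rw [finrank_euclideanSpace_fin]; omega) (by
        rw [finrank_euclideanSpace_fin, eq_top_iff]
        rintro x -
        have : x = ∑ v : Fin d, x v • seedVec d v := by
          ext w
          simp [seedVec, ← Fin.ext_iff]
        rw [this]
        exact Submodule.sum_mem _ fun v _ => Submodule.smul_mem _ _
          (Submodule.subset_span ⟨v, v.2, rfl⟩))
    rw [finrank_euclideanSpace_fin] at h1
    rwa [h1] at h2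

end DopedStab

namespace DopedStab

/-! ### The blocks of the conjugated Hamiltonian -/

/-- The bits of a number. -/
def decBits (q a : ℕ) : Bits q := fun l => a.testBit l

theorem ofBits_eq_sum {q : ℕ} (y : Bits q) : ∑ l, (y l).toNat * 2 ^ (l : ℕ) = Nat.ofBits y := by
  induction q with
  | zero => simp
  | succ q ih =>
    rw [Nat.ofBits_succ, ← ih, Fin.sum_univ_succ, Finset.mul_sum, add_comm]
    simp only [Fin.val_succ, pow_succ, Fin.val_zero, pow_zero, mul_one, Function.comp]
    congr 1
    exact Finset.sum_congr rfl fun l _ => by ring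

theorem decBits_ofBits {q : ℕ} (y : Bits q) : decBits q (Nat.ofBits y) = y := by
  funext l
  simp [decBits]

theorem ofBits_decBits {q a : ℕ} (h : a < 2 ^ q) : Nat.ofBits (decBits q a) = a := by
  have := Nat.ofBits_testBit a q
  rwa [Nat.mod_eq_of_lt h] at this

/-- Basis states of `q` qubits are numbered by `0, …, 2 ^ q - 1`. -/
def bitsEquiv (q : ℕ) : Bits q ≃ Fin (2 ^ q) where
  toFun y := ⟨Nat.ofBits y, Nat.ofBits_lt_two_pow y⟩
  invFun a := decBits q a
  left_inv := decBits_ofBits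
  right_inv a := Fin.ext (ofBits_decBits a.2)

theorem ofBits_inj {q : ℕ} {y z : Bits q} : Nat.ofBits y = Nat.ofBits z ↔ y = z :=
  ⟨fun h => (bitsEquiv q).injective (Fin.ext h), fun h => by rw [h]⟩

theorem ofBits_xor {q : ℕ} (y z : Bits q) :
    Nat.ofBits (fun l => y l ^^ z l) = Nat.ofBits y ^^^ Nat.ofBits z := by
  apply Nat.eq_of_testBit_eq
  intro l
  rw [Nat.testBit_xor]
  by_cases h : l < q <;> simp [Nat.testBit_ofBits, h]

variable {n m k q : ℕ}

/-- The basis state with given head and tail. -/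
def joinBits (q : ℕ) (x : Bits (n - q)) (y : Bits q) : Bits n := fun i =>
  if h : (i : ℕ) < n - q then x ⟨i, h⟩ else y ⟨i - (n - q), by omega⟩

theorem headBits_joinBits (x : Bits (n - q)) (y : Bits q) : headBits q (joinBits q x y) = x := by
  funext i
  simp [headBits, joinBits]

theorem tailBits_joinBits (h : q ≤ n) (x : Bits (n - q)) (y : Bits q) :
    tailBits h (joinBits q x y) = y := by
  funext i
  simp [tailBits, joinBits]

theorem joinBits_head_tail (h : q ≤ n) (v : Bits n) :
    joinBits q (headBits q v) (tailBits h v) = v := by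
  funext i
  by_cases h' : (i : ℕ) < n - q
  · simp [headBits, joinBits, h']
  · simp only [joinBits, h', dite_false, tailBits]
    congr 1
    ext
    simp only
    omega

theorem prod_head_tail {M : Type*} [CommMonoid M] (h : q ≤ n) (f : Fin n → M) :
    ∏ i, f i = (∏ i : Fin (n - q), f ⟨i, by omega⟩) * ∏ l : Fin q, f ⟨n - q + l, by omega⟩ := by
  have e : n - q + q = n := by omega
  rw [← (finCongr e).prod_comp, Fin.prod_univ_add]
  rfl

theorem letterOf_entry (x z a b : Bool) : (letterOf x z).entry a b =
    if a = (b ^^ x) then (if x && z then Complex.I else 1) * sgn (z && b) else 0 := by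
  cases x <;> cases z <;> cases a <;> cases b <;> simp [letterOf, Letter.entry, sgn]

/-- The phase `i ^ |a ∧ b|`, where `a` and `b` are regarded as bit strings of length `q`. -/
noncomputable def iph (q a b : ℕ) : ℂ :=
  ∏ l ∈ Finset.range q, if a.testBit l && b.testBit l then Complex.I else 1

theorem iph_ofBits (y z : Bits q) : iph q (Nat.ofBits y) (Nat.ofBits z) =
    ∏ l, if y l && z l then Complex.I else 1 := by
  rw [iph, Finset.prod_range]
  exact Finset.prod_congr rfl fun l _ => by simp

/-- One table of phases `i ^ |a ∧ b|` thereby also provides the signs `(-1) ^ |a ∧ b|`. -/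
theorem iph_sq_ofBits (y z : Bits q) : iph q (Nat.ofBits y) (Nat.ofBits z) ^ 2 =
    ∏ l, sgn (y l && z l) := by
  rw [iph_ofBits, ← Finset.prod_pow]
  refine Finset.prod_congr rfl fun l _ => ?_
  cases y l <;> cases z l <;> simp [sgn]

/-- The sign `(-1) ^ b` as a real number. -/
def rsgn (b : Bool) : ℝ := if b then -1 else 1

theorem sgn_eq (b : Bool) : sgn b = (rsgn b : ℂ) := by cases b <;> simp [sgn, rsgn]

/-- The number of the X-part on the last `q` qubits. -/
def Tab.tailX (T : Tab n) (h : q ≤ n) : ℕ := Nat.ofBits (tailBits h T.x)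
/-- The number of the Z-part on the last `q` qubits. -/
def Tab.tailZ (T : Tab n) (h : q ≤ n) : ℕ := Nat.ofBits (tailBits h T.z)

/-- The sign of a Pauli operator, diagonal on the first `n - q` qubits, on the block `x`. -/
noncomputable def Tab.headSign (T : Tab n) (x : Bits (n - q)) : ℝ :=
  rsgn T.r * ∏ i : Fin (n - q), rsgn (T.z ⟨i, by omega⟩ && x i)

/-- The entry is a product over the qubits. The head factors are diagonal and give a sign that
depends on the block only; the tail factors vanish unless the X-part is the difference of the two
labels, and otherwise give a phase for the letters `Y` and a sign from the Z-part. -/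
theorem Tab.mat_apply_of_head (T : Tab n) (h : q ≤ n)
    (hT : ∀ i : Fin n, (i : ℕ) < n - q → T.x i = false) (v w : Bits n) :
    T.mat v w = if headBits q v = headBits q w then
      (T.headSign (headBits q w) : ℂ) *
        (if T.tailX h = Nat.ofBits (tailBits h v) ^^^ Nat.ofBits (tailBits h w) then
          iph q (T.tailX h) (T.tailZ h) * iph q (T.tailZ h) (Nat.ofBits (tailBits h w)) ^ 2
        else 0)
      else 0 := by
  rw [Tab.mat, Matrix.smul_apply, smul_eq_mul, PauliString.mat, Matrix.of_apply,
    prod_head_tail h]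
  have hhead : (∏ i : Fin (n - q), (T.letters ⟨i, by omega⟩).entry (v ⟨i, by omega⟩)
      (w ⟨i, by omega⟩)) = if headBits q v = headBits q w then
        ∏ i : Fin (n - q), sgn (T.z ⟨i, by omega⟩ && headBits q w i) else 0 := by
    split_ifs with hvw
    · refine Finset.prod_congr rfl fun i _ => ?_
      have : v ⟨i, by omega⟩ = w ⟨i, by omega⟩ := congrFun hvw i
      rw [Tab.letters, letterOf_entry, hT _ i.2, this]
      simp [headBits]
    · have : ∃ i, headBits q v i ≠ headBits q w i := by
        by_contra! hc
        exact hvw (funext hc)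
      obtain ⟨i, hi⟩ := this
      refine Finset.prod_eq_zero (Finset.mem_univ i) ?_
      rw [Tab.letters, letterOf_entry, hT _ i.2, if_neg]
      simpa [headBits] using hi
  have htail : (∏ l : Fin q, (T.letters ⟨n - q + l, by omega⟩).entry (v ⟨n - q + l, by omega⟩)
      (w ⟨n - q + l, by omega⟩)) =
        if T.tailX h = Nat.ofBits (tailBits h v) ^^^ Nat.ofBits (tailBits h w) then
          iph q (T.tailX h) (T.tailZ h) * iph q (T.tailZ h) (Nat.ofBits (tailBits h w)) ^ 2
        else 0 := by
    have hiff : T.tailX h = Nat.ofBits (tailBits h v) ^^^ Nat.ofBits (tailBits h w) ↔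
        ∀ l : Fin q, v ⟨n - q + l, by omega⟩ = (w ⟨n - q + l, by omega⟩ ^^
          T.x ⟨n - q + l, by omega⟩) := by
      rw [← ofBits_xor, Tab.tailX, ofBits_inj, funext_iff]
      refine forall_congr' fun l => ?_
      simp only [tailBits]
      cases v ⟨n - q + l, by omega⟩ <;> cases w ⟨n - q + l, by omega⟩ <;>
        cases T.x ⟨n - q + l, by omega⟩ <;> decide
    split_ifs with hvw
    · rw [Tab.tailX, Tab.tailZ, iph_sq_ofBits, iph_ofBits, ← Finset.prod_mul_distrib]
      refine Finset.prod_congr rfl fun l _ => ?_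
      rw [Tab.letters, letterOf_entry, if_pos (hiff.1 hvw l)]
      simp [tailBits]
    · rw [hiff] at hvw
      push Not at hvw
      obtain ⟨l, hl⟩ := hvw
      refine Finset.prod_eq_zero (Finset.mem_univ l) ?_
      rw [Tab.letters, letterOf_entry, if_neg hl]
  rw [hhead, htail]
  have hs : (T.headSign (headBits q w) : ℂ) = sgn T.r *
      ∏ i : Fin (n - q), sgn (T.z ⟨i, by omega⟩ && headBits q w i) := by
    simp only [Tab.headSign, sgn_eq, Complex.ofReal_mul, Complex.ofReal_prod]
  rw [hs]
  by_cases hvw : headBits q v = headBits q w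
  · simp only [if_pos hvw, mul_assoc]
  · simp only [if_neg hvw, zero_mul, mul_zero]

/-- The coefficient of the Pauli operator with X-part `a` and Z-part `b` in block `x`. -/
noncomputable def famCoef (h : q ≤ n) (F : Fin k → Tab n) (c : Fin k → ℝ) (x : Bits (n - q))
    (a b : ℕ) : ℝ :=
  ∑ j, if (F j).tailX h = a ∧ (F j).tailZ h = b then c j * (F j).headSign x else 0

/-- The coefficient of the Pauli operator with X-part `a` and Z-part `b` in block `x`. -/
noncomputable def Hamiltonian.coef (D : Hamiltonian n m k) (h : q ≤ n) (L : List (Gate n))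
    (x : Bits (n - q)) (a b : ℕ) : ℝ :=
  famCoef h (fun j => actL L (D.Q j).tab) (fun j => -D.α j) x a b +
    famCoef h (fun j => actL L (D.P j).tab) D.γ x a b

/-- A block of the conjugated Hamiltonian. -/
noncomputable def Hamiltonian.block (D : Hamiltonian n m k) (L : List (Gate n)) (q : ℕ)
    (x : Bits (n - q)) : Matrix (Bits q) (Bits q) ℂ := Matrix.of fun v w =>
  (circuitMat L * D.mat * (circuitMat L)ᴴ) (joinBits q x v) (joinBits q x w)

theorem Hamiltonian.conj_apply (D : Hamiltonian n m k) (L : List (Gate n)) (v w : Bits n) :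
    (circuitMat L * D.mat * (circuitMat L)ᴴ) v w =
      ∑ j, ((-D.α j : ℝ) : ℂ) * (actL L (D.Q j).tab).mat v w +
      ∑ j, (D.γ j : ℂ) * (actL L (D.P j).tab).mat v w := by
  have : circuitMat L * D.mat * (circuitMat L)ᴴ =
      ∑ j, ((-D.α j : ℝ) : ℂ) • (actL L (D.Q j).tab).mat +
      ∑ j, (D.γ j : ℂ) • (actL L (D.P j).tab).mat := by
    simp only [Hamiltonian.mat, Matrix.mul_add, Matrix.add_mul, Matrix.mul_neg, Matrix.neg_mul,
      Matrix.mul_sum, Matrix.sum_mul, Matrix.mul_smul, Matrix.smul_mul, ← circuitMat_conj_tab,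
      PauliString.mat_tab, Complex.ofReal_neg, neg_smul, Finset.sum_neg_distrib]
  rw [this]
  simp [Matrix.sum_apply]

variable {D : Hamiltonian n m k} {L : List (Gate n)}

theorem GoodCircuit.Qx (hL : GoodCircuit D q L) (j : Fin m) (i : Fin n) (_ : (i : ℕ) < n - q) :
    (actL L (D.Q j).tab).x i = false := hL.Q j i

theorem GoodCircuit.eq_blockMat (hL : GoodCircuit D q L) (h : q ≤ n) :
    circuitMat L * D.mat * (circuitMat L)ᴴ = blockMat h (D.block L q) := by
  ext v w
  rw [blockMat, Matrix.of_apply]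
  split_ifs with hvw
  · rw [Hamiltonian.block, Matrix.of_apply, joinBits_head_tail, hvw, joinBits_head_tail]
  · rw [Hamiltonian.conj_apply]
    simp only [Tab.mat_apply_of_head _ h (hL.Qx _), Tab.mat_apply_of_head _ h (hL.P _),
      if_neg hvw]
    simp

/-- The entry at `(y, w)` involves only operators with X-part `y ⊕ w`, so it is a sum over the `2 ^
q` possible Z-parts. After the coefficients have been collected once, all `4 ^ q` entries together
cost `O(8 ^ q)`. -/
theorem famCoef_sum (h : q ≤ n) (F : Fin k → Tab n) (c : Fin k → ℝ)
    (hF : ∀ j, ∀ i : Fin n, (i : ℕ) < n - q → (F j).x i = false) (x : Bits (n - q))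
    (y w : Bits q) : ∑ j, (c j : ℂ) * (F j).mat (joinBits q x y) (joinBits q x w) =
      ∑ z ∈ Finset.range (2 ^ q), (famCoef h F c x (Nat.ofBits y ^^^ Nat.ofBits w) z : ℂ) *
        iph q (Nat.ofBits y ^^^ Nat.ofBits w) z * iph q z (Nat.ofBits w) ^ 2 := by
  simp only [famCoef, Complex.ofReal_sum, Finset.sum_mul]
  rw [Finset.sum_comm]
  refine Finset.sum_congr rfl fun j _ => ?_
  rw [Finset.sum_eq_single ((F j).tailZ h)]
  · rw [Tab.mat_apply_of_head _ h (hF j)]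
    simp only [headBits_joinBits, tailBits_joinBits, if_true, and_true]
    split_ifs with h'
    · rw [h']; push_cast; ring
    · simp
  · intro z _ hz
    rw [if_neg fun h' => hz h'.2.symm]
    simp
  · intro h'
    exact absurd (Finset.mem_range.2 (Nat.ofBits_lt_two_pow _)) h'

theorem GoodCircuit.block_apply (hL : GoodCircuit D q L) (h : q ≤ n) (x : Bits (n - q))
    (y w : Bits q) : D.block L q x y w =
      ∑ z ∈ Finset.range (2 ^ q), (D.coef h L x (Nat.ofBits y ^^^ Nat.ofBits w) z : ℂ) *
        iph q (Nat.ofBits y ^^^ Nat.ofBits w) z * iph q z (Nat.ofBits w) ^ 2 := by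
  rw [Hamiltonian.block, Matrix.of_apply, Hamiltonian.conj_apply,
    famCoef_sum h (fun j => actL L (D.Q j).tab) _ hL.Qx,
    famCoef_sum h (fun j => actL L (D.P j).tab) _ hL.P, ← Finset.sum_add_distrib]
  refine Finset.sum_congr rfl fun z _ => ?_
  rw [Hamiltonian.coef]
  push_cast
  ring

/-- The block as a matrix indexed by numbers. -/
noncomputable def Hamiltonian.numBlock (D : Hamiltonian n m k) (L : List (Gate n)) (q : ℕ)
    (x : Bits (n - q)) : Matrix (Fin (2 ^ q)) (Fin (2 ^ q)) ℂ :=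
  (D.block L q x).submatrix (bitsEquiv q).symm (bitsEquiv q).symm

theorem GoodCircuit.numBlock_apply (hL : GoodCircuit D q L) (h : q ≤ n) (x : Bits (n - q))
    (v w : Fin (2 ^ q)) : D.numBlock L q x v w =
      ∑ z ∈ Finset.range (2 ^ q), (D.coef h L x (v ^^^ w : ℕ) z : ℂ) *
        iph q (v ^^^ w : ℕ) z * iph q z w ^ 2 := by
  have e : ∀ v : Fin (2 ^ q), Nat.ofBits ((bitsEquiv q).symm v) = v := fun v =>
    ofBits_decBits v.2
  rw [Hamiltonian.numBlock, Matrix.submatrix_apply, hL.block_apply h, e, e]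

theorem PauliString.mat_isHermitian (P : PauliString n) : P.mat.IsHermitian := by
  ext v w
  rw [Matrix.conjTranspose_apply, PauliString.mat, Matrix.of_apply, Matrix.of_apply, star_prod]
  refine Finset.prod_congr rfl fun i _ => ?_
  cases P i <;> cases v i <;> cases w i <;> simp [Letter.entry]

theorem Hamiltonian.isHermitian (D : Hamiltonian n m k) : D.mat.IsHermitian := by
  rw [Matrix.IsHermitian, Hamiltonian.mat]
  simp only [Matrix.conjTranspose_add, Matrix.conjTranspose_neg, Matrix.conjTranspose_sum,
    Matrix.conjTranspose_smul, (PauliString.mat_isHermitian _).eq]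
  simp

theorem Hamiltonian.numBlock_isHermitian (D : Hamiltonian n m k) (L : List (Gate n))
    (x : Bits (n - q)) : (D.numBlock L q x).IsHermitian := by
  refine Matrix.IsHermitian.submatrix ?_ _
  have := Matrix.isHermitian_mul_mul_conjTranspose (circuitMat L) D.isHermitian
  ext v w
  rw [Matrix.conjTranspose_apply, Hamiltonian.block, Matrix.of_apply, Matrix.of_apply]
  exact this.apply _ _

end DopedStab

namespace DopedStab

/-! ### Tables -/

theorem iph_eq_of_testBit {q a a' b b' : ℕ}
    (h : ∀ l < q, (a.testBit l && b.testBit l) = (a'.testBit l && b'.testBit l)) :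
    iph q a b = iph q a' b' :=
  Finset.prod_congr rfl fun l hl => by rw [h l (Finset.mem_range.1 hl)]

theorem testBit_add_two_pow {a l : ℕ} (ha : a < 2 ^ l) (t : ℕ) :
    (a + 2 ^ l).testBit t = (a.testBit t || decide (t = l)) := by
  have h := Nat.two_pow_add_eq_or_of_lt ha 1
  rw [Nat.mul_one] at h
  rw [Nat.add_comm, h, Nat.testBit_or, Nat.testBit_two_pow, Bool.or_comm]
  simp only [eq_comm (a := l)]

theorem iph_add_left {q l a b : ℕ} (ha : a < 2 ^ l) (hb : b < 2 ^ l) :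
    iph q (a + 2 ^ l) b = iph q a b := by
  refine iph_eq_of_testBit fun t _ => ?_
  rw [testBit_add_two_pow ha]
  by_cases h : t = l
  · subst h; simp [Nat.testBit_lt_two_pow hb]
  · simp [h]

theorem iph_comm (q a b : ℕ) : iph q a b = iph q b a :=
  Finset.prod_congr rfl fun l _ => by rw [Bool.and_comm]

theorem iph_add_right {q l a b : ℕ} (ha : a < 2 ^ l) (hb : b < 2 ^ l) :
    iph q a (b + 2 ^ l) = iph q a b := by
  rw [iph_comm, iph_add_left hb ha, iph_comm]

theorem iph_add_add {q l a b : ℕ} (hl : l < q) (ha : a < 2 ^ l) (hb : b < 2 ^ l) :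
    iph q (a + 2 ^ l) (b + 2 ^ l) = Complex.I * iph q a b := by
  rw [iph, iph, ← Finset.mul_prod_erase _ _ (Finset.mem_range.2 hl),
    ← Finset.mul_prod_erase (Finset.range q) (fun t => if a.testBit t && b.testBit t then
      Complex.I else 1) (Finset.mem_range.2 hl), testBit_add_two_pow ha, testBit_add_two_pow hb,
      Nat.testBit_lt_two_pow ha]
  simp only [decide_true, Bool.or_true, Bool.and_self, if_true, Bool.false_and, Bool.false_eq_true,
    if_false, one_mul]
  congr 1
  refine Finset.prod_congr rfl fun t ht => ?_
  rw [testBit_add_two_pow ha, testBit_add_two_pow hb]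
  simp [Finset.ne_of_mem_erase ht]

theorem xor_add_left {l a b : ℕ} (ha : a < 2 ^ l) (hb : b < 2 ^ l) :
    (a + 2 ^ l) ^^^ b = (a ^^^ b) + 2 ^ l := by
  apply Nat.eq_of_testBit_eq
  intro t
  rw [testBit_add_two_pow (Nat.xor_lt_two_pow ha hb), Nat.testBit_xor, Nat.testBit_xor,
    testBit_add_two_pow ha]
  by_cases h : t = l
  · subst h; simp [Nat.testBit_lt_two_pow hb, Nat.testBit_lt_two_pow ha]
  · simp [h]

theorem xor_add_add {l a b : ℕ} (ha : a < 2 ^ l) (hb : b < 2 ^ l) :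
    (a + 2 ^ l) ^^^ (b + 2 ^ l) = a ^^^ b := by
  apply Nat.eq_of_testBit_eq
  intro t
  rw [Nat.testBit_xor, Nat.testBit_xor, testBit_add_two_pow ha, testBit_add_two_pow hb]
  by_cases h : t = l
  · subst h; simp [Nat.testBit_lt_two_pow hb, Nat.testBit_lt_two_pow ha]
  · simp [h]

/-- Entry `(a, b)` of the tables of exclusive or and of phases is correct. -/
structure TabEntry (q : ℕ) (s : Memory) (a b : ℕ) : Prop where
  xor : s.nat 35 a b = a ^^^ b
  re : s.real 11 a b = (iph q a b).re
  im : s.real 12 a b = (iph q a b).im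

theorem TabEntry.congr {q a b : ℕ} {s s' : Memory} (h : TabEntry q s a b)
    (h₁ : s'.nat 35 a b = s.nat 35 a b) (h₂ : s'.real 11 a b = s.real 11 a b)
    (h₃ : s'.real 12 a b = s.real 12 a b) : TabEntry q s' a b :=
  ⟨h₁.trans h.xor, h₂.trans h.re, h₃.trans h.im⟩

theorem TabEntry.same {q a b : ℕ} {s s' : Memory} (h : TabEntry q s a b) {N R : List ℕ}
    (hS : Same N R s s') (hN : 35 ∉ N) (hR : [11, 12].all (· ∉ R) = true) :
    TabEntry q s' a b := by
  simp at hR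
  exact h.congr (by rw [hS.nat _ hN]) (by rw [hS.real _ hR.1]) (by rw [hS.real _ hR.2])

/-- Extend the tables from entry `(nv 28, nv 29)` by the bit of value `nv 15`. -/
def extendEntry : Program :=
  let a := nv 28
  let b := nv 29
  let D := nv 15
  .setNat 35 (a + D) b (.get 35 a b + D) ;; .setNat 35 a (b + D) (.get 35 a b + D) ;;
  .setNat 35 (a + D) (b + D) (.get 35 a b) ;;
  .setReal 11 (a + D) b (.get 11 a b) ;; .setReal 11 a (b + D) (.get 11 a b) ;;
  .setReal 11 (a + D) (b + D) (0 - .get 12 a b) ;;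
  .setReal 12 (a + D) b (.get 12 a b) ;; .setReal 12 a (b + D) (.get 12 a b) ;;
  .setReal 12 (a + D) (b + D) (.get 11 a b)

/-- The machine has no bitwise operations, so exclusive or and phases are tabulated by doubling. The
new bit enters the exclusive or when it is added to exactly one argument; added to both, it
multiplies the phase by `i`, which sends `(re, im)` to `(-im, re)`. -/
theorem runs_extendEntry {q l a b : ℕ} {s : Memory} (hl : l < q) (hD : s.nat 15 0 0 = 2 ^ l)
    (ha : s.nat 28 0 0 = a) (hb : s.nat 29 0 0 = b) (ha' : a < 2 ^ l) (hb' : b < 2 ^ l)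
    (h : TabEntry q s a b) :
    Runs extendEntry s 9 fun s' => Same [35] [11, 12] s s' ∧
      (∀ u v, ¬ ((u = a + 2 ^ l ∧ v = b) ∨ (u = a ∧ v = b + 2 ^ l) ∨
        (u = a + 2 ^ l ∧ v = b + 2 ^ l)) → TabEntry q s u v → TabEntry q s' u v) ∧
      TabEntry q s' (a + 2 ^ l) b ∧ TabEntry q s' a (b + 2 ^ l) ∧
      TabEntry q s' (a + 2 ^ l) (b + 2 ^ l) := by
  have hp : 0 < 2 ^ l := by positivity
  have hne : ∀ c : ℕ, c ≠ c + 2 ^ l := fun c => by omega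
  generalize hDD : 2 ^ l = D at *
  refine (Runs.seq (T₁ := 1) <| Runs.setNat <| Runs.seq (T₁ := 1) <| Runs.setNat <|
    Runs.seq (T₁ := 1) <| Runs.setNat <| Runs.seq (T₁ := 1) <| Runs.setReal <|
    Runs.seq (T₁ := 1) <| Runs.setReal <| Runs.seq (T₁ := 1) <| Runs.setReal <|
    Runs.seq (T₁ := 1) <| Runs.setReal <| Runs.seq (T₁ := 1) <| Runs.setReal <|
    Runs.setReal ?_).mono le_rfl fun _ h => h
  have hx := h.xor
  have hr := h.re
  have hi := h.im
  simp only [NExp.eval_get, NExp.eval_add, NExp.eval_ofNat, RExp.eval_get, RExp.eval_sub,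
    RExp.eval_ofNat, Memory.setNat_nat, Memory.setReal_nat, Memory.setNat_real, Memory.setReal_real,
    ha, hb, hD, hx, hr, hi, hne, and_false, false_and, if_false,
    show (28 : ℕ) ≠ 35 by decide, show (29 : ℕ) ≠ 35 by decide, show (15 : ℕ) ≠ 35 by decide,
    show (11 : ℕ) ≠ 12 by decide, show (12 : ℕ) ≠ 11 by decide]
  refine ⟨?_, ?_, ?_, ?_, ?_⟩
  · exact ((((((((((Same.refl _ _ _).setNat (by simp) _ _ _).setNat (by simp) _ _ _).setNat
      (by simp) _ _ _).setReal (by simp) _ _ _).setReal (by simp) _ _ _).setReal (by simp) _ _ _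
      ).setReal (by simp) _ _ _).setReal (by simp) _ _ _).setReal (by simp) _ _ _)
  · intro u v huv h'
    push Not at huv
    have c1 : ¬ (u = a + D ∧ v = b) := fun h => huv.1 h.1 h.2
    have c2 : ¬ (u = a ∧ v = b + D) := fun h => huv.2.1 h.1 h.2
    have c3 : ¬ (u = a + D ∧ v = b + D) := fun h => huv.2.2 h.1 h.2
    refine h'.congr ?_ ?_ ?_ <;>
      simp [Memory.setNat_nat, Memory.setReal_real, c1, c2, c3]
  · subst hDD
    refine ⟨?_, ?_, ?_⟩
    · simp [Memory.setNat_nat, xor_add_left ha' hb']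
    · simp [Memory.setReal_real, iph_add_left ha' hb']
    · simp [Memory.setReal_real, iph_add_left ha' hb']
  · subst hDD
    refine ⟨?_, ?_, ?_⟩
    · rw [Nat.xor_comm a (b + 2 ^ l), xor_add_left hb' ha', Nat.xor_comm]
      simp [Memory.setNat_nat]
    · simp [Memory.setReal_real, iph_add_right ha' hb']
    · simp [Memory.setReal_real, iph_add_right ha' hb']
  · subst hDD
    refine ⟨?_, ?_, ?_⟩
    · simp [xor_add_add ha' hb']
    · simp [iph_add_add hl ha' hb']
    · simp [iph_add_add hl ha' hb']

/-- Double the size of the tables. -/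
def extendTables : Program :=
  .forUp 28 (nv 15) (.forUp 29 (nv 15) extendEntry)

/-- The position is among the first `D` rows and columns, or has been reached by the extension of
the tables, all rows before `i` and the first `j` entries of row `i` being processed. -/
def Reached (D i j u v : ℕ) : Prop :=
  (u < D ∧ v < D) ∨ ∃ u' v', (u' < i ∨ u' = i ∧ v' < j) ∧ u' < D ∧ v' < D ∧
    ((u = u' + D ∧ v = v') ∨ (u = u' ∧ v = v' + D) ∨ (u = u' + D ∧ v = v' + D))

theorem Reached.of_full {D u v : ℕ} (hu : u < D + D) (hv : v < D + D) : Reached D D 0 u v := by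
  by_cases h1 : u < D <;> by_cases h2 : v < D
  · exact Or.inl ⟨h1, h2⟩
  · exact Or.inr ⟨u, v - D, Or.inl h1, h1, by omega, by omega⟩
  · exact Or.inr ⟨u - D, v, Or.inl (by omega), by omega, h2, by omega⟩
  · exact Or.inr ⟨u - D, v - D, Or.inl (by omega), by omega, by omega, by omega⟩

theorem Reached.row {D i u v : ℕ} (h : Reached D (i + 1) 0 u v) : Reached D i D u v := by
  rcases h with h | ⟨u', v', h1, h2, h3, h4⟩
  · exact Or.inl h
  · exact Or.inr ⟨u', v', by omega, h2, h3, h4⟩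

theorem Reached.step {D i j u v : ℕ} (h : Reached D i (j + 1) u v) :
    Reached D i j u v ∨ (u = i + D ∧ v = j) ∨ (u = i ∧ v = j + D) ∨ (u = i + D ∧ v = j + D) := by
  rcases h with h | ⟨u', v', h1, h2, h3, h4⟩
  · exact Or.inl (Or.inl h)
  · by_cases h' : u' = i ∧ v' = j
    · right
      omega
    · exact Or.inl (Or.inr ⟨u', v', by omega, h2, h3, h4⟩)

theorem runs_extendTables {q l : ℕ} {s : Memory} (hl : l < q) (hD : s.nat 15 0 0 = 2 ^ l)
    (h : ∀ u v, u < 2 ^ l → v < 2 ^ l → TabEntry q s u v) :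
    Runs extendTables s (15 * 4 ^ l + 2) fun s' => Same [28, 29, 35] [11, 12] s s' ∧
      ∀ u v, u < 2 ^ (l + 1) → v < 2 ^ (l + 1) → TabEntry q s' u v := by
  have hp : 1 ≤ 2 ^ l := Nat.one_le_two_pow
  have h4 : (4 : ℕ) ^ l = 2 ^ l * 2 ^ l := by rw [← mul_pow]; norm_num
  refine (Runs.forUp (T := 2 ^ l * 11 + 2) (M := 2 ^ l) (fun i s' =>
    Same [28, 29, 35] [11, 12] s s' ∧ ∀ u v, Reached (2 ^ l) i 0 u v → TabEntry q s' u v)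
    ⟨(Same.refl _ _ _).setNat (by simp) _ _ _, ?_⟩ (fun i s' _ h => by simp [h.1.nat, hD]) ?_
    ?_).mono (by rw [h4]; nlinarith) fun _ h => h
  · rintro u v (⟨hu, hv⟩ | ⟨u', v', h', -⟩)
    · exact (h u v hu hv).congr (by simp) rfl rfl
    · omega
  · rintro i s' hi ⟨hS, hE⟩ hv
    refine Runs.forUp (T := 9) (M := 2 ^ l) (fun j s'' =>
      Same [29, 35] [11, 12] s' s'' ∧ ∀ u v, Reached (2 ^ l) i j u v → TabEntry q s'' u v)
      ⟨(Same.refl _ _ _).setNat (by simp) _ _ _, fun u v h' => (hE u v h').congr (by simp) rfl rfl⟩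
      (fun j s'' _ h => by simp [h.1.nat, hS.nat, hD]) ?_ ?_
    · rintro j s'' hj ⟨hS', hE'⟩ hv'
      refine (runs_extendEntry hl (by simp [hS'.nat, hS.nat, hD]) (by simp [hS'.nat, hv]) hv' hi hj
        (hE' i j (Or.inl ⟨hi, hj⟩))).mono le_rfl ?_
      rintro s₃ ⟨hS₃, k0, k1, k2, k3⟩
      refine ⟨by simp [hS₃.nat, hv'], ((hS'.trans (hS₃.mono (by decide) (by decide))).setNat
        (by simp) _ _ _), fun u v h' => ?_⟩
      refine TabEntry.congr (s := s₃) ?_ (by simp) rfl rfl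
      by_cases hc : (u = i + 2 ^ l ∧ v = j) ∨ (u = i ∧ v = j + 2 ^ l) ∨
        (u = i + 2 ^ l ∧ v = j + 2 ^ l)
      · rcases hc with ⟨rfl, rfl⟩ | ⟨rfl, rfl⟩ | ⟨rfl, rfl⟩
        · exact k1
        · exact k2
        · exact k3
      · refine k0 u v hc (hE' u v ?_)
        rcases h'.step with h' | h'
        · exact h'
        · exact absurd h' hc
    · rintro s'' ⟨hS', hE'⟩ -
      refine ⟨by simp [hS'.nat, hv], (hS.trans (hS'.mono (by decide) (by decide))).setNat
        (by simp) _ _ _, fun u v h' => ?_⟩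
      exact (hE' u v h'.row).congr (by simp) rfl rfl
  · rintro s' ⟨hS, hE⟩ -
    refine ⟨hS, fun u v hu hv => hE u v (Reached.of_full ?_ ?_)⟩
    · rw [pow_succ] at hu; omega
    · rw [pow_succ] at hv; omega

/-- Set up the tables of powers of two, signs, exclusive or, and phases. -/
def tablesProg : Program :=
  -- Row `1` of the sign table contains the opposite signs, for the terms of `H₀`, whose
  -- coefficients enter with a minus.
  .setReal 20 0 0 1 ;; .setReal 20 0 1 (0 - 1) ;; .setReal 20 1 0 (0 - 1) ;; .setReal 20 1 1 1 ;;
  .setNat 35 0 0 0 ;; .setReal 11 0 0 1 ;; .setReal 12 0 0 0 ;; .setNat 15 0 0 1 ;;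
  .forUp 27 (nv 8) (.setNat 34 0 (nv 27) 0 ;; .setNat 34 1 (nv 27) (nv 15) ;; extendTables ;;
    .setNat 15 0 0 (nv 15 + nv 15))

/-- The tables set up by `tablesProg`. -/
structure Tables (q : ℕ) (s : Memory) : Prop where
  dim : s.nat 15 0 0 = 2 ^ q
  sign : ∀ b : Bool, s.real 20 0 b.toNat = rsgn b
  nsign : ∀ b : Bool, s.real 20 1 b.toNat = -rsgn b
  pow : ∀ (b : Bool) l, l < q → s.nat 34 b.toNat l = b.toNat * 2 ^ l
  entry : ∀ u v, u < 2 ^ q → v < 2 ^ q → TabEntry q s u v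

theorem Tables.same {q : ℕ} {s s' : Memory} (h : Tables q s) {N R : List ℕ}
    (hS : Same N R s s') (hN : [15, 34, 35].all (· ∉ N) = true)
    (hR : [11, 12, 20].all (· ∉ R) = true) : Tables q s' := by
  simp at hN hR
  refine ⟨?_, ?_, ?_, ?_, fun u v hu hv => (h.entry u v hu hv).same hS hN.2.2 (by simp [hR])⟩
  · rw [hS.nat _ hN.1]; exact h.dim
  · rw [hS.real _ hR.2.2]; exact h.sign
  · rw [hS.real _ hR.2.2]; exact h.nsign
  · rw [hS.nat _ hN.2.1]; exact h.pow

/-- The integer arrays changed by `tablesProg`. -/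
abbrev tablesNat : List ℕ := [15, 27, 28, 29, 34, 35]

theorem runs_tablesProg {q : ℕ} {s : Memory} (hq : s.nat 8 0 0 = q) :
    Runs tablesProg s (40 * 8 ^ q) fun s' => Same tablesNat [11, 12, 20] s s' ∧ Tables q s' := by
  have hp : (4 : ℕ) ^ q = 2 ^ q * 2 ^ q := by rw [← mul_pow]; norm_num
  have hp8 : (8 : ℕ) ^ q = 4 ^ q * 2 ^ q := by rw [← mul_pow]; norm_num
  have h1 : 1 ≤ 2 ^ q := Nat.one_le_two_pow
  have h14 : 1 ≤ 4 ^ q := Nat.one_le_pow _ _ (by norm_num)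
  -- There are `q` doublings of cost `O(4 ^ q)`; the factor `q` is absorbed in `8 ^ q`.
  have hq2 : q < 2 ^ q := Nat.lt_two_pow_self
  refine (Runs.seq (T₁ := 1) <| Runs.setReal <| Runs.seq (T₁ := 1) <| Runs.setReal <|
    Runs.seq (T₁ := 1) <| Runs.setReal <| Runs.seq (T₁ := 1) <| Runs.setReal <|
    Runs.seq (T₁ := 1) <| Runs.setNat <| Runs.seq (T₁ := 1) <| Runs.setReal <|
    Runs.seq (T₁ := 1) <| Runs.setReal <| Runs.seq (T₁ := 1) (T₂ := q * (15 * 4 ^ q + 5 + 2) + 2)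
    <| Runs.setNat ?_).mono (by rw [hp8]; nlinarith) fun _ h => h
  simp only [NExp.eval_ofNat, RExp.eval_ofNat, RExp.eval_sub]
  generalize hs₁ : (((((((s.setReal 20 0 0 _).setReal 20 0 1 _).setReal 20 1 0 _).setReal 20 1 1 _
    ).setNat 35 0 0 0).setReal 11 0 0 _).setReal 12 0 0 _).setNat 15 0 0 1 = s₁
  have S₁ : Same tablesNat [11, 12, 20] s s₁ := by
    rw [← hs₁]
    exact (((((((((Same.refl _ _ _).setReal (by simp) _ _ _).setReal (by simp) _ _ _).setReal
      (by simp) _ _ _).setReal (by simp) _ _ _).setNat (by simp) _ _ _).setReal (by simp) _ _ _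
      ).setReal (by simp) _ _ _).setNat (by simp) _ _ _)
  have h20 : ∀ b : Bool, s₁.real 20 0 b.toNat = rsgn b ∧ s₁.real 20 1 b.toNat = -rsgn b := by
    intro b
    rw [← hs₁]
    cases b <;> simp [Memory.setReal_real, rsgn]
  have h15 : s₁.nat 15 0 0 = 1 := by simp [← hs₁]
  have hE : TabEntry q s₁ 0 0 := by
    have : iph q 0 0 = 1 := by simp [iph]
    refine ⟨?_, ?_, ?_⟩
    · simp [← hs₁]
    · simp [← hs₁, this]
    · simp [← hs₁, this]
  refine Runs.forUp (M := q) (fun i s' => Same tablesNat [11, 12] s₁ s' ∧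
    s'.nat 15 0 0 = 2 ^ i ∧ (∀ (b : Bool) l, l < i → s'.nat 34 b.toNat l = b.toNat * 2 ^ l) ∧
    ∀ u v, u < 2 ^ i → v < 2 ^ i → TabEntry q s' u v)
    ⟨(Same.refl _ _ _).setNat (by simp) _ _ _, by simp [h15], by simp, ?_⟩
    (fun i s' _ h => by simp [h.1.nat, S₁.nat, hq]) ?_ ?_
  · intro u v hu hv
    obtain rfl : u = 0 := by omega
    obtain rfl : v = 0 := by omega
    exact hE.congr (by simp) rfl rfl
  · rintro i s' hi ⟨hS, hd, hpw, hE⟩ hv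
    have h4 : 4 ^ i ≤ 4 ^ q := Nat.pow_le_pow_right (by norm_num) hi.le
    refine (Runs.seq (T₁ := 1) (T₂ := 1 + ((15 * 4 ^ i + 2) + 1)) <| Runs.setNat <|
      Runs.seq <| Runs.setNat ?_).mono (by omega) fun _ h => h
    simp only [NExp.eval_ofNat, NExp.eval_get, hv, Memory.setNat_nat_ne _ _ _ _ _ 27
      (show 27 ≠ 34 by decide), Memory.setNat_nat_ne _ _ _ _ _ 15 (show 15 ≠ 34 by decide), hd]
    generalize hs₂ : (s'.setNat 34 0 i 0).setNat 34 1 i (2 ^ i) = s₂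
    have S₂ : Same [34] [] s' s₂ := by
      rw [← hs₂]
      exact ((Same.refl _ _ _).setNat (by simp) _ _ _).setNat (by simp) _ _ _
    have h34 : ∀ (b : Bool) l, l < i + 1 → s₂.nat 34 b.toNat l = b.toNat * 2 ^ l := by
      intro b l hl
      rcases Nat.lt_succ_iff_lt_or_eq.1 hl with hl | rfl
      · rw [← hpw b l hl, ← hs₂]
        simp [Memory.setNat_nat, hl.ne]
      · rw [← hs₂]
        cases b <;> simp [Memory.setNat_nat]
    refine Runs.seq' (runs_extendTables hi (by simp [S₂.nat, hd])
      fun u v hu hv => (hE u v hu hv).same S₂ (by decide) (by decide)) ?_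
    rintro s₃ ⟨S₃, hE₃⟩
    refine Runs.setNat ⟨by simp [S₃.nat, S₂.nat, hv], ?_, ?_, ?_, ?_⟩
    · exact ((((hS.trans (S₂.mono (by decide) (by decide))).trans (S₃.mono (by decide)
        (by decide))).setNat (by simp) _ _ _).setNat (by simp) _ _ _)
    · simp [S₃.nat, S₂.nat, hd, pow_succ]; omega
    · intro b l hl
      simp [S₃.nat, h34 b l hl]
    · intro u v hu hv
      exact (hE₃ u v hu hv).congr (by simp) rfl rfl
  · rintro s' ⟨hS, hd, hpw, hE⟩ -
    exact ⟨S₁.trans (hS.mono (by decide) (by decide)), hd, fun b => by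
      rw [hS.real 20 (by decide)]; exact (h20 b).1, fun b => by
      rw [hS.real 20 (by decide)]; exact (h20 b).2, hpw, hE⟩

end DopedStab

namespace DopedStab

/-! ### The coefficients and the matrix of a block -/

variable {n m k q : ℕ}

@[simp] theorem NExp.eval_band_eq (s : Memory) (e f : NExp) :
    (e.band f).eval s = e.eval s - (e.eval s - f.eval s) := rfl

theorem band_toNat (a b : Bool) : a.toNat - (a.toNat - b.toNat) = (a && b).toNat := by
  cases a <;> cases b <;> rfl

/-- Add the contributions of the operators in array `A` with coefficients in array `R` and with
signs from row `σ` of the table. -/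
def termsProg (A R : ℕ) (σ cnt : NExp) : Program :=
  .forUp 20 cnt (loadProg A ;; conjProg ;; .setReal 26 0 0 (.get 20 σ (nv 12)) ;;
    .forUp 27 (nv 6 - nv 8) (.setReal 26 0 0
      (rv 26 * .get 20 0 (.band (.get 11 0 (nv 27)) (.get 5 0 (nv 27))))) ;;
    .sumN 27 (nv 8) 36 (.get 34 (.get 10 0 (nv 6 - nv 8 + nv 27)) (nv 27)) ;;
    .sumN 27 (nv 8) 37 (.get 34 (.get 11 0 (nv 6 - nv 8 + nv 27)) (nv 27)) ;;
    .setReal 10 (nv 36) (nv 37) (.get 10 (nv 36) (nv 37) + .get R 0 (nv 20) * rv 26))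

/-- The integer arrays changed by `termsProg`. -/
abbrev termsNat : List ℕ := [10, 11, 12, 13, 16, 17, 18, 20, 21, 22, 27, 36, 37]

/-- The data needed to compute the block `x` of the Hamiltonian. -/
structure BlockCtx (s : Memory) (L : List (Gate n)) (q : ℕ) (x : Bits (n - q)) : Prop where
  num : s.nat 6 0 0 = n
  loc : s.nat 8 0 0 = q
  circ : CircAt s L
  bits : ∀ i : Fin (n - q), s.nat 5 0 i = (x i).toNat
  tables : Tables q s

theorem BlockCtx.same {s s' : Memory} {L : List (Gate n)} {x : Bits (n - q)}
    (h : BlockCtx s L q x) {N R : List ℕ} (hS : Same N R s s')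
    (hN : [4, 5, 6, 7, 8, 15, 34, 35].all (· ∉ N) = true)
    (hR : [11, 12, 20].all (· ∉ R) = true) : BlockCtx s' L q x := by
  simp at hN
  refine ⟨?_, ?_, h.circ.same hS (by simp [hN]), ?_, h.tables.same hS (by simp [hN]) hR⟩
  · rw [hS.nat _ hN.2.2.1]; exact h.num
  · rw [hS.nat _ hN.2.2.2.2.1]; exact h.loc
  · rw [hS.nat _ hN.2.1]; exact h.bits

/-- Integer multiplication is not available either: the product of a bit and a power of two is
looked up in array `34`, the bit being the row. -/
theorem runs_tailSum {s : Memory} {L : List (Gate n)} {x : Bits (n - q)} (h : BlockCtx s L q x)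
    (hqn : q ≤ n) {arr acc : ℕ} {y : Bits n} (hacc : acc = 36 ∨ acc = 37)
    (harr : arr ∉ [27, 36, 37]) (hy : ∀ i : Fin n, s.nat arr 0 i = (y i).toNat) :
    Runs (.sumN 27 (nv 8) acc (.get 34 (.get arr 0 (nv 6 - nv 8 + nv 27)) (nv 27))) s (3 * q + 3)
      fun s' => Same [27, acc] [] s s' ∧ s'.nat acc 0 0 = Nat.ofBits (tailBits hqn y) := by
  have n1 : ∀ a, a ∉ [27, 36, 37] → a ∉ [27, acc] := by
    intro a ha
    simp at ha ⊢
    omega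
  refine (Runs.sumN q (fun l => if hl : l < q then (tailBits hqn y ⟨l, hl⟩).toNat * 2 ^ l else 0)
    (by omega) (fun s' hS => ?_) (fun l s' hl hS hv => ?_)).mono le_rfl ?_
  · simp [hS.nat 8 (n1 8 (by decide)), h.loc]
  · have hrow : s'.nat arr 0 (n - q + l) = (tailBits hqn y ⟨l, hl⟩).toNat := by
      rw [hS.nat arr (n1 arr harr)]
      exact hy ⟨n - q + l, by omega⟩
    simp only [NExp.eval_get, NExp.eval_add, NExp.eval_sub, NExp.eval_ofNat,
      hS.nat 8 (n1 8 (by decide)), hS.nat 6 (n1 6 (by decide)), h.loc, h.num, hv, hrow]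
    rw [hS.nat 34 (n1 34 (by decide)), h.tables.pow _ l hl, dif_pos hl]
  · rintro s' ⟨hS, hval⟩
    refine ⟨hS, ?_⟩
    rw [hval, Finset.sum_range, ← ofBits_eq_sum]
    exact Finset.sum_congr rfl fun l _ => by rw [dif_pos l.2]

/-- The row `σ` of the sign table determines the common sign `ε` of the family: `-1` for `H₀`, `1`
for `δH`. One operator costs `O(n ^ 2)` for the conjugation and `O(n)` for its sign and its numbers.
-/
theorem runs_termsProg {s : Memory} {L : List (Gate n)} {x : Bits (n - q)} (h : BlockCtx s L q x)
    (hqn : q ≤ n) (hL : L.length ≤ 6 * n ^ 2) {A R : ℕ} {σ cnt : NExp} {ε : ℝ}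
    (hA : A ∉ termsNat) (hR : R ∉ [10, 26]) (F : Fin k → PauliString n) (c : Fin k → ℝ)
    (hcnt : ∀ s', Same termsNat [10, 26] s s' → cnt.eval s' = k)
    (hσ : ∀ s' (b : Bool), Same termsNat [10, 26] s s' →
      s'.real 20 (σ.eval s') b.toNat = ε * rsgn b)
    (hF : ∀ (j : Fin k) (i : Fin n), s.nat A j i = (F j i).code)
    (hc : ∀ j : Fin k, s.real R 0 j = c j) :
    Runs (termsProg A R σ cnt) s (k * (66 * n ^ 2 + 15 * n + 25) + 2) fun s' =>
      Same termsNat [10, 26] s s' ∧ ∀ a b, s'.real 10 a b = s.real 10 a b +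
        famCoef hqn (fun j => actL L (F j).tab) (fun j => ε * c j) x a b := by
  set tm : ℕ → ℕ → Fin k → ℝ := fun a b j => if (actL L (F j).tab).tailX hqn = a ∧
    (actL L (F j).tab).tailZ hqn = b then ε * c j * (actL L (F j).tab).headSign x else 0 with htm
  refine (Runs.forUp (T := 66 * n ^ 2 + 15 * n + 23) (M := k) (fun i s' =>
    Same termsNat [10, 26] s s' ∧ ∀ a b, s'.real 10 a b = s.real 10 a b +
      ∑ j ∈ Finset.range i, if hj : j < k then tm a b ⟨j, hj⟩ else 0)
    ⟨(Same.refl _ _ _).setNat (by simp) _ _ _, by simp⟩ (fun i s' _ h => hcnt s' h.1) ?_ ?_).mono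
    le_rfl fun _ h => h
  · rintro i s' hi ⟨hS, hsum⟩ hv
    have hctx := h.same hS (by decide) (by decide)
    refine (Runs.seq' (T₁ := 6 * n + 5) (T₂ := (L.length * 11 + 2) + (1 + (((n - q) * (1 + 2) + 2) +
      ((3 * q + 3) + ((3 * q + 3) + 1))))) (runs_loadProg (P := F ⟨i, hi⟩) (j := i) ?_ hctx.num hv
        (fun l => by rw [hS.nat _ hA]; exact hF ⟨i, hi⟩ l)) ?_).mono (by omega) fun _ h => h
    · simp at hA ⊢; omega
    rintro s₁ ⟨hT₁, S₁⟩
    have hctx₁ := hctx.same S₁ (by decide) (by decide)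
    refine Runs.seq' (runs_conjProg hT₁ hctx₁.circ) ?_
    rintro s₂ ⟨hT₂, S₂⟩
    set T := actL L (F ⟨i, hi⟩).tab with hT
    refine Runs.seq <| Runs.setReal ?_
    have S₂' : Same termsNat [10, 26] s s₂ := (hS.trans (S₁.mono (by decide) (by decide))).trans
      (S₂.mono (by decide) (by decide))
    have h26 := hσ s₂ T.r S₂'
    simp only [NExp.eval_ofNat, NExp.eval_get, RExp.eval_get, hT₂.r, h26]
    have S₃ : Same termsNat [26] s₂ (s₂.setReal 26 0 0 (ε * rsgn T.r)) :=
      (Same.refl _ _ _).setReal (by simp) _ _ _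
    have hv₃ : (s₂.setReal 26 0 0 (ε * rsgn T.r)).nat 20 0 0 = i := by
      simp [S₂.nat, S₁.nat, hv]
    have r₃ : (s₂.setReal 26 0 0 (ε * rsgn T.r)).real 26 0 0 = ε * rsgn T.r := by simp
    have hT₃ : TabAt (s₂.setReal 26 0 0 (ε * rsgn T.r)) T :=
      hT₂.same ((Same.refl [] [26] _).setReal (by simp) _ _ _) (by decide)
    have r10 : (s₂.setReal 26 0 0 (ε * rsgn T.r)).real 10 = s'.real 10 := by
      simp [S₂.real, S₁.real]
    generalize s₂.setReal 26 0 0 (ε * rsgn T.r) = s₃ at *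
    have hctx₃ := (hctx₁.same S₂ (by decide) (by decide)).same (S₃.mono (N' := termsNat)
      (R' := [26]) (by decide) (by decide)) (by decide) (by decide)
    refine Runs.seq' (Mid := fun s₄ => Same [27] [26] s₃ s₄ ∧ s₄.real 26 0 0 = ε * T.headSign x)
      (Runs.forUp (M := n - q) (fun l s₄ => Same [27] [26] s₃ s₄ ∧
      s₄.real 26 0 0 = ε * (rsgn T.r * ∏ t ∈ Finset.range l,
        if ht : t < n - q then rsgn (T.z ⟨t, by omega⟩ && x ⟨t, ht⟩) else 1))
        ⟨(Same.refl _ _ _).setNat (by simp) _ _ _, by simp [r₃]⟩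
        (fun l s₄ _ h => by simp [h.1.nat, hctx₃.num, hctx₃.loc]) ?_ ?_) ?_
    · rintro l s₄ hl ⟨S₄, hr₄⟩ hv₄
      refine Runs.setReal ⟨hv₄, (S₄.setReal (by simp) _ _ _).setNat (by simp) _ _ _, ?_⟩
      have e1 : s₄.nat 11 0 l = (T.z ⟨l, by omega⟩).toNat := by
        rw [S₄.nat 11 (by decide)]; exact hT₃.z ⟨l, by omega⟩
      have e2 : s₄.nat 5 0 l = (x ⟨l, hl⟩).toNat := by
        rw [S₄.nat 5 (by decide)]; exact hctx₃.bits ⟨l, hl⟩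
      have e3 : ∀ b : Bool, s₄.real 20 0 b.toNat = rsgn b := by
        rw [S₄.real 20 (by decide)]; exact hctx₃.tables.sign
      simp only [NExp.eval_ofNat, NExp.eval_get, NExp.eval_band_eq, RExp.eval_mul, RExp.eval_get,
        hv₄, e1, e2, band_toNat, e3, hr₄, Memory.setNat_real, Memory.setReal_real_same]
      rw [Finset.prod_range_succ, dif_pos hl]
      ring
    · rintro s₄ ⟨S₄, hr₄⟩ -
      refine ⟨S₄, ?_⟩
      rw [hr₄, Tab.headSign, Finset.prod_range]
      congr 2
      exact Finset.prod_congr rfl fun t _ => by rw [dif_pos t.2]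
    rintro s₄ ⟨S₄, hr₄⟩
    have hctx₄ := hctx₃.same S₄ (by decide) (by decide)
    have hT₄ := hT₃.same S₄ (by decide)
    refine Runs.seq' (runs_tailSum hctx₄ hqn (Or.inl rfl) (by decide) hT₄.x) ?_
    rintro s₅ ⟨S₅, hx₅⟩
    have hctx₅ := hctx₄.same S₅ (by decide) (by decide)
    have hT₅ := hT₄.same S₅ (by decide)
    refine Runs.seq' (runs_tailSum hctx₅ hqn (Or.inr rfl) (by decide) hT₅.z) ?_
    rintro s₆ ⟨S₆, hz₆⟩
    have hx₆ : s₆.nat 36 0 0 = T.tailX hqn := by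
      rw [S₆.nat 36 (by decide), hx₅]; rfl
    have hz₆' : s₆.nat 37 0 0 = T.tailZ hqn := by rw [hz₆]; rfl
    have hv₆ : s₆.nat 20 0 0 = i := by simp [S₆.nat, S₅.nat, S₄.nat, hv₃]
    have S₆' : Same termsNat [10, 26] s s₆ :=
      (((S₂'.trans (S₃.mono (by decide) (by decide))).trans (S₄.mono (by decide)
        (by decide))).trans (S₅.mono (by decide) (by decide))).trans (S₆.mono (by decide)
        (by decide))
    have hcR : s₆.real R 0 i = c ⟨i, hi⟩ := by rw [S₆'.real R hR]; exact hc ⟨i, hi⟩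
    have h26' : s₆.real 26 0 0 = ε * T.headSign x := by
      rw [S₆.real 26 (by decide), S₅.real 26 (by decide), hr₄]
    have h10 : s₆.real 10 = s'.real 10 := by
      rw [S₆.real 10 (by decide), S₅.real 10 (by decide), S₄.real 10 (by decide), r10]
    refine Runs.setReal ⟨by simpa using hv₆, (S₆'.setReal (by simp) _ _ _).setNat
      (by simp) _ _ _, fun a b => ?_⟩
    simp only [NExp.eval_get, NExp.eval_ofNat, RExp.eval_add, RExp.eval_mul, RExp.eval_get,
      hx₆, hz₆', hv₆, hcR, h26', h10, Memory.setNat_real, Memory.setReal_real, hsum]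
    rw [Finset.sum_range_succ, dif_pos hi, htm]
    dsimp only
    rw [← hT]
    by_cases hab : T.tailX hqn = a ∧ T.tailZ hqn = b
    · rw [if_pos hab, if_pos ⟨trivial, hab.1.symm, hab.2.symm⟩, hab.1, hab.2]
      ring
    · rw [if_neg hab, if_neg (fun h' => hab ⟨h'.2.1.symm, h'.2.2.symm⟩)]
      ring
  · rintro s' ⟨hS, hsum⟩ -
    refine ⟨hS, fun a b => ?_⟩
    rw [hsum, famCoef, Finset.sum_range]
    congr 1
    exact Finset.sum_congr rfl fun j _ => by rw [dif_pos j.2]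

/-- Compute the matrix of the block from its coefficients. -/
def matrixProg : Program :=
  let e : NExp := .get 35 (nv 27) (nv 28)
  let s : RExp := .get 11 (nv 29) (nv 28) * .get 11 (nv 29) (nv 28) -
    .get 12 (nv 29) (nv 28) * .get 12 (nv 29) (nv 28)
  .forUp 27 (nv 15) (.forUp 28 (nv 15) (
    .sumR 29 (nv 15) 21 (.get 10 e (nv 29) * .get 11 e (nv 29) * s) ;;
    .sumR 29 (nv 15) 22 (.get 10 e (nv 29) * .get 12 e (nv 29) * s) ;;
    .setReal 13 (nv 27) (nv 28) (rv 21) ;; .setReal 14 (nv 27) (nv 28) (rv 22)))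

/-- A power of `i` is real or purely imaginary, so its square is real. -/
theorem iph_sq_re (a b : ℕ) : iph q a b ^ 2 =
    (((iph q a b).re * (iph q a b).re - (iph q a b).im * (iph q a b).im : ℝ) : ℂ) := by
  have h : ∀ s : Finset ℕ, (∏ l ∈ s, if a.testBit l && b.testBit l then Complex.I else 1).re *
      (∏ l ∈ s, if a.testBit l && b.testBit l then Complex.I else 1).im = 0 := by
    intro s
    induction s using Finset.induction_on with
    | empty => simp
    | insert l s hl ih =>
      rw [Finset.prod_insert hl]
      split_ifs
      · simp only [Complex.mul_re, Complex.mul_im, Complex.I_re, Complex.I_im]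
        linear_combination -ih
      · simpa using ih
  have h' : (iph q a b).re * (iph q a b).im = 0 := h _
  apply Complex.ext
  · rw [sq, Complex.mul_re, Complex.ofReal_re]
  · rw [sq, Complex.mul_im, Complex.ofReal_im]
    linear_combination 2 * h'

/-- The integer arrays changed by `matrixProg`. -/
abbrev matNat : List ℕ := [27, 28, 29]

theorem runs_matrixProg {s : Memory} {D : Hamiltonian n m k} {L : List (Gate n)}
    {x : Bits (n - q)} (hG : GoodCircuit D q L) (hqn : q ≤ n) (ht : Tables q s)
    (hco : ∀ a b, s.real 10 a b = D.coef hqn L x a b) :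
    Runs matrixProg s (22 * 8 ^ q) fun s' => Same matNat [13, 14, 21, 22] s s' ∧
      MatAt s' (D.numBlock L q x) := by
  have hp : (8 : ℕ) ^ q = 2 ^ q * 2 ^ q * 2 ^ q := by rw [← mul_pow, ← mul_pow]; norm_num
  have h1 : 1 ≤ 2 ^ q := Nat.one_le_two_pow
  have hd := ht.dim
  set d := 2 ^ q with hdd
  set M := D.numBlock L q x with hM
  refine (Runs.forUp (T := d * (6 * d + 8 + 2) + 2) (M := d) (fun v s' =>
    Same matNat [13, 14, 21, 22] s s' ∧ ∀ u w : Fin d, (u : ℕ) < v →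
      s'.real 13 u w = (M u w).re ∧ s'.real 14 u w = (M u w).im)
    ⟨(Same.refl _ _ _).setNat (by simp) _ _ _, by simp⟩ (fun v s' _ h => by simp [h.1.nat, hd])
    ?_ ?_).mono ?_ fun _ h => h
  rotate_left 2
  · have e : d * (d * (6 * d + 8 + 2) + 2 + 2) + 2 = 6 * (d * d * d) + 10 * (d * d) + 4 * d + 2 := by
      ring
    have e1 : d * d ≤ d * d * d := Nat.le_mul_of_pos_right _ h1
    have e2 : d ≤ d * d := Nat.le_mul_of_pos_right _ h1
    omega
  · rintro v s' hv ⟨hS, hrow⟩ hv'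
    refine Runs.forUp (M := d) (fun w s'' => Same [28, 29] [13, 14, 21, 22] s' s'' ∧
      ∀ u t : Fin d, (u : ℕ) < v ∨ (u : ℕ) = v ∧ (t : ℕ) < w →
        s''.real 13 u t = (M u t).re ∧ s''.real 14 u t = (M u t).im)
      ⟨(Same.refl _ _ _).setNat (by simp) _ _ _, ?_⟩
      (fun w s'' _ h => by simp [h.1.nat, hS.nat, hd]) ?_ ?_
    · rintro u t (h' | h')
      · exact hrow u t h'
      · omega
    · rintro w s'' hw ⟨hS', hent⟩ hw'
      have hS'' : Same matNat [13, 14, 21, 22] s s'' := hS.trans (hS'.mono (by decide) (by decide))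
      have ht' : Tables q s'' := ht.same hS'' (by decide) (by decide)
      have hco' : ∀ a b, s''.real 10 a b = D.coef hqn L x a b := by
        rw [hS''.real 10 (by decide)]; exact hco
      have hvv : s''.nat 27 0 0 = v := by simp [hS'.nat, hv']
      have hxor : s''.nat 35 v w = v ^^^ w := (ht'.entry v w hv hw).xor
      have hlt : v ^^^ w < 2 ^ q := Nat.xor_lt_two_pow hv hw
      refine (Runs.seq' (T₁ := 3 * d + 3) (T₂ := (3 * d + 3) + (1 + 1)) (Runs.sumR d
        (fun z => D.coef hqn L x (v ^^^ w) z * (iph q (v ^^^ w) z).re *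
          ((iph q z w).re * (iph q z w).re - (iph q z w).im * (iph q z w).im))
        (fun s₁ h => by simp [h.nat, ht'.dim, hdd]) ?_) ?_).mono (by omega) fun _ h => h
      · intro z s₁ hz S₁ hz'
        have e1 := ht'.entry (v ^^^ w) z hlt hz
        have e2 := ht'.entry z w hz hw
        simp [S₁.nat, S₁.real, hvv, hw', hz', hxor, hco', e1.re, e2.re, e2.im]
      rintro s₁ ⟨S₁, h₁⟩
      refine Runs.seq' (Runs.sumR d
        (fun z => D.coef hqn L x (v ^^^ w) z * (iph q (v ^^^ w) z).im *
          ((iph q z w).re * (iph q z w).re - (iph q z w).im * (iph q z w).im))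
        (fun s₂ h => by simp [h.nat, S₁.nat, ht'.dim, hdd]) ?_) ?_
      · intro z s₂ hz S₂ hz'
        have e1 := ht'.entry (v ^^^ w) z hlt hz
        have e2 := ht'.entry z w hz hw
        simp [S₂.nat, S₂.real, S₁.nat, S₁.real, hvv, hw', hz', hxor, hco', e1.im, e2.re, e2.im]
      rintro s₂ ⟨S₂, h₂⟩
      have hvw : M ⟨v, hv⟩ ⟨w, hw⟩ = ⟨s₂.real 21 0 0, s₂.real 22 0 0⟩ := by
        rw [hM, hG.numBlock_apply hqn, S₂.real 21 (by decide), h₁, h₂]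
        have hterm : ∀ z, (D.coef hqn L x (v ^^^ w) z : ℂ) * iph q (v ^^^ w) z * iph q z w ^ 2 =
            ⟨D.coef hqn L x (v ^^^ w) z * (iph q (v ^^^ w) z).re *
          ((iph q z w).re * (iph q z w).re - (iph q z w).im * (iph q z w).im),
          D.coef hqn L x (v ^^^ w) z * (iph q (v ^^^ w) z).im *
          ((iph q z w).re * (iph q z w).re - (iph q z w).im * (iph q z w).im)⟩ := by
          intro z
          rw [iph_sq_re, Complex.ext_iff, Complex.re_mul_ofReal, Complex.im_mul_ofReal,
            Complex.re_ofReal_mul, Complex.im_ofReal_mul]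
          exact ⟨rfl, rfl⟩
        simp only [hterm]
        apply Complex.ext
        · rw [Complex.re_sum]
        · rw [Complex.im_sum]
      have hvv₂ : s₂.nat 27 0 0 = v := by simp [S₂.nat, S₁.nat, hvv]
      have hww₂ : s₂.nat 28 0 0 = w := by simp [S₂.nat, S₁.nat, hw']
      refine Runs.seq <| Runs.setReal <| Runs.setReal ?_
      simp only [NExp.eval_get, NExp.eval_ofNat, RExp.eval_get, Memory.setReal_nat, hvv₂, hww₂]
      refine ⟨trivial, ((((hS'.trans (S₁.mono (by decide) (by decide))).trans
        (S₂.mono (by decide) (by decide))).setReal (by simp) _ _ _).setReal (by simp) _ _ _).setNat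
        (by simp) _ _ _, fun u t hut => ?_⟩
      by_cases hc : (u : ℕ) = v ∧ (t : ℕ) = w
      · obtain rfl : u = ⟨v, hv⟩ := Fin.ext hc.1
        obtain rfl : t = ⟨w, hw⟩ := Fin.ext hc.2
        rw [hvw]
        simp [Memory.setReal_real]
      · rw [← (hent u t (by omega)).1, ← (hent u t (by omega)).2]
        simp [Memory.setReal_real, hc, S₂.real, S₁.real]
    · rintro s'' ⟨hS', hent⟩ -
      refine ⟨by simp [hS'.nat, hv'], (hS.trans (hS'.mono (by decide) (by decide))).setNat
        (by simp) _ _ _, fun u t hut => ?_⟩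
      exact hent u t (by omega)
  · rintro s' ⟨hS, hrow⟩ -
    exact ⟨hS, fun u w => hrow u w u.2⟩

end DopedStab

namespace DopedStab

/-! ### Eigenvectors of a block of the tridiagonal matrix -/

/-- Find the block containing the index `nv 36`; put a `1` after the end of its subdiagonal. -/
def findBlock : Program :=
  .setNat 33 0 (nv 15) 0 ;; .setNat 38 0 0 (nv 36) ;;
  .loop (.le 1 (.get 33 0 (nv 38))) (.setNat 38 0 0 (nv 38 - 1)) ;;
  .setNat 39 0 0 (nv 36 + 1) ;;
  .loop (.le 1 (.get 33 0 (nv 39))) (.setNat 39 0 0 (nv 39 + 1)) ;;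
  -- This may overwrite the zero entry at the start of the next block; only the present block is
  -- evaluated afterwards.
  .setNat 40 0 0 (nv 39 - nv 38) ;; .setReal 24 0 (nv 39) 1

/-- The scan to the left stops at the latest at index `0`, because `K 0 = 0`; the scan to the right
stops at the latest at `d`, where the program has first put a zero. -/
theorem runs_findBlock {s : Memory} {d i : ℕ} (hd : s.nat 15 0 0 = d) (hi : s.nat 36 0 0 = i)
    (hid : i < d) (hK : s.nat 33 0 0 = 0) :
    Runs findBlock s (4 * d + 10) fun s' => Same [33, 38, 39, 40] [24] s s' ∧
      ∃ S L, IsBlock d (s.nat 33 0) S L ∧ S ≤ i ∧ i < S + L ∧ s'.nat 38 0 0 = S ∧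
        s'.nat 40 0 0 = L ∧ ∀ t, s'.real 24 0 t = if t = S + L then 1 else s.real 24 0 t := by
  refine (Runs.seq (T₁ := 1) (T₂ := 1 + ((i * (1 + 1) + 1) + (1 + (((d - (i + 1)) * (1 + 1) + 1) +
    (1 + 1))))) <| Runs.setNat <| Runs.seq <| Runs.setNat ?_).mono (by omega) fun _ h => h
  simp only [NExp.eval_get, NExp.eval_ofNat, hd, hi, Memory.setNat_nat_ne _ _ _ _ _ 36
    (show 36 ≠ 33 by decide)]
  generalize hs₁ : (s.setNat 33 0 d 0).setNat 38 0 0 i = s₁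
  have S₁ : Same [33, 38, 39, 40] [] s s₁ := by
    rw [← hs₁]
    exact ((Same.refl _ _ _).setNat (by simp) _ _ _).setNat (by simp) _ _ _
  have hK₁ : ∀ t, t < d → s₁.nat 33 0 t = s.nat 33 0 t := fun t ht => by
    rw [← hs₁]; simp [Memory.setNat_nat, ht.ne]
  have hKd : s₁.nat 33 0 d = 0 := by rw [← hs₁]; simp [Memory.setNat_nat]
  -- The loop counter is the position itself. For the scan to the right it will be the distance to
  -- `d`.
  refine Runs.seq' (Runs.while (fun j s' => Same [38] [] s₁ s' ∧ s'.nat 38 0 0 = j ∧ j ≤ i ∧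
    ∀ t, j < t → t ≤ i → s.nat 33 0 t ≠ 0) i ⟨Same.refl _ _ _, by simp [← hs₁], le_rfl, by omega⟩
    (Post := fun s' => ∃ S, Same [38] [] s₁ s' ∧ s'.nat 38 0 0 = S ∧ S ≤ i ∧ s.nat 33 0 S = 0 ∧
    ∀ t, S < t → t ≤ i → s.nat 33 0 t ≠ 0) ?_ ?_) ?_
  · rintro j s' ⟨hS, hj, hji, hne⟩ hb
    simp only [Test.holds_le, NExp.eval_get, NExp.eval_ofNat, hj, hS.nat 33 (by decide),
      hK₁ j (by omega)] at hb
    have hj0 : j ≠ 0 := by rintro rfl; omega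
    refine ⟨j - 1, by omega, Runs.setNat ⟨hS.setNat (by simp) _ _ _, by simp [hj], by omega,
      fun t h1 h2 => ?_⟩⟩
    rcases Nat.lt_or_ge j t with h3 | h3
    · exact hne t h3 h2
    · obtain rfl : t = j := by omega
      omega
  · rintro j s' ⟨hS, hj, hji, hne⟩ hb
    simp only [Test.holds_le, NExp.eval_get, NExp.eval_ofNat, hj, hS.nat 33 (by decide),
      hK₁ j (by omega)] at hb
    exact ⟨j, hS, hj, hji, by omega, hne⟩
  rintro s₂ ⟨S, S₂, hS, hSi, hS0, hne⟩
  refine Runs.seq <| Runs.setNat ?_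
  simp only [NExp.eval_get, NExp.eval_ofNat, NExp.eval_add, S₂.nat 36 (by decide),
    S₁.nat 36 (by decide), hi]
  refine Runs.seq' (Runs.while (fun j s' => Same [38, 39] [] s₁ s' ∧ s'.nat 39 0 0 = d - j ∧
    j ≤ d - (i + 1) ∧ s'.nat 38 0 0 = S ∧ ∀ t, i < t → t < d - j → s.nat 33 0 t ≠ 0) (d - (i + 1))
    ⟨(S₂.mono (by decide) (by decide)).setNat (by simp) _ _ _, by simp; omega, le_rfl,
      by simp [hS], by omega⟩
    (Post := fun s' => ∃ e, Same [38, 39] [] s₁ s' ∧ s'.nat 39 0 0 = e ∧ i < e ∧ e ≤ d ∧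
      s'.nat 38 0 0 = S ∧ (e < d → s.nat 33 0 e = 0) ∧
    ∀ t, i < t → t < e → s.nat 33 0 t ≠ 0) ?_ ?_) ?_
  · rintro j s' ⟨hS', hj, hji, h38, hne'⟩ hb
    have hj0 : j ≠ 0 := by
      rintro rfl
      simp [hj, hS'.nat, hKd] at hb
    simp only [Test.holds_le, NExp.eval_get, NExp.eval_ofNat, hj, hS'.nat 33 (by decide),
      hK₁ (d - j) (by omega)] at hb
    refine ⟨j - 1, by omega, Runs.setNat ⟨hS'.setNat (by simp) _ _ _, by simp [hj]; omega, by omega,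
      by simp [h38], fun t h1 h2 => ?_⟩⟩
    rcases Nat.lt_or_ge t (d - j) with h3 | h3
    · exact hne' t h1 h3
    · obtain rfl : t = d - j := by omega
      omega
  · rintro j s' ⟨hS', hj, hji, h38, hne'⟩ hb
    refine ⟨d - j, hS', hj, by omega, by omega, h38, fun hlt => ?_, hne'⟩
    simp only [Test.holds_le, NExp.eval_get, NExp.eval_ofNat, hj, hS'.nat 33 (by decide),
      hK₁ (d - j) hlt] at hb
    omega
  rintro s₃ ⟨e, S₃, he, hie, hed, h38, he0, hne'⟩
  refine Runs.seq <| Runs.setNat <| Runs.setReal ⟨?_, S, e - S, ⟨by omega, by omega, hS0, ?_, ?_⟩, hSi,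
    by omega, ?_, ?_, ?_⟩
  · exact ((S₁.mono (by decide) (by decide)).trans (S₃.mono (by decide) (by decide))).setNat
      (by simp) _ _ _ |>.setReal (by simp) _ _ _
  · intro l h1 h2
    rcases Nat.lt_or_ge i (S + l) with h3 | h3
    · exact hne' _ h3 (by omega)
    · exact hne _ (by omega) h3
  · intro h
    rw [show S + (e - S) = e by omega] at h ⊢
    exact he0 h
  · simp [h38]
  · simp [h38, he]
  · intro t
    simp [Memory.setReal_real, he, S₃.real, S₁.real, show S + (e - S) = e by omega]

/-- Tabulate the coefficients of the polynomials of the block, shifted by one place, in the rows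
of array `25`, and copy those of the last one to array `26`. -/
def polyProg : Program :=
  let α : RExp := .get 23 0 (nv 38 + nv 41)
  .mapR 42 (nv 40 + 2) 25 0 0 ;; .mapR 42 (nv 40 + 2) 25 1 0 ;; .setReal 25 1 1 1 ;;
  .forUp 41 (nv 40) (.mapR 42 (nv 40 + 2) 25 (nv 41 + 2)
    ((.get 25 (nv 41 + 1) (nv 42 - 1) - α * .get 25 (nv 41 + 1) (nv 42) -
      .get 24 0 (nv 38 + nv 41) * .get 25 (nv 41) (nv 42)) / .get 24 0 (nv 38 + nv 41 + 1))) ;;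
  .mapR 42 (nv 40 + 1) 26 0 (.get 25 (nv 40 + 1) (nv 42 + 1))

/-- The description of a block in memory. -/
structure BlockAt (s : Memory) (a b : ℕ → ℝ) (S L : ℕ) : Prop where
  start : s.nat 38 0 0 = S
  len : s.nat 40 0 0 = L
  diag : s.real 23 0 = a
  sub : ∀ l ≤ L, s.real 24 0 (S + l) = blockSub b S L l

theorem BlockAt.same {s s' : Memory} {a b : ℕ → ℝ} {S L : ℕ} (h : BlockAt s a b S L)
    {N R : List ℕ} (hS : Same N R s s') (hN : [38, 40].all (· ∉ N) = true)
    (hR : [23, 24].all (· ∉ R) = true) : BlockAt s' a b S L := by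
  simp at hN hR
  refine ⟨?_, ?_, ?_, ?_⟩
  · rw [hS.nat _ hN.1]; exact h.start
  · rw [hS.nat _ hN.2]; exact h.len
  · rw [hS.real _ hR.1]; exact h.diag
  · rw [hS.real _ hR.2]; exact h.sub

/-- The coefficients of a polynomial, shifted by one place. -/
def shiftCoeff (p : Polynomial ℝ) (c : ℕ) : ℝ := if c = 0 then 0 else p.coeff (c - 1)

theorem blockPoly_succ_succ (a b : ℕ → ℝ) (s L l : ℕ) : blockPoly a b s L (l + 2) =
    Polynomial.C (blockSub b s L (l + 1))⁻¹ * ((Polynomial.X - Polynomial.C (a (s + l))) *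
      blockPoly a b s L (l + 1) - Polynomial.C (blockSub b s L l) * blockPoly a b s L l) := rfl

/-- The shift puts a zero in column `0`. Multiplication by `X` then reads column `c - 1` without a
case distinction, the truncated index at `c = 0` meeting that zero. -/
theorem shiftCoeff_blockPoly (a b : ℕ → ℝ) (s L l c : ℕ) :
    shiftCoeff (blockPoly a b s L (l + 2)) c =
      (shiftCoeff (blockPoly a b s L (l + 1)) (c - 1) - a (s + l) *
        shiftCoeff (blockPoly a b s L (l + 1)) c - blockSub b s L l *
        shiftCoeff (blockPoly a b s L l) c) / blockSub b s L (l + 1) := by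
  rcases c with _ | c
  · simp [shiftCoeff]
  · rw [blockPoly_succ_succ, sub_mul]
    simp only [shiftCoeff, Nat.add_sub_cancel, Nat.succ_ne_zero, if_false, Polynomial.coeff_C_mul,
      Polynomial.coeff_sub]
    have : (Polynomial.X * blockPoly a b s L (l + 1)).coeff c =
        if c = 0 then 0 else (blockPoly a b s L (l + 1)).coeff (c - 1) := by
      rcases c with _ | c
      · simp
      · simp [Polynomial.coeff_X_mul]
    rw [this, div_eq_inv_mul]

theorem realRoots_eq (p : Polynomial ℝ) (d : ℕ) (hp : p.natDegree ≤ d) (c : ℕ → ℝ)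
    (hc : ∀ i ≤ d, c i = p.coeff i) : realRoots d c = p.roots.sort (· ≤ ·) := by
  rw [realRoots]
  conv_rhs => rw [p.as_sum_range_C_mul_X_pow' (Nat.lt_succ_of_le hp)]
  congr 2
  refine Finset.sum_congr rfl fun i hi => ?_
  rw [hc i (by simpa [Nat.lt_succ_iff] using hi)]

theorem runs_polyProg {s : Memory} {a b : ℕ → ℝ} {S L : ℕ} (h : BlockAt s a b S L) :
    Runs polyProg s (40 * (L + 1) ^ 2) fun s' => Same [41, 42] [25, 26] s s' ∧
      ∀ c ≤ L, s'.real 26 0 c = (blockPoly a b S L (L + 1)).coeff c := by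
  refine (Runs.seq' (T₁ := 3 * (L + 2) + 2) (T₂ := (3 * (L + 2) + 2) + (1 +
    ((L * (3 * (L + 2) + 2 + 2) + 2) + (3 * (L + 1) + 2)))) (Runs.mapR (L + 2) 0 (fun _ => 0)
      (fun s' hS => by simp [hS.nat, h.len]) (fun _ _ => rfl) fun _ _ _ _ _ _ => by simp) ?_).mono
    (by nlinarith) fun _ h => h
  rintro s₁ ⟨S₁, h₁⟩
  refine Runs.seq' (Runs.mapR (L + 2) 1 (fun _ => 0)
    (fun s' hS => by simp [hS.nat, S₁.nat, h.len]) (fun _ _ => rfl) fun _ _ _ _ _ _ => by simp) ?_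
  rintro s₂ ⟨S₂, h₂⟩
  refine Runs.seq <| Runs.setReal ?_
  simp only [NExp.eval_ofNat, RExp.eval_ofNat, Nat.cast_one]
  have S₃ : Same [41, 42] [25, 26] s (s₂.setReal 25 1 1 1) :=
    ((S₁.mono (by decide) (by decide)).trans (S₂.mono (by decide) (by decide))).setReal
      (by simp) _ _ _
  have h₃ : ∀ c, c < L + 2 → (s₂.setReal 25 1 1 1).real 25 0 c =
      shiftCoeff (blockPoly a b S L 0) c ∧
      (s₂.setReal 25 1 1 1).real 25 1 c = shiftCoeff (blockPoly a b S L 1) c := by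
    intro c hc
    simp only [Memory.setReal_real, h₂, h₁, blockPoly, jacobi, shiftCoeff]
    constructor
    · simp [hc]
    · rcases c with _ | _ | c
      · simp
      · simp
      · simp [hc, Polynomial.coeff_one]
  generalize s₂.setReal 25 1 1 1 = s₃ at *
  refine Runs.seq' (Runs.forUp (M := L) (fun i s' => Same [41, 42] [25, 26] s s' ∧
    ∀ l ≤ i + 1, ∀ c < L + 2, s'.real 25 l c = shiftCoeff (blockPoly a b S L l) c)
    ⟨S₃.setNat (by simp) _ _ _, ?_⟩ (fun i s' _ hS => by simp [hS.1.nat, h.len]) ?_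
    fun s' h _ => h) ?_
  · intro l hl c hc
    have : l = 0 ∨ l = 1 := by omega
    rcases this with rfl | rfl
    · exact (h₃ c hc).1
    · exact (h₃ c hc).2
  · rintro i s' hi ⟨hS, hp⟩ hv
    have hb := h.same hS (by decide) (by decide)
    refine (Runs.mapR (L + 2) (i + 2) (shiftCoeff (blockPoly a b S L (i + 2)))
      (fun s'' hS' => by simp [hS'.nat, hb.len]) (fun s'' hS' => by simp [hS'.nat, hv]) ?_).mono
      le_rfl ?_
    · intro c s'' hc hS' hv' hold
      have e1 : ∀ c', s''.real 25 (i + 1) c' = s'.real 25 (i + 1) c' := fun c' =>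
        hold _ _ (by omega)
      have e2 : ∀ c', s''.real 25 i c' = s'.real 25 i c' := fun c' => hold _ _ (by omega)
      have e3 : s'.real 24 0 (S + i) = blockSub b S L i := hb.sub i hi.le
      have e4 : s'.real 24 0 (S + i + 1) = blockSub b S L (i + 1) := by
        rw [add_assoc]; exact hb.sub (i + 1) hi
      have n41 : s''.nat 41 0 0 = i := by simp [hS'.nat, hv]
      have n38 : s''.nat 38 0 0 = S := by simp [hS'.nat, hb.start]
      simp only [RExp.eval_div, RExp.eval_sub, RExp.eval_mul, RExp.eval_get, NExp.eval_add,
        NExp.eval_sub, NExp.eval_get, NExp.eval_ofNat, n41, n38, hv', e1, e2,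
        hS'.real 24 (by decide), hS'.real 23 (by decide), e3, e4, hb.diag,
        hp (i + 1) le_rfl (c - 1) (by omega), hp (i + 1) le_rfl c hc, hp i (by omega) c hc]
      rw [shiftCoeff_blockPoly]
    · rintro s'' ⟨hS', hp'⟩
      refine ⟨by simp [hS'.nat, hv], (hS.trans (hS'.mono (by decide) (by decide))).setNat
        (by simp) _ _ _, fun l hl c hc => ?_⟩
      simp only [Memory.setNat_real]
      rw [hp']
      split_ifs with hl'
      · rw [hl'.1]
      · exact hp l (by omega) c hc
  rintro s₄ ⟨S₄, h₄⟩
  have hb := h.same S₄ (by decide) (by decide)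
  refine (Runs.mapR (L + 1) 0 (fun c => (blockPoly a b S L (L + 1)).coeff c)
    (fun s' hS => by simp [hS.nat, hb.len]) (fun _ _ => rfl) fun c s' hc hS hv _ => ?_).mono le_rfl ?_
  · simp [hv, hS.nat, hS.real, hb.len, h₄ (L + 1) le_rfl (c + 1) (by omega), shiftCoeff]
  · rintro s₅ ⟨S₅, h₅⟩
    refine ⟨S₄.trans (S₅.mono (by decide) (by decide)), fun c hc => ?_⟩
    rw [h₅, if_pos ⟨rfl, by omega⟩]

end DopedStab

namespace DopedStab

/-! ### Selecting a root and assembling its eigenvector -/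

theorem Same.setRoots {N R : List ℕ} {s s' : Memory} (h : Same N R s s') {a : ℕ} (ha : a ∈ R)
    (b d : ℕ) : Same N R s (s'.setRoots b a d) := by
  refine ⟨h.nat, fun c hc => ?_, h.tape⟩
  rw [← h.real c hc]
  funext i j
  have : c ≠ a := fun e => hc (e ▸ ha)
  simp [Memory.setRoots, this]

/-- Evaluate the polynomials of the block at its root number `nv 36 - nv 38`. -/
def evalProg : Program :=
  .roots 26 27 (nv 40) ;; .setReal 28 0 0 0 ;; .setReal 28 0 1 1 ;;
  .forUp 41 (nv 40) (.setReal 28 0 (nv 41 + 2)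
    (((.get 27 0 (nv 36 - nv 38) - .get 23 0 (nv 38 + nv 41)) * .get 28 0 (nv 41 + 1) -
      .get 24 0 (nv 38 + nv 41) * .get 28 0 (nv 41)) / .get 24 0 (nv 38 + nv 41 + 1)))

/-- The coefficients serve only to find the roots. The values of all polynomials at the chosen root
come from the recurrence, in linear time. -/
theorem runs_evalProg {s : Memory} {a b : ℕ → ℝ} {S L i : ℕ} (h : BlockAt s a b S L)
    (hi : s.nat 36 0 0 = i) (hSi : S ≤ i) (hiL : i < S + L)
    (hc : ∀ c ≤ L, s.real 26 0 c = (blockPoly a b S L (L + 1)).coeff c) :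
    Runs evalProg s (10 * (L + 1) ^ 3) fun s' => Same [41] [27, 28] s s' ∧
      ∀ l ≤ L, s'.real 28 0 l =
        (blockPoly a b S L l).eval ((blockRoots a b S L).getD (i - S) 0) := by
  set μ := (blockRoots a b S L).getD (i - S) 0 with hμ
  have h40 : (nv 40).eval s = L := h.len
  have hT : (L + 1) ^ 3 + (1 + (1 + (L * (1 + 2) + 2))) ≤ 10 * (L + 1) ^ 3 := by
    have : L + 1 ≤ (L + 1) ^ 3 := Nat.le_self_pow (by norm_num) _
    omega
  refine (Runs.seq' (T₁ := (L + 1) ^ 3) (T₂ := 1 + (1 + (L * (1 + 2) + 2)))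
    (Mid := fun s' => s' = s.setRoots 26 27 L) ?_ ?_).mono hT fun _ h => h
  · have := Runs.roots (s := s) (a := 26) (b := 27) (d := nv 40)
      (Post := fun s' => s' = s.setRoots 26 27 L) (by rw [h40])
    rwa [h40] at this
  rintro s₁ hs₁
  have S₁ : Same [41] [27, 28] s s₁ := hs₁ ▸ (Same.refl _ _ _).setRoots (by simp) _ _
  have hroot : s₁.real 27 0 (i - S) = μ := by
    rw [hs₁, Memory.setRoots, hμ, blockRoots,
      ← realRoots_eq (blockPoly a b S L (L + 1)) L (Polynomial.natDegree_le_iff_coeff_eq_zero.2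
        fun c hc => jacobi_coeff _ _ _ c hc) _ hc]
    simp only [true_and]
    rw [if_pos (by omega)]
  refine Runs.seq <| Runs.setReal <| Runs.seq <| Runs.setReal ?_
  simp only [NExp.eval_ofNat, RExp.eval_ofNat, Nat.cast_zero, Nat.cast_one]
  generalize hs₂ : (s₁.setReal 28 0 0 0).setReal 28 0 1 1 = s₂
  have S₂ : Same [41] [27, 28] s s₂ := by
    rw [← hs₂]
    exact (S₁.setReal (by simp) _ _ _).setReal (by simp) _ _ _
  have r₂ : s₂.real 27 0 (i - S) = μ := by rw [← hs₂]; simpa using hroot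
  have p₂ : s₂.real 28 0 0 = 0 ∧ s₂.real 28 0 1 = 1 := by
    rw [← hs₂]; simp [Memory.setReal_real]
  refine Runs.forUp (M := L) (fun j s' => Same [41] [28] s₂ s' ∧
    ∀ l ≤ j + 1, s'.real 28 0 l = (blockPoly a b S L l).eval μ)
    ⟨(Same.refl _ _ _).setNat (by simp) _ _ _, ?_⟩
    (fun j s' _ hS => by simp [hS.1.nat, S₂.nat, h.len]) ?_ ?_
  · intro l hl
    have : l = 0 ∨ l = 1 := by omega
    rcases this with rfl | rfl
    · simp [p₂, blockPoly, jacobi]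
    · simp [p₂, blockPoly, jacobi]
  · rintro j s' hj ⟨hS, hp⟩ hv
    have hb := (h.same S₂ (by decide) (by decide)).same hS (by decide) (by decide)
    have e3 : s'.real 24 0 (S + j) = blockSub b S L j := hb.sub j hj.le
    have e4 : s'.real 24 0 (S + j + 1) = blockSub b S L (j + 1) := by
      rw [add_assoc]; exact hb.sub (j + 1) hj
    have n36 : s'.nat 36 0 0 = i := by simp [hS.nat, S₂.nat, hi]
    have r27 : s'.real 27 0 (i - S) = μ := by rw [hS.real 27 (by decide), r₂]
    refine Runs.setReal ⟨hv, (hS.setReal (by simp) _ _ _).setNat (by simp) _ _ _, fun l hl => ?_⟩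
    simp only [RExp.eval_div, RExp.eval_sub, RExp.eval_mul, RExp.eval_get, NExp.eval_add,
      NExp.eval_sub, NExp.eval_get, NExp.eval_ofNat, hv, n36, hb.start, r27, e3, e4, hb.diag,
      hp (j + 1) le_rfl, hp j (by omega), Memory.setNat_real, Memory.setReal_real, true_and]
    split_ifs with hl'
    · subst hl'
      rw [blockPoly_succ_succ]
      simp only [Polynomial.eval_mul, Polynomial.eval_C, Polynomial.eval_sub, Polynomial.eval_X]
      rw [div_eq_inv_mul]
    · exact hp l (by omega)
  · rintro s' ⟨hS, hp⟩ -
    exact ⟨S₂.trans (hS.mono (by decide) (by decide)), fun l hl => hp l (by omega)⟩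

/-- Combine the basis vectors to the normalized eigenvector. -/
def combineProg : Program :=
  .sumR 42 (nv 40) 29 (.get 28 0 (nv 42 + 1) * .get 28 0 (nv 42 + 1)) ;;
  .forUp 43 (nv 15) (
    .sumR 42 (nv 40) 21 (.get 28 0 (nv 42 + 1) * .get 15 (nv 38 + nv 42) (nv 43)) ;;
    .sumR 42 (nv 40) 22 (.get 28 0 (nv 42 + 1) * .get 16 (nv 38 + nv 42) (nv 43)) ;;
    .setReal 3 0 (nv 43) (rv 21 / .sqrt (rv 29)) ;; .setReal 4 0 (nv 43) (rv 22 / .sqrt (rv 29)))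

theorem runs_combineProg {s : Memory} {a b : ℕ → ℝ} {S L d : ℕ} {μ : ℝ} (h : BlockAt s a b S L)
    (hd : s.nat 15 0 0 = d) (hL : L ≤ d)
    (hp : ∀ l ≤ L, s.real 28 0 l = (blockPoly a b S L l).eval μ) :
    Runs combineProg s (24 * (d + 1) ^ 2) fun s' => Same [42, 43] [3, 4, 21, 22, 29] s s' ∧
      memVec s' 3 4 0 d = blockEig (fun t => memVec s 15 16 t d) a b S L μ := by
  set p : ℕ → ℝ := fun l => (blockPoly a b S L (l + 1)).eval μ with hpd
  set ν := Real.sqrt (∑ l ∈ Finset.range L, p l ^ 2) with hν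
  have hcoord : ∀ v : Fin d, blockEig (fun t => memVec s 15 16 t d) a b S L μ v =
      ⟨(∑ l ∈ Finset.range L, p l * s.real 15 (S + l) v) / ν,
        (∑ l ∈ Finset.range L, p l * s.real 16 (S + l) v) / ν⟩ := by
    intro v
    have : blockEig (fun t => memVec s 15 16 t d) a b S L μ v =
        ((ν⁻¹ : ℝ) : ℂ) * ∑ l ∈ Finset.range L, (p l : ℂ) * memVec s 15 16 (S + l) d v := by
      rw [blockEig, blockVec]
      simp [hν, hpd]
    rw [this]
    apply Complex.ext
    · rw [Complex.re_ofReal_mul, Complex.re_sum]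
      simp [div_eq_inv_mul]
    · rw [Complex.im_ofReal_mul, Complex.im_sum]
      simp [div_eq_inv_mul]
  refine (Runs.seq' (T₁ := 3 * L + 3) (T₂ := d * ((3 * L + 3) + ((3 * L + 3) + (1 + 1)) + 2) + 2)
    (Runs.sumR L (fun l => p l * p l) (fun s' hS => by simp [hS.nat, h.len])
    fun l s' hl hS hv => ?_) ?_).mono ?_ fun _ h => h
  · simp [hS.real, hv, hp (l + 1) hl, hpd]
  swap
  · have := Nat.mul_le_mul_left d hL
    nlinarith
  rintro s₁ ⟨S₁, h₁⟩
  refine Runs.forUp (M := d) (fun v s' => Same [42, 43] [3, 4, 21, 22, 29] s s' ∧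
    s'.real 29 0 0 = ∑ l ∈ Finset.range L, p l * p l ∧
    ∀ u < v, s'.real 3 0 u = (∑ l ∈ Finset.range L, p l * s.real 15 (S + l) u) / ν ∧
      s'.real 4 0 u = (∑ l ∈ Finset.range L, p l * s.real 16 (S + l) u) / ν)
    ⟨(S₁.mono (by decide) (by decide)).setNat (by simp) _ _ _, by simpa using h₁, by simp⟩
    (fun v s' _ hS => by simp [hS.1.nat, hd]) ?_ ?_
  · rintro v s' hv ⟨hS, h29, hu⟩ hv'
    refine Runs.seq' (Runs.sumR L (fun l => p l * s.real 15 (S + l) v)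
      (fun s'' hS' => by simp [hS'.nat, hS.nat, h.len]) fun l s'' hl hS' hl' => ?_) ?_
    · simp [hS'.real, hS.real, hS'.nat, hS.nat, hl', hv', hp (l + 1) hl, hpd, h.start]
    rintro s₂ ⟨S₂, h₂⟩
    refine Runs.seq' (Runs.sumR L (fun l => p l * s.real 16 (S + l) v)
      (fun s'' hS' => by simp [hS'.nat, S₂.nat, hS.nat, h.len]) fun l s'' hl hS' hl' => ?_) ?_
    · simp [hS'.real, S₂.real, hS.real, hS'.nat, S₂.nat, hS.nat, hl', hv', hp (l + 1) hl, hpd,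
        h.start]
    rintro s₃ ⟨S₃, h₃⟩
    have S₃' : Same [42, 43] [3, 4, 21, 22, 29] s s₃ :=
      (hS.trans (S₂.mono (by decide) (by decide))).trans (S₃.mono (by decide) (by decide))
    have n43 : s₃.nat 43 0 0 = v := by simp [S₃.nat, S₂.nat, hv']
    have r29 : s₃.real 29 0 0 = ∑ l ∈ Finset.range L, p l * p l := by
      rw [S₃.real 29 (by decide), S₂.real 29 (by decide), h29]
    have rν : Real.sqrt (∑ l ∈ Finset.range L, p l * p l) = ν := by
      rw [hν]; simp only [sq]
    have r21 : s₃.real 21 0 0 = ∑ l ∈ Finset.range L, p l * s.real 15 (S + l) v := by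
      rw [S₃.real 21 (by decide), h₂]
    refine Runs.seq <| Runs.setReal <| Runs.setReal ?_
    simp only [NExp.eval_get, NExp.eval_ofNat, RExp.eval_div, RExp.eval_sqrt, RExp.eval_get,
      Memory.setReal_nat, Memory.setReal_real_ne _ _ _ _ _ 22 (show 22 ≠ 3 by decide),
      Memory.setReal_real_ne _ _ _ _ _ 29 (show 29 ≠ 3 by decide), n43, r29, rν, r21, h₃]
    refine ⟨trivial, ((S₃'.setReal (by simp) _ _ _).setReal (by simp) _ _ _).setNat
      (by simp) _ _ _, by simpa using r29, fun u hu' => ?_⟩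
    by_cases huv : u = v
    · subst huv
      simp [Memory.setReal_real]
    · rw [← (hu u (by omega)).1, ← (hu u (by omega)).2]
      simp [Memory.setReal_real, huv, S₃.real, S₂.real]
  · rintro s' ⟨hS, -, hu⟩ -
    refine ⟨hS, ?_⟩
    ext v
    rw [hcoord v]
    exact Complex.ext (hu v v.2).1 (hu v v.2).2

/-- Compute the eigenvector selected by the last `q` coins and complete the output. -/
def eigProg : Program :=
  .sumN 27 (nv 8) 36 (.get 34 (.get 5 0 (nv 6 - nv 8 + nv 27)) (nv 27)) ;; findBlock ;;
  polyProg ;; evalProg ;; combineProg ;; .setNat 3 0 0 (nv 7) ;; .setNat 3 0 1 (nv 8)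

/-- The integer arrays changed by `eigProg`. -/
abbrev eigNat : List ℕ := [3, 27, 33, 36, 38, 39, 40, 41, 42, 43]
/-- The real arrays changed by `eigProg`. -/
abbrev eigReal : List ℕ := [3, 4, 21, 22, 24, 25, 26, 27, 28, 29]

/-- The tail coins, read as a number `i < 2 ^ q`, select the block containing `i` and in it the root
number `i - S`. In this way every index reaches its own eigenvector although only one is computed.
-/
theorem runs_eigProg {n q : ℕ} {s : Memory} {L : List (Gate n)} {x : Bits (n - q)}
    {A : EuclideanSpace ℂ (Fin (2 ^ q)) →ₗ[ℂ] EuclideanSpace ℂ (Fin (2 ^ q))}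
    (h : BlockCtx s L q x) (hqn : q ≤ n) {v : Bits n}
    (hv : ∀ i : Fin n, s.nat 5 0 i = (v i).toNat)
    (hT : Tridiag A (2 ^ q) (fun t => memVec s 15 16 t (2 ^ q)) (s.real 23 0) (s.real 24 0)
      (s.nat 33 0)) :
    Runs eigProg s (600 * 8 ^ q) fun s' => Same eigNat eigReal s s' ∧
      s'.nat 3 0 0 = L.length ∧ s'.nat 3 0 1 = q ∧
      ∃ S Lb, IsBlock (2 ^ q) (s.nat 33 0) S Lb ∧ S ≤ Nat.ofBits (tailBits hqn v) ∧
        Nat.ofBits (tailBits hqn v) < S + Lb ∧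
        memVec s' 3 4 0 (2 ^ q) = blockEig (fun t => memVec s 15 16 t (2 ^ q)) (s.real 23 0)
          (s.real 24 0) S Lb ((blockRoots (s.real 23 0) (s.real 24 0) S Lb).getD
            (Nat.ofBits (tailBits hqn v) - S) 0) := by
  have hp : (8 : ℕ) ^ q = (2 ^ q) ^ 3 := by rw [← pow_mul, mul_comm q, pow_mul]; norm_num
  have h1 : 1 ≤ 2 ^ q := Nat.one_le_two_pow
  have hq2 : q < 2 ^ q := Nat.lt_two_pow_self
  have hlt := Nat.ofBits_lt_two_pow (tailBits hqn v)
  set i := Nat.ofBits (tailBits hqn v) with hi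
  have hd := h.tables.dim
  set d := 2 ^ q with hdd
  refine (Runs.seq' (T₁ := 3 * q + 3) (T₂ := (4 * d + 10) + (40 * (d + 1) ^ 2 + (10 * (d + 1) ^ 3 +
    (24 * (d + 1) ^ 2 + (1 + 1))))) (runs_tailSum h hqn (Or.inl rfl) (by decide) hv) ?_).mono ?_
    fun _ h => h
  swap
  · rw [hp]
    have e1 : d + 1 ≤ 2 * d := by omega
    have e2 : (d + 1) ^ 2 ≤ (2 * d) ^ 2 := Nat.pow_le_pow_left e1 2
    have e3 : (d + 1) ^ 3 ≤ (2 * d) ^ 3 := Nat.pow_le_pow_left e1 3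
    have e4 : d ^ 2 ≤ d ^ 3 := Nat.pow_le_pow_right h1 (by norm_num)
    have e5 : d ≤ d ^ 3 := Nat.le_self_pow (by norm_num) _
    rw [mul_pow] at e2 e3
    omega
  rintro s₁ ⟨S₁, h36⟩
  rw [← hi] at h36
  refine Runs.seq' (runs_findBlock (d := d) (i := i) (by simp [S₁.nat, hd]) h36 hlt
    (by simpa [S₁.nat] using hT.K0 h1)) ?_
  rintro s₂ ⟨S₂, S, Lb, hB, hSi, hiL, h38, h40, hsub⟩
  rw [S₁.nat 33 (by decide)] at hB
  have hLd : Lb ≤ d := by have := hB.le; omega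
  have hBA : BlockAt s₂ (s.real 23 0) (s.real 24 0) S Lb := by
    refine ⟨h38, h40, by simp [S₂.real, S₁.real], fun l hl => ?_⟩
    rw [hsub, blockSub, S₁.real 24 (by decide)]
    simp
  refine Runs.seq' ((runs_polyProg hBA).mono (Nat.mul_le_mul_left _
    (Nat.pow_le_pow_left (by omega) _)) fun _ h => h) ?_
  rintro s₃ ⟨S₃, hc⟩
  have hBA₃ := hBA.same S₃ (by decide) (by decide)
  refine Runs.seq' ((runs_evalProg hBA₃ (i := i) (by simp [S₃.nat, S₂.nat, h36]) hSi hiL hc).mono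
    (Nat.mul_le_mul_left _ (Nat.pow_le_pow_left (by omega) _)) fun _ h => h) ?_
  rintro s₄ ⟨S₄, hp₄⟩
  refine Runs.seq' (runs_combineProg (hBA₃.same S₄ (by decide) (by decide)) (d := d)
    (by simp [S₄.nat, S₃.nat, S₂.nat, S₁.nat, hd]) hLd hp₄) ?_
  rintro s₅ ⟨S₅, hvec⟩
  have S₄' : Same eigNat eigReal s s₄ :=
    (((S₁.mono (by decide) (by decide)).trans (S₂.mono (by decide) (by decide))).trans
      (S₃.mono (by decide) (by decide))).trans (S₄.mono (by decide) (by decide))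
  have S₅' : Same eigNat eigReal s s₅ := S₄'.trans (S₅.mono (by decide) (by decide))
  refine Runs.seq <| Runs.setNat <| Runs.setNat ⟨(S₅'.setNat (by simp) _ _ _).setNat
    (by simp) _ _ _, ?_, ?_, S, Lb, hB, hSi, hiL, ?_⟩
  · simp [Memory.setNat_nat, S₅'.nat, h.circ.len]
  · simp [S₅'.nat, h.loc]
  · refine (memVec_congr (s := s₅) (fun _ _ => rfl) (fun _ _ => rfl)).trans (hvec.trans ?_)
    simp only [S₄'.memVec (a := 15) (b := 16) (by decide) (by decide)]

end DopedStab

namespace DopedStab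

/-! ### Eigenbases of block-diagonal matrices -/

variable {n m k q : ℕ}

/-- Basis states of `n` qubits are pairs of a head and a tail. -/
def splitEquiv (h : q ≤ n) : Bits n ≃ Bits (n - q) × Bits q where
  toFun v := (headBits q v, tailBits h v)
  invFun p := joinBits q p.1 p.2
  left_inv := joinBits_head_tail h
  right_inv p := Prod.ext (headBits_joinBits p.1 p.2) (tailBits_joinBits h p.1 p.2)

theorem sum_head_tail {M : Type*} [AddCommMonoid M] (h : q ≤ n)
    (f : Bits (n - q) → Bits q → M) :
    ∑ v, f (headBits q v) (tailBits h v) = ∑ x, ∑ y, f x y := by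
  rw [← Fintype.sum_prod_type']
  exact (splitEquiv h).sum_comp fun p => f p.1 p.2

theorem blockMat_mulVec_tensorKet (h : q ≤ n) (B : Bits (n - q) → Matrix (Bits q) (Bits q) ℂ)
    (x : Bits (n - q)) (φ : Bits q → ℂ) :
    blockMat h B *ᵥ tensorKet h x φ = tensorKet h x (B x *ᵥ φ) := by
  funext v
  rw [Matrix.mulVec, dotProduct]
  simp only [blockMat, Matrix.of_apply, tensorKet]
  rw [sum_head_tail h fun x' y => (if headBits q v = x' then
    B (headBits q v) (tailBits h v) y else 0) * if x' = x then φ y else 0]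
  rw [Finset.sum_eq_single x]
  · by_cases hx : headBits q v = x
    · simp only [if_true, hx]
      rfl
    · simp [hx]
  · intro x' _ hx'
    simp [hx']
  · simp

theorem tensorKet_dotProduct (h : q ≤ n) (x x' : Bits (n - q)) (φ φ' : Bits q → ℂ) :
    star (tensorKet h x φ) ⬝ᵥ tensorKet h x' φ' = if x = x' then star φ ⬝ᵥ φ' else 0 := by
  rw [dotProduct]
  simp only [Pi.star_apply, tensorKet]
  rw [sum_head_tail h fun x'' y => star (if x'' = x then φ y else 0) *
    if x'' = x' then φ' y else 0, Finset.sum_eq_single x]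
  · by_cases hx : x = x'
    · simp only [if_pos hx, if_true]
      rfl
    · simp [hx]
  · intro x'' _ hx'
    simp [hx']
  · simp

theorem tensorKet_smul (h : q ≤ n) (x : Bits (n - q)) (c : ℂ) (φ : Bits q → ℂ) :
    tensorKet h x (c • φ) = c • tensorKet h x φ := by
  funext v
  simp [tensorKet]

theorem exists_orthonormalBasis_of_orthonormal {ι E : Type*} [Fintype ι] [NormedAddCommGroup E]
    [InnerProductSpace ℂ E] [FiniteDimensional ℂ E] (hc : Module.finrank ℂ E = Fintype.card ι)
    {v : ι → E} (hv : Orthonormal ℂ v) : ∃ b : OrthonormalBasis ι ℂ E, ∀ i, b i = v i := by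
  obtain ⟨b, hb⟩ := Orthonormal.exists_orthonormalBasis_extension_of_card_eq (𝕜 := ℂ) hc
    (v := v) (s := Set.univ) (hv.comp _ Subtype.val_injective)
  exact ⟨b, fun i => hb i trivial⟩

/-- The states `C† (|x⟩ ⊗ |φ⟩)` form an orthonormal basis. -/
theorem exists_eigenbasis (h : q ≤ n) (L : List (Gate n))
    (φ : Bits (n - q) → OrthonormalBasis (Bits q) ℂ (EuclideanSpace ℂ (Bits q))) :
    ∃ ψ : OrthonormalBasis (Bits (n - q) × Bits q) ℂ (EuclideanSpace ℂ (Bits n)),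
      ∀ x i, (ψ (x, i)).ofLp = (circuitMat L)ᴴ *ᵥ tensorKet h x (φ x i).ofLp := by
  have hon : Orthonormal ℂ fun p : Bits (n - q) × Bits q =>
      (WithLp.toLp 2 ((circuitMat L)ᴴ *ᵥ tensorKet h p.1 (φ p.1 p.2).ofLp) :
        EuclideanSpace ℂ (Bits n)) := by
    rw [orthonormal_iff_ite]
    rintro ⟨x, i⟩ ⟨x', i'⟩
    rw [EuclideanSpace.inner_eq_star_dotProduct, dotProduct_comm, Matrix.star_mulVec,
      ← Matrix.dotProduct_mulVec, Matrix.conjTranspose_conjTranspose, Matrix.mulVec_mulVec,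
      circuitMat_mul_conjTranspose, Matrix.one_mulVec, tensorKet_dotProduct]
    have := orthonormal_iff_ite.1 (φ x).orthonormal i i'
    rw [EuclideanSpace.inner_eq_star_dotProduct, dotProduct_comm] at this
    by_cases hx : x = x'
    · subst hx
      simp [this]
    · simp [hx]
  obtain ⟨ψ, hψ⟩ := exists_orthonormalBasis_of_orthonormal
    (by rw [finrank_euclideanSpace]; exact Fintype.card_congr (splitEquiv h)) hon
  exact ⟨ψ, fun x i => by rw [hψ]⟩

/-- By unitarity of the circuit, `H C† = C† (C H C†)`, and the block form acts on `|x⟩ ⊗ |φ⟩`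
through `B x` alone. -/
theorem mulVec_of_block {D : Hamiltonian n m k} (h : q ≤ n) {L : List (Gate n)}
    {B : Bits (n - q) → Matrix (Bits q) (Bits q) ℂ}
    (hB : circuitMat L * D.mat * (circuitMat L)ᴴ = blockMat h B) {x : Bits (n - q)}
    {φ : Bits q → ℂ} {E : ℂ} (hφ : B x *ᵥ φ = E • φ) :
    D.mat *ᵥ ((circuitMat L)ᴴ *ᵥ tensorKet h x φ) =
      E • ((circuitMat L)ᴴ *ᵥ tensorKet h x φ) := by
  have : D.mat * (circuitMat L)ᴴ = (circuitMat L)ᴴ * blockMat h B := by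
    rw [← hB, ← Matrix.mul_assoc, ← Matrix.mul_assoc, conjTranspose_mul_circuitMat, Matrix.one_mul]
  rw [Matrix.mulVec_mulVec, this, ← Matrix.mulVec_mulVec, blockMat_mulVec_tensorKet, hφ,
    tensorKet_smul, Matrix.mulVec_smul]

/-! ### Counting the terms of the Hamiltonian -/

theorem Letter.symp_injective : Function.Injective Letter.symp := by
  intro a b h
  cases a <;> cases b <;> simp [Letter.symp] at h ⊢

/-- Distinct Pauli strings have distinct symplectic vectors, and the span has `2 ^ |K|` elements. -/
theorem Hamiltonian.k_le (D : Hamiltonian n m k) : k ≤ 2 ^ D.dimK := by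
  set W := Submodule.span (ZMod 2)
    (Set.range fun j : Fin k => (fun i : Fin n => (D.P j i).symp : Fin n → ZMod 2 × ZMod 2)) with hW
  have hcard : Nat.card W = 2 ^ D.dimK := by
    have := Module.natCard_eq_pow_finrank (K := ZMod 2) (V := W)
    rw [this, Nat.card_zmod]
    rfl
  have hinj : Function.Injective fun j : Fin k =>
      (⟨fun i => (D.P j i).symp, Submodule.subset_span ⟨j, rfl⟩⟩ : W) := by
    intro j j' h
    apply D.P_injective
    funext i
    exact Letter.symp_injective (congrFun (Subtype.ext_iff.1 h) i)
  have := Nat.card_le_card_of_injective _ hinj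
  rwa [hcard, Nat.card_fin] at this

theorem Hamiltonian.m_le_one (D : Hamiltonian 0 m k) : m ≤ 1 := by
  have := Fintype.card_le_of_injective _ D.Q_injective
  simpa using this

/-- With `N = 2 ^ |K|` one has `k * n ^ 2 ≤ N * n ^ 2 ≤ n ^ 3 + N ^ 3`, according to which of `n`
and `N` is larger. The stray summand `m` is covered by `m * n ^ 2` unless `n = 0`, and then `m ≤ 1`.
-/
theorem Hamiltonian.terms_le (D : Hamiltonian n m k) :
    (m + k) * (n ^ 2 + 1) ≤ 3 * (n ^ 3 + m * n ^ 2 + 2 ^ (3 * D.dimK)) := by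
  have hk := D.k_le
  set N := 2 ^ D.dimK with hN
  have h1 : 1 ≤ N := Nat.one_le_two_pow
  have hN3 : 2 ^ (3 * D.dimK) = N ^ 3 := by rw [hN, ← pow_mul, mul_comm]
  rw [hN3]
  have e1 : N ≤ N ^ 3 := Nat.le_self_pow (by norm_num) _
  have e2 : N * n ^ 2 ≤ n ^ 3 + N ^ 3 := by
    rcases Nat.le_total n N with h | h
    · have : N * n ^ 2 ≤ N * N ^ 2 := Nat.mul_le_mul_left _ (Nat.pow_le_pow_left h 2)
      nlinarith
    · have : N * n ^ 2 ≤ n * n ^ 2 := Nat.mul_le_mul_right _ h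
      nlinarith
  have e3 : k * n ^ 2 ≤ N * n ^ 2 := Nat.mul_le_mul_right _ hk
  have e4 : m ≤ m * n ^ 2 + N ^ 3 := by
    rcases Nat.eq_zero_or_pos n with rfl | hn
    · have := D.m_le_one
      have : 1 ≤ N ^ 3 := Nat.one_le_pow _ _ h1
      omega
    · have : m * 1 ≤ m * n ^ 2 := Nat.mul_le_mul_left _ (Nat.one_le_pow _ _ hn)
      omega
  have : (m + k) * (n ^ 2 + 1) = m * n ^ 2 + k * n ^ 2 + m + k := by ring
  rw [this]
  omega

/-! ### Coins -/

open MeasureTheory in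
theorem coinMeasure_cylinder (v : Bits n) :
    coinMeasure {ω | ∀ i : Fin n, ω i = v i} = ((1 : ENNReal) / 2) ^ n := by
  have : {ω : ℕ → Bool | ∀ i : Fin n, ω i = v i} =
      Set.pi (Finset.range n) fun l => {b | ∀ h : l < n, b = v ⟨l, h⟩} := by
    ext ω
    simp only [Set.mem_ofPred_eq, Set.mem_pi, Finset.coe_range, Set.mem_Iio]
    exact ⟨fun h l hl h' => h ⟨l, h'⟩, fun h i => h i i.2 i.2⟩
  rw [this, coinMeasure, Measure.infinitePi_pi _ fun _ _ => MeasurableSet.of_discrete,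
    Finset.prod_congr rfl (g := fun _ => (1 : ENNReal) / 2), Finset.prod_const, Finset.card_range]
  intro l hl
  rw [Finset.mem_range] at hl
  have : {b | ∀ h : l < n, b = v ⟨l, h⟩} = {v ⟨l, hl⟩} := by
    ext b
    simp [hl]
  rw [this, PMF.toMeasure_uniformOfFintype_apply _ MeasurableSet.of_discrete]
  simp

/-- The memory after writing the bits `β` behind position `base` of array `5`. -/
def Memory.afterCoins (s : Memory) (base : ℕ) {N : ℕ} (β : Bits N) (τ : ℕ → Bool) : Memory where
  nat a i j := if a = 44 ∧ i = 0 ∧ j = 0 then N else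
    if h : a = 5 ∧ i = 0 ∧ base ≤ j ∧ j - base < N then (β ⟨j - base, h.2.2.2⟩).toNat
    else s.nat a i j
  real := s.real
  tape := τ

/-- Flip `N` coins and write them to array `5`. -/
def coinsProg (base N : NExp) : Program := .forUp 44 N (.coin 5 0 (base + nv 44))

theorem Memory.afterCoins_same (s : Memory) (base : ℕ) {N : ℕ} (β : Bits N) :
    Same [5, 44] [] s (s.afterCoins base β s.tape) := by
  refine ⟨fun a ha => ?_, fun _ _ => rfl, rfl⟩
  simp at ha
  funext i j
  simp [Memory.afterCoins, ha]

/-- The final memory is given exactly and not merely up to a frame, so that this run can be joined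
to runs of the other parts that were obtained for another tape. -/
theorem runs_coinsProg {s : Memory} {base N : NExp} {B M : ℕ}
    (hB : ∀ s', (∀ a, a ∉ [5, 44] → s'.nat a = s.nat a) → base.eval s' = B)
    (hN : ∀ s', (∀ a, a ∉ [5, 44] → s'.nat a = s.nat a) → N.eval s' = M) :
    Runs (coinsProg base N) s (3 * M + 2) fun s' =>
      s' = s.afterCoins B (fun i : Fin M => s.tape i) fun l => s.tape (M + l) := by
  have hfr : ∀ (i : ℕ) (a : ℕ), a ∉ [5, 44] →
      (s.afterCoins B (fun t : Fin i => s.tape t) fun l => s.tape (i + l)).nat a = s.nat a := by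
    intro i a ha
    simp at ha
    funext t j
    simp [Memory.afterCoins, ha]
  refine (Runs.forUp (T := 1) (M := M) (fun i s' =>
    s' = s.afterCoins B (fun t : Fin i => s.tape t) fun l => s.tape (i + l)) ?_ ?_ ?_
    fun s' h _ => h).mono (by omega) fun _ h => h
  · simp [Memory.afterCoins, Memory.setNat]
  · rintro i s' - rfl
    exact hN _ (hfr i)
  · rintro i s' hi rfl -
    have h44 : (s.afterCoins B (fun t : Fin i => s.tape t) fun l => s.tape (i + l)).nat 44 0 0 = i := by
      simp [Memory.afterCoins]
    refine Runs.coin ⟨by simpa [Memory.setCoin, Memory.setNat] using h44, ?_⟩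
    simp only [NExp.eval_add, NExp.eval_get, NExp.eval_ofNat, h44, hB _ (hfr i)]
    simp only [Memory.setCoin, Memory.setNat, Memory.afterCoins, Memory.mk.injEq, add_zero]
    refine ⟨?_, trivial, ?_⟩
    · funext a t j
      by_cases h1 : a = 44 ∧ t = 0 ∧ j = 0
      · simp [h1]
      · rw [if_neg h1, if_neg h1, if_neg h1]
        by_cases h2 : a = 5 ∧ t = 0 ∧ j = B + i
        · have : j - B = i := by omega
          rw [if_pos h2, dif_pos ⟨h2.1, h2.2.1, by omega, by omega⟩]
          simp [this]
        · rw [if_neg h2]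
          by_cases h3 : a = 5 ∧ t = 0 ∧ B ≤ j ∧ j - B < i
          · rw [dif_pos h3, dif_pos ⟨h3.1, h3.2.1, h3.2.2.1, by omega⟩]
          · rw [dif_neg h3, dif_neg]
            rintro ⟨rfl, rfl, h4, h5⟩
            exact h3 ⟨rfl, rfl, h4, by
              have : ¬ j = B + i := fun h => h2 ⟨rfl, rfl, h⟩
              omega⟩
    · funext l
      congr 1
      omega

end DopedStab

namespace DopedStab

/-! ### The algorithm -/

variable {n m k q : ℕ}

/-- The program numbers coordinates and eigenvectors by `0, …, 2 ^ q - 1`; relabelling along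
`bitsEquiv` is an isometry and turns the renumbered matrix back into `M`. -/
theorem exists_block_eigenbasis {M : Matrix (Bits q) (Bits q) ℂ}
    (hM : (M.submatrix (bitsEquiv q).symm (bitsEquiv q).symm).IsHermitian)
    {U : ℕ → EuclideanSpace ℂ (Fin (2 ^ q))} {a b : ℕ → ℝ} {K : ℕ → ℕ}
    (hT : Tridiag (Matrix.toEuclideanLin (M.submatrix (bitsEquiv q).symm (bitsEquiv q).symm))
      (2 ^ q) U a b K) {S Lb : Bits q → ℕ} (hB : ∀ y, IsBlock (2 ^ q) K (S y) (Lb y))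
    (hi : ∀ y, S y ≤ Nat.ofBits y ∧ Nat.ofBits y < S y + Lb y) :
    ∃ (φ : OrthonormalBasis (Bits q) ℂ (EuclideanSpace ℂ (Bits q))) (E : Bits q → ℝ),
      (∀ y z, φ y z = blockEig U a b (S y) (Lb y)
        ((blockRoots a b (S y) (Lb y)).getD (Nat.ofBits y - S y) 0) (bitsEquiv q z)) ∧
      ∀ y, M *ᵥ (φ y).ofLp = (E y : ℂ) • (φ y).ofLp := by
  have e : ∀ i : Fin (2 ^ q), Nat.ofBits ((bitsEquiv q).symm i) = i := fun i =>
    ofBits_decBits i.2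
  obtain ⟨h1, h2⟩ := hT.orthonormal (Matrix.isSymmetric_toEuclideanLin_iff.2 hM)
    (fun i => S ((bitsEquiv q).symm i)) (fun i => Lb ((bitsEquiv q).symm i)) (fun i => hB _)
    fun i => by simpa only [e] using hi ((bitsEquiv q).symm i)
  set w : Fin (2 ^ q) → EuclideanSpace ℂ (Fin (2 ^ q)) := fun i =>
    blockEig U a b (S ((bitsEquiv q).symm i)) (Lb ((bitsEquiv q).symm i))
      ((blockRoots a b (S ((bitsEquiv q).symm i)) (Lb ((bitsEquiv q).symm i))).getD
        (i - S ((bitsEquiv q).symm i)) 0) with hw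
  have h3 := (h1.comp_linearIsometryEquiv
    (LinearIsometryEquiv.piLpCongrLeft 2 ℂ ℂ (bitsEquiv q).symm)).comp _ (bitsEquiv q).injective
  obtain ⟨φ, hφ⟩ := exists_orthonormalBasis_of_orthonormal (ι := Bits q)
    (by rw [finrank_euclideanSpace]) h3
  have hφ' : ∀ y z, φ y z = w (bitsEquiv q y) (bitsEquiv q z) := fun y z => by
    rw [hφ]; rfl
  refine ⟨φ, fun y => (blockRoots a b (S y) (Lb y)).getD (Nat.ofBits y - S y) 0, fun y z => ?_,
    fun y => ?_⟩
  · rw [hφ', hw]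
    simp only [Equiv.symm_apply_apply]
    rfl
  · have h4 := congrArg WithLp.ofLp (h2 (bitsEquiv q y))
    rw [Matrix.ofLp_toLpLin, Matrix.toLin'_apply, Matrix.submatrix_mulVec_equiv,
      Equiv.symm_symm] at h4
    have h5 : (w (bitsEquiv q y)).ofLp ∘ bitsEquiv q = (φ y).ofLp := by
      funext z; rw [hφ']; rfl
    funext z
    have h6 := congrFun h4 (bitsEquiv q z)
    simp only [Function.comp_apply, Equiv.symm_apply_apply] at h6
    rw [← h5]
    simp only [hw, Equiv.symm_apply_apply]
    exact h6

/-! ### Correctness and cost of the whole program -/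

/-- The memory holds the Hamiltonian. -/
structure InputAt (s : Memory) (D : Hamiltonian n m k) : Prop where
  hm : s.nat 0 0 1 = m
  hk : s.nat 0 0 2 = k
  Q : ∀ (j : Fin m) (i : Fin n), s.nat 1 j i = (D.Q j i).code
  P : ∀ (j : Fin k) (i : Fin n), s.nat 2 j i = (D.P j i).code
  α : ∀ j : Fin m, s.real 1 0 j = D.α j
  γ : ∀ j : Fin k, s.real 2 0 j = D.γ j

theorem InputAt.same {s s' : Memory} {D : Hamiltonian n m k} (h : InputAt s D) {N R : List ℕ}
    (hS : Same N R s s') (hN : [0, 1, 2].all (· ∉ N) = true) (hR : [1, 2].all (· ∉ R) = true) :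
    InputAt s' D := by
  simp at hN hR
  refine ⟨?_, ?_, ?_, ?_, ?_, ?_⟩
  · rw [hS.nat _ hN.1]; exact h.hm
  · rw [hS.nat _ hN.1]; exact h.hk
  · rw [hS.nat _ hN.2.1]; exact h.Q
  · rw [hS.nat _ hN.2.2]; exact h.P
  · rw [hS.real _ hR.1]; exact h.α
  · rw [hS.real _ hR.2]; exact h.γ

theorem inputAt_input (D : Hamiltonian n m k) (ω : ℕ → Bool) : InputAt (D.input ω) D where
  hm := rfl
  hk := rfl
  Q j i := by simp [Hamiltonian.input]
  P j i := by simp [Hamiltonian.input]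
  α j := by simp [Hamiltonian.input]
  γ j := by simp [Hamiltonian.input]

/-- Compute the circuit and the tables. -/
def prepProg : Program := circuitProg ;; tablesProg

theorem runs_prepProg (D : Hamiltonian n m k) (ω : ℕ → Bool) (hq : q = min D.dimK n) :
    Runs prepProg (D.input ω) (600 * ((m + k) * (n ^ 2 + 1) + 1) + 40 * 8 ^ q) fun s =>
      ∃ L : List (Gate n), GoodCircuit D q L ∧ CircAt s L ∧ s.nat 6 0 0 = n ∧ s.nat 8 0 0 = q ∧
        Tables q s ∧ InputAt s D ∧ ∀ a b, s.real 10 a b = 0 := by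
  subst hq
  refine Runs.seq' (runs_circuitProg D ω) ?_
  rintro s ⟨L, hC, hG, h8, h6, hS⟩
  refine (runs_tablesProg h8).mono le_rfl ?_
  rintro s' ⟨hS', hT⟩
  refine ⟨L, hG, hC.same hS' (by decide), by simp [hS'.nat, h6], by simp [hS'.nat, h8], hT,
    ((inputAt_input D ω).same hS (by decide) (by decide)).same hS' (by decide) (by decide),
    fun a b => ?_⟩
  rw [hS'.real 10 (by decide), hS.real 10 (by decide)]
  simp [Hamiltonian.input]

/-- Compute the matrix of a block and make it tridiagonal. -/
def blockProg : Program :=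
  termsProg 1 1 1 (.get 0 0 1) ;; termsProg 2 2 0 (.get 0 0 2) ;; matrixProg ;; lanczosProg

theorem runs_blockProg {s : Memory} {D : Hamiltonian n m k} {L : List (Gate n)}
    {x : Bits (n - q)} (hG : GoodCircuit D q L) (hqn : q ≤ n) (h : BlockCtx s L q x)
    (hI : InputAt s D) (h0 : ∀ a b, s.real 10 a b = 0) :
    Runs blockProg s (81 * ((m + k) * (n ^ 2 + 1)) + 2500 * 8 ^ q) fun s' =>
      BlockCtx s' L q x ∧ Tridiag (Matrix.toEuclideanLin (D.numBlock L q x)) (2 ^ q)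
        (fun t => memVec s' 15 16 t (2 ^ q)) (s'.real 23 0) (s'.real 24 0) (s'.nat 33 0) := by
  have hp : (8 : ℕ) ^ q = (2 ^ q) ^ 3 := by rw [← pow_mul, mul_comm q, pow_mul]; norm_num
  have h1 : 1 ≤ 2 ^ q := Nat.one_le_two_pow
  refine (Runs.seq' (T₁ := m * (66 * n ^ 2 + 15 * n + 25) + 2)
    (T₂ := (k * (66 * n ^ 2 + 15 * n + 25) + 2) + (22 * 8 ^ q + 300 * (2 ^ q + 1) ^ 3))
    (runs_termsProg (A := 1) (R := 1) (σ := 1) (cnt := .get 0 0 1) (ε := -1) h hqn hG.len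
      (by decide) (by decide) D.Q D.α
      (fun s' hS => by simp [hS.nat, hI.hm]) (fun s' b hS => ?_) hI.Q hI.α) ?_).mono ?_
      fun _ h => h
  · rw [hS.real 20 (by decide), neg_one_mul]
    exact h.tables.nsign b
  swap
  · have e1 : 66 * n ^ 2 + 15 * n + 25 ≤ 81 * (n ^ 2 + 1) := by nlinarith [Nat.le_self_pow (two_ne_zero) n]
    have e2 := Nat.mul_le_mul_left m e1
    have e3 := Nat.mul_le_mul_left k e1
    -- The Lanczos process costs at most `300 * 8 * 8 ^ q`, the main share of the constant `2500`.
    have e4 : (2 ^ q + 1) ^ 3 ≤ (2 * 2 ^ q) ^ 3 := Nat.pow_le_pow_left (by omega) 3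
    have e5 : 1 ≤ 8 ^ q := Nat.one_le_pow _ _ (by norm_num)
    rw [mul_pow, ← hp] at e4
    have e6 : 81 * ((m + k) * (n ^ 2 + 1)) = m * (81 * (n ^ 2 + 1)) + k * (81 * (n ^ 2 + 1)) := by
      ring
    omega
  rintro s₁ ⟨S₁, h₁⟩
  have hctx₁ := h.same S₁ (by decide) (by decide)
  have hI₁ := hI.same S₁ (by decide) (by decide)
  refine Runs.seq' (runs_termsProg (A := 2) (R := 2) (σ := 0) (cnt := .get 0 0 2) (ε := 1) hctx₁
    hqn hG.len (by decide) (by decide) D.P D.γ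
    (fun s' hS => by simp [hS.nat, hI₁.hk]) (fun s' b hS => ?_) hI₁.P hI₁.γ) ?_
  · rw [hS.real 20 (by decide), one_mul]
    exact hctx₁.tables.sign b
  rintro s₂ ⟨S₂, h₂⟩
  have hctx₂ := hctx₁.same S₂ (by decide) (by decide)
  refine Runs.seq' (runs_matrixProg (x := x) hG hqn hctx₂.tables fun a b => ?_) ?_
  · rw [h₂, h₁, h0, zero_add, Hamiltonian.coef]
    simp only [neg_one_mul, one_mul]
  rintro s₃ ⟨S₃, hM⟩
  have hctx₃ := hctx₂.same S₃ (by decide) (by decide)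
  refine (runs_lanczosProg (D.numBlock_isHermitian L x) hctx₃.tables.dim hM).mono le_rfl ?_
  rintro s₄ ⟨S₄, hT⟩
  exact ⟨hctx₃.same S₄ (by decide) (by decide), hT⟩

/-- The whole algorithm. -/
def sampleProg : Program :=
  prepProg ;; coinsProg 0 (nv 6 - nv 8) ;; blockProg ;; coinsProg (nv 6 - nv 8) (nv 8) ;; eigProg

theorem Memory.afterCoins_bits {s : Memory} (x : Bits n) (i : Fin n) (τ : ℕ → Bool) :
    (s.afterCoins 0 x τ).nat 5 0 i = (x i).toNat := by
  simp [Memory.afterCoins]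

theorem Memory.afterCoins_joinBits {s : Memory} (hqn : q ≤ n) {x : Bits (n - q)} (y : Bits q)
    (hx : ∀ i : Fin (n - q), s.nat 5 0 i = (x i).toNat) (i : Fin n) (τ : ℕ → Bool) :
    (s.afterCoins (n - q) y τ).nat 5 0 i = (joinBits q x y i).toNat := by
  by_cases h : (i : ℕ) < n - q
  · have : ¬ n - q ≤ i := by omega
    simp only [Memory.afterCoins, joinBits, dif_pos h]
    rw [if_neg (by omega), dif_neg (by omega)]
    exact hx ⟨i, h⟩
  · simp only [Memory.afterCoins, joinBits, dif_neg h]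
    rw [if_neg (by omega), dif_pos ⟨trivial, trivial, by omega, by omega⟩]

/-- The final states of the algorithm, depending only on the first `n` coins, and the eigenbases
that they describe. -/
theorem exists_final_states (D : Hamiltonian n m k) (hqn : q ≤ n) (hq : q = min D.dimK n) :
    ∃ (L : List (Gate n)) (E : Bits (n - q) → Bits q → ℝ)
      (φ : Bits (n - q) → OrthonormalBasis (Bits q) ℂ (EuclideanSpace ℂ (Bits q)))
      (F : Bits (n - q) → Bits q → Memory), GoodCircuit D q L ∧
      (∀ x y, D.block L q x *ᵥ (φ x y).ofLp = (E x y : ℂ) • (φ x y).ofLp) ∧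
      (∀ x y, Outputs (F x y) L x (φ x y).ofLp) ∧
      ∀ ω : ℕ → Bool, ∃ t, t ≤ 10000 * (n ^ 3 + m * n ^ 2 + 2 ^ (3 * D.dimK)) ∧
        Exec sampleProg (D.input ω) ((F (fun i => ω i) fun l => ω (n - q + l)).withTape
          fun l => ω (n - q + (q + l))) t := by
  -- The coin-free parts are run on an arbitrary tape, so that the circuit and the final memories
  -- can be chosen before the coins `ω` are known; the true tape is inserted at the end.
  obtain ⟨s₁, t₁, he₁, ht₁, L, hG, hC, h6, h8, hT, hI, h10⟩ :=
    runs_prepProg D (fun _ => false) hq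
  have S₁ : ∀ x : Bits (n - q), Same [5, 44] [] s₁ (s₁.afterCoins 0 x s₁.tape) := fun x =>
    s₁.afterCoins_same 0 x
  have hctx₁ : ∀ x : Bits (n - q), BlockCtx (s₁.afterCoins 0 x s₁.tape) L q x := fun x =>
    ⟨by simp [(S₁ x).nat, h6], by simp [(S₁ x).nat, h8], hC.same (S₁ x) (by decide),
      fun i => Memory.afterCoins_bits x i _, hT.same (S₁ x) (by decide) (by decide)⟩
  have hb := fun x : Bits (n - q) => runs_blockProg hG hqn (hctx₁ x)
    (hI.same (S₁ x) (by decide) (by decide)) h10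
  choose s₂ t₂ he₂ ht₂ hctx₂ htri using hb
  have S₂ : ∀ x (y : Bits q), Same [5, 44] [] (s₂ x) ((s₂ x).afterCoins (n - q) y (s₂ x).tape) :=
    fun x y => (s₂ x).afterCoins_same (n - q) y
  have hbits : ∀ x (y : Bits q) (i : Fin n),
      ((s₂ x).afterCoins (n - q) y (s₂ x).tape).nat 5 0 i = (joinBits q x y i).toNat :=
    fun x y i => Memory.afterCoins_joinBits hqn y (hctx₂ x).bits i _
  have hctx₃ : ∀ x (y : Bits q), BlockCtx ((s₂ x).afterCoins (n - q) y (s₂ x).tape) L q x := by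
    intro x y
    refine ⟨by simp [(S₂ x y).nat, (hctx₂ x).num], by simp [(S₂ x y).nat, (hctx₂ x).loc],
      (hctx₂ x).circ.same (S₂ x y) (by decide), fun i => ?_,
      (hctx₂ x).tables.same (S₂ x y) (by decide) (by decide)⟩
    rw [hbits x y ⟨i, by omega⟩]
    simp [joinBits]
  have he := fun x (y : Bits q) => runs_eigProg
    (A := Matrix.toEuclideanLin (D.numBlock L q x)) (hctx₃ x y) hqn (hbits x y) (htri x)
  choose F t₃ he₃ ht₃ S₃ hlen hloc S Lb hB hSi hiL hvec using he
  simp only [tailBits_joinBits] at hSi hiL hvec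
  have hbasis := fun x => exists_block_eigenbasis (D.numBlock_isHermitian L x) (htri x)
    (S := S x) (Lb := Lb x) (hB x) fun y => ⟨hSi x y, hiL x y⟩
  choose φ E hφ hE using hbasis
  refine ⟨L, E, φ, F, hG, hE, fun x y => ?_, fun ω => ?_⟩
  · have hctx := (hctx₃ x y).same (S₃ x y) (by decide) (by decide)
    refine ⟨hlen x y, hloc x y, fun t => hctx.circ.gate t t.2, hctx.bits, fun z => ?_⟩
    have h1 := congrFun (congrArg WithLp.ofLp (hvec x y)) (bitsEquiv q z)
    have h2 := (hφ x y z).trans h1.symm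
    rw [ofBits_eq_sum, h2]
    exact ⟨rfl, rfl⟩
  · set x : Bits (n - q) := fun i => ω i with hx
    set y : Bits q := fun l => ω (n - q + l) with hy
    have c₁ := he₁.withTape (τ := ω) (by rfl)
    obtain ⟨_, u₁, d₁, hu₁, rfl⟩ := runs_coinsProg (s := s₁.withTape ω) (base := 0)
      (N := nv 6 - nv 8) (B := 0) (M := n - q) (fun _ _ => rfl) fun s' hs' => by
        simp [hs', h6, h8]
    have c₂ := (he₂ x).withTape (τ := fun l => ω (n - q + l)) (by rfl)
    obtain ⟨_, u₂, d₂, hu₂, rfl⟩ := runs_coinsProg (s := (s₂ x).withTape fun l => ω (n - q + l))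
      (base := nv 6 - nv 8) (N := nv 8) (B := n - q) (M := q)
      (fun s' hs' => by simp [hs', (hctx₂ x).num, (hctx₂ x).loc])
      fun s' hs' => by simp [hs', (hctx₂ x).loc]
    have c₃ := (he₃ x y).withTape (τ := fun l => ω (n - q + (q + l))) (by rfl)
    refine ⟨_, ?_, .seq c₁ (.seq d₁ (.seq c₂ (.seq d₂ c₃)))⟩
    have e1 := D.terms_le
    -- This uses `q ≤ |K|`; the cost in terms of `q` is thereby bounded by the cost in terms of
    -- `|K|`.
    have e2 : 8 ^ q ≤ 2 ^ (3 * D.dimK) := by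
      rw [pow_mul]
      exact Nat.pow_le_pow_right (by norm_num) (by omega)
    have e3 : n ≤ n ^ 3 := Nat.le_self_pow (by norm_num) _
    have e4 : 1 ≤ 2 ^ (3 * D.dimK) := Nat.one_le_two_pow
    have e5 := ht₂ x
    have e6 := ht₃ x y
    omega

theorem Outputs.eq_of_eq {s s' : Memory} {L : List (Gate n)} {x x' : Bits (n - q)}
    {φ φ' : Bits q → ℂ} (h : Outputs s L x φ) (h' : Outputs s' L x' φ') (hn : s.nat = s'.nat)
    (hr : s.real = s'.real) : x = x' ∧ φ = φ' := by
  obtain ⟨-, -, -, h1, h2⟩ := h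
  obtain ⟨-, -, -, h1', h2'⟩ := h'
  rw [← hn] at h1'
  rw [← hr] at h2'
  constructor
  · funext i
    have := (h1 i).symm.trans (h1' i)
    cases hx : x i <;> cases hx' : x' i <;> simp [hx, hx'] at this ⊢
  · funext y
    exact Complex.ext ((h2 y).1.symm.trans (h2' y).1) ((h2 y).2.symm.trans (h2' y).2)

end DopedStab

theorem theorem2 :
    ∃ (prog : Program) (c : ℕ), ∀ (n m k : ℕ) (D : Hamiltonian n m k) (q : ℕ) (hq : q ≤ n),
      q = min D.dimK n →
      -- a Clifford circuit, the blocks, their energies and their eigenbases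
      ∃ (C : List (Gate n)) (B : Bits (n - q) → Matrix (Bits q) (Bits q) ℂ)
        (E : Bits (n - q) → Bits q → ℝ)
        (φ : Bits (n - q) → OrthonormalBasis (Bits q) ℂ (EuclideanSpace ℂ (Bits q)))
        (ψ : OrthonormalBasis (Bits (n - q) × Bits q) ℂ (EuclideanSpace ℂ (Bits n))),
        circuitMat C * D.mat * (circuitMat C)ᴴ = blockMat hq B ∧
        (∀ x i, B x *ᵥ (φ x i).ofLp = (E x i : ℂ) • (φ x i).ofLp) ∧
        -- the corresponding eigenbasis of the Hamiltonian
        (∀ x i, (ψ (x, i)).ofLp = (circuitMat C)ᴴ *ᵥ tensorKet hq x (φ x i).ofLp) ∧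
        (∀ x i, D.mat *ᵥ (ψ (x, i)).ofLp = (E x i : ℂ) • (ψ (x, i)).ofLp) ∧
        -- the program always halts in time and outputs an element of this eigenbasis
        (∀ ω : ℕ → Bool, ∃ (s : Memory) (t : ℕ), Exec prog (D.input ω) s t ∧
          t ≤ c * (n ^ 3 + m * n ^ 2 + 2 ^ (3 * D.dimK)) ∧
          ∃ x i, Outputs s C x (φ x i).ofLp) ∧
        -- each of the `2 ^ n` elements is output with the same probability
        (∀ x i, coinMeasure {ω | ∃ (s : Memory) (t : ℕ), Exec prog (D.input ω) s t ∧
          Outputs s C x (φ x i).ofLp} = ((1 : ENNReal) / 2) ^ n) := by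
  refine ⟨sampleProg, 10000, fun n m k D q hqn hq => ?_⟩
  obtain ⟨L, E, φ, F, hG, hE, hout, hex⟩ := exists_final_states D hqn hq
  obtain ⟨ψ, hψ⟩ := exists_eigenbasis hqn L φ
  have hB := hG.eq_blockMat hqn
  refine ⟨L, D.block L q, E, φ, ψ, hB, hE, hψ, fun x i => ?_, fun ω => ?_, fun x i => ?_⟩
  · rw [hψ]
    exact mulVec_of_block hqn hB (hE x i)
  · obtain ⟨t, ht, he⟩ := hex ω
    exact ⟨_, t, he, ht, _, _, hout _ _⟩
  -- The event is the set of coin sequences that begin with `x` followed by `i`.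
  · rw [← coinMeasure_cylinder (joinBits q x i)]
    congr 1
    ext ω
    constructor
    · rintro ⟨s, t, he, ho⟩ l
      obtain ⟨t', -, he'⟩ := hex ω
      have hs := he.deterministic he'
      obtain ⟨h1, h2⟩ := ho.eq_of_eq (hout _ _) (by rw [hs]; rfl) (by rw [hs]; rfl)
      subst h1
      -- The vectors of an orthonormal basis are different, so the amplitudes in the output
      -- determine the index.
      have h3 := (φ _).orthonormal.linearIndependent.injective (WithLp.ofLp_injective 2 h2)
      rw [h3, joinBits]
      split_ifs with hl
      · rfl
      · simp only
        congr 1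
        omega
    · intro h
      obtain ⟨t, -, he⟩ := hex ω
      have h1 : (fun j : Fin (n - q) => ω j) = x := by
        funext j
        have := h ⟨j, by omega⟩
        simpa [joinBits] using this
      have h2 : (fun l : Fin q => ω (n - q + l)) = i := by
        funext l
        have := h ⟨n - q + l, by omega⟩
        simpa [joinBits] using this
      rw [h1, h2] at he
      exact ⟨_, t, he, hout x i⟩
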